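/- Let $T^X$ be the set of finite types over the ground types $0$ (natural numbers) and $X$, with $\tau(\rho)$ the type of functionals from $\rho$ to $\tau$, and $1:=0(0)$. Let $\mathrm{WE}\text{-}\mathrm{PA}^\omega$ be classical Peano arithmetic in all types of $T^X$: a many-sorted classical theory whose only relation symbol is $=_0$, with constants $0$, $S$, the combinators $\Pi,\Sigma$ and the simultaneous primitive recursors in all types, their defining axioms, the axioms of equality and successor, full induction, and the quantifier-free extensionality rule (from $A_0\to s=_\rho t$ infer $A_0\to r[s/x]=_\tau r[t/x]$, for $A_0$ quantifier-free). Equality at higher types is pointwise, and $x=_Xy$ abbreviates $\|x-_Xy\|_X=_{\mathbb R}0$. Rationals are coded by objects of type $0$ through a pairing function, and reals are represented by objects of type $1$ (sequences $f$ of rationals with $|f(n)-f(n+1)|<2^{-n-1}$; every $f$ of type $1$ represents a real, namely that of the sequence $\hat f$ which follows $f$ and stays constant from the first violation of this condition on); $=_{\mathbb R},<_{\mathbb R},\le_{\mathbb R}$ are the corresponding formulas and $+,\cdot,|\cdot|$ the corresponding closed terms. A formula containing a reciprocal $\gamma^{-1}$ under the premise $\gamma>_{\mathbb R}0$ stands for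 the one with an additional universally quantified variable $l$ of type $0$, with $\gamma>_{\mathbb R}0$ replaced by $\gamma>_{\mathbb R}2^{-l}$ and $\gamma^{-1}$ replaced by $(\gamma)^{-1}_l$, where $(\cdot)^{-1}_l$ is a closed term representing the reciprocal of all reals of absolute value greater than $2^{-l}$. Let $\mathcal V^\omega$ be the extension of $\mathrm{WE}\text{-}\mathrm{PA}^\omega$ by quantifier-free choice and dependent choice in all types (for tuples of variables), by constants $0_X,1_X,+_X,-_X,\cdot_X,\|\cdot\|_X$ with axioms stating that $X$ is a real normed space with $\|1_X\|_X=_{\mathbb R}1$ (the vector space axioms for $=_X$ and the usual norm axioms, from which extensionality of all these operations follows), and by constants $\chi_A$ of type $0(X)(X)$, $J^{\chi_A}$ of type $X(X)(1)$, $\tilde\gamma$ of type $1$, $m_{\tilde\gamma}$ of type $0$ and $c_X$ of type $X$. Write $u\in Ax$ for $\chi_Axu=_00$ and $J^A_\gamma$ for $J^{\chi_A}\gamma$. The axioms for the latter constants are (I) $\forall x^X,y^X\,(\chi_Axy\le_0 1)$; (II) $\forall\gamma^1,x^X\,\big(\gamma>_{\mathbb R}0\to\gamma^{-1}(x-_XJ^A_\gamma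 x)\in A(J^A_\gamma x)\big)$; (III) $\forall x^X,y^X,u^X,v^X,\lambda^1\,\big(u\in Ax\wedge v\in Ay\to\|x-_Xy+_X|\lambda|(u-_Xv)\|_X\ge_{\mathbb R}\|x-_Xy\|_X\big)$; (IV) $\tilde\gamma\ge_{\mathbb R}2^{-m_{\tilde\gamma}}$. Then $\mathcal V^\omega$ proves each of the following sentences. (1) $J^A_\gamma$ is unique for any $\gamma>0$: $$\forall\gamma^1,p^X,x^X\,\big(\gamma>_{\mathbb R}0\wedge\gamma^{-1}(x-_Xp)\in Ap\to p=_XJ^A_\gamma x\big).$$ (2) $J^A_\gamma$ is firmly nonexpansive for any $\gamma>0$: $$\forall\gamma^1,r^1,x^X,y^X\,\big(\gamma>_{\mathbb R}0\wedge r>_{\mathbb R}0\to\|J^A_\gamma x-_XJ^A_\gamma y\|_X\le_{\mathbb R}\|r(x-_Xy)+_X(1-r)(J^A_\gamma x-_XJ^A_\gamma y)\|_X\big).$$ (3) $J^A_\gamma$ is nonexpansive for any $\gamma>0$: $$\forall\gamma^1,x^X,y^X\,\big(\gamma>_{\mathbb R}0\to\|x-_Xy\|_X\ge_{\mathbb R}\|J^A_\gamma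 x-_XJ^A_\gamma y\|_X\big).$$ (4) $J^{\chi_A}$ is extensional in both arguments: $$\forall\gamma^1,{\gamma'}^1,x^X,{x'}^X\,\big(\gamma>_{\mathbb R}0\wedge\gamma'>_{\mathbb R}0\wedge x=_Xx'\wedge\gamma=_{\mathbb R}\gamma'\to J^A_\gamma x=_XJ^A_{\gamma'}x'\big).$$ -/

import Mathlib

namespace FinType

/-! ### Finite types over `0` and the abstract type `X` -/

/-- The set of types `T^X`; `arr ρ τ` is the type `τ(ρ)` of functionals from `ρ` to `τ`. -/
inductive Ty : Type
  | nat : Ty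
  | X : Ty
  | arr (ρ τ : Ty) : Ty
  deriving DecidableEq

infixr:60 " ⟶ₜ " => Ty.arr

/-- The type `1 = 0(0)`; reals are represented by objects of this type. -/
abbrev Ty.one : Ty := Ty.nat ⟶ₜ Ty.nat

/-- `arrs ρ τ` is `τ(ρ_{k-1})…(ρ_0)`: functionals taking `ρ_0, …, ρ_{k-1}`, in this order, to `τ`. -/
def Ty.arrs : {k : ℕ} → (Fin k → Ty) → Ty → Ty
  | 0, _, τ => τ
  | _ + 1, ρ, τ => ρ 0 ⟶ₜ Ty.arrs (fun i => ρ i.succ) τ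

/-- The constants of the language. -/
inductive Cst : Ty → Type
  -- arithmetic in all finite types
  | zero : Cst Ty.nat
  | succ : Cst (Ty.nat ⟶ₜ Ty.nat)
  | proj (ρ τ : Ty) : Cst (ρ ⟶ₜ τ ⟶ₜ ρ)
  | comb (δ ρ τ : Ty) : Cst ((δ ⟶ₜ ρ ⟶ₜ τ) ⟶ₜ (δ ⟶ₜ ρ) ⟶ₜ δ ⟶ₜ τ)
  /-- the `i`-th component of the simultaneous recursor for the tuple of types `ρ` -/
  | recr {k : ℕ} (ρ : Fin k → Ty) (i : Fin k) :
      Cst (Ty.nat ⟶ₜ Ty.arrs ρ (Ty.arrs (fun j => Ty.arrs ρ (Ty.nat ⟶ₜ ρ j)) (ρ i)))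
  -- the normed space
  | zeroX : Cst Ty.X
  | oneX : Cst Ty.X
  | plusX : Cst (Ty.X ⟶ₜ Ty.X ⟶ₜ Ty.X)
  | negX : Cst (Ty.X ⟶ₜ Ty.X)
  | smulX : Cst (Ty.one ⟶ₜ Ty.X ⟶ₜ Ty.X)
  | normX : Cst (Ty.X ⟶ₜ Ty.one)
  -- the operator, its resolvent, and the constants needed for majorization
  | chiA : Cst (Ty.X ⟶ₜ Ty.X ⟶ₜ Ty.nat)
  | resA : Cst (Ty.one ⟶ₜ Ty.X ⟶ₜ Ty.X)
  | gammaT : Cst Ty.one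
  | mT : Cst Ty.nat
  | cX : Cst Ty.X

/-! ### Terms and formulas

Variables are de Bruijn indices counted separately for every type: `var τ n` refers to the `n`-th
innermost enclosing binder of type `τ`, or to a free variable if there is no such binder. -/

inductive Tm : Ty → Type
  | var (τ : Ty) (n : ℕ) : Tm τ
  | cst {τ : Ty} (c : Cst τ) : Tm τ
  | app {ρ τ : Ty} (t : Tm (ρ ⟶ₜ τ)) (s : Tm ρ) : Tm τ

infixl:90 " ⬝ " => Tm.app

/-- Formulas; equality of type `0` is the only relation symbol. -/
inductive Fm : Type
  | eq (s t : Tm Ty.nat) : Fm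
  | and (φ ψ : Fm) : Fm
  | or (φ ψ : Fm) : Fm
  | imp (φ ψ : Fm) : Fm
  | all (τ : Ty) (φ : Fm) : Fm
  | ex (τ : Ty) (φ : Fm) : Fm

infix:50 " ≐ " => Fm.eq
infixr:35 " ⊓ᶠ " => Fm.and
infixr:30 " ⇒ᶠ " => Fm.imp

/-- Quantifier-free formulas. -/
def Fm.QF : Fm → Prop
  | .eq _ _ => True
  | .and φ ψ => φ.QF ∧ ψ.QF
  | .or φ ψ => φ.QF ∧ ψ.QF
  | .imp φ ψ => φ.QF ∧ ψ.QF
  | .all _ _ => False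
  | .ex _ _ => False

/-- Simultaneous substitutions. -/
abbrev Sub : Type := (τ : Ty) → ℕ → Tm τ

def Tm.subst (σ : Sub) : {τ : Ty} → Tm τ → Tm τ
  | _, .var τ n => σ τ n
  | _, .cst c => .cst c
  | _, .app t s => .app (t.subst σ) (s.subst σ)

/-- The innermost variable of type `ρ` goes to `t`, the other variables are treated by `σ`. -/
def Sub.cons {ρ : Ty} (t : Tm ρ) (σ : Sub) : Sub := fun τ n =>
  if h : ρ = τ then
    match n with
    | 0 => h ▸ t
    | n + 1 => σ τ n
  else σ τ n

/-- Weakening by one new innermost variable of type `ρ`. -/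
def Sub.shift (ρ : Ty) : Sub := fun τ n => if ρ = τ then .var τ (n + 1) else .var τ n

/-- The substitution `σ` below a binder of type `ρ`. -/
def Sub.lift (ρ : Ty) (σ : Sub) : Sub :=
  Sub.cons (.var ρ 0) (fun τ n => (σ τ n).subst (Sub.shift ρ))

/-- Capture-avoiding substitution. -/
def Fm.subst (σ : Sub) : Fm → Fm
  | .eq s t => .eq (s.subst σ) (t.subst σ)
  | .and φ ψ => .and (φ.subst σ) (ψ.subst σ)
  | .or φ ψ => .or (φ.subst σ) (ψ.subst σ)
  | .imp φ ψ => .imp (φ.subst σ) (ψ.subst σ)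
  | .all τ φ => .all τ (φ.subst (Sub.lift τ σ))
  | .ex τ φ => .ex τ (φ.subst (Sub.lift τ σ))

/-- Substitution of `t` for the innermost variable of its type. -/
def Sub.inst {ρ : Ty} (t : Tm ρ) : Sub := Sub.cons t Tm.var

def Tm.wk (ρ : Ty) {τ : Ty} (t : Tm τ) : Tm τ := t.subst (Sub.shift ρ)

def Fm.wk (ρ : Ty) (φ : Fm) : Fm := φ.subst (Sub.shift ρ)

/-! Tuples of types, terms and quantifiers; the last component is the innermost one. -/

def Tm.apps : {k : ℕ} → {ρ : Fin k → Ty} → {τ : Ty} →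
    Tm (Ty.arrs ρ τ) → ((i : Fin k) → Tm (ρ i)) → Tm τ
  | 0, _, _, t, _ => t
  | _ + 1, _, _, t, s => Tm.apps (Tm.app t (s 0)) (fun i => s i.succ)

def Fm.alls : {k : ℕ} → (Fin k → Ty) → Fm → Fm
  | 0, _, φ => φ
  | _ + 1, ρ, φ => .all (ρ 0) (Fm.alls (fun i => ρ i.succ) φ)

def Fm.exs : {k : ℕ} → (Fin k → Ty) → Fm → Fm
  | 0, _, φ => φ
  | _ + 1, ρ, φ => .ex (ρ 0) (Fm.exs (fun i => ρ i.succ) φ)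

/-- The variables of the tuple `ρ` go to the terms `t`, the other variables are treated by `σ`. -/
def Sub.conss : {k : ℕ} → {ρ : Fin k → Ty} → ((i : Fin k) → Tm (ρ i)) → Sub → Sub
  | 0, _, _, σ => σ
  | _ + 1, _, t, σ => Sub.conss (fun i => t i.succ) (Sub.cons (t 0) σ)

/-- Weakening of a term by a tuple of new innermost variables. -/
def Tm.wks : {k : ℕ} → (Fin k → Ty) → {τ : Ty} → Tm τ → Tm τ
  | 0, _, _, t => t
  | _ + 1, ρ, _, t => Tm.wks (fun i => ρ i.succ) (t.wk (ρ 0))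

/-- The variables bound by an innermost tuple of binders of types `ρ`. -/
def Tm.vars : {k : ℕ} → (ρ : Fin k → Ty) → (i : Fin k) → Tm (ρ i)
  | 0, _ => fun i => i.elim0
  | _ + 1, ρ => Fin.cases (Tm.wks (fun i => ρ i.succ) (.var (ρ 0) 0))
      (Tm.vars (fun i => ρ i.succ))

/-! ### Abstraction by combinators -/

/-- `K t` for the projector `K`. -/
def Tm.const (ρ : Ty) {τ : Ty} (t : Tm τ) : Tm (ρ ⟶ₜ τ) := .cst (.proj τ ρ) ⬝ t

/-- The identity `S K K`. -/
def Tm.idt (ρ : Ty) : Tm (ρ ⟶ₜ ρ) :=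
  .cst (.comb ρ (ρ ⟶ₜ ρ) ρ) ⬝ .cst (.proj ρ (ρ ⟶ₜ ρ)) ⬝ .cst (.proj ρ ρ)

/-- Terms without variables. -/
def Tm.closed : {τ : Ty} → Tm τ → Bool
  | _, .var _ _ => false
  | _, .cst _ => true
  | _, .app t s => t.closed && s.closed

/-- `λ x^ρ. t`, where `x` is the innermost variable of type `ρ`. Closed terms are left intact and
turned into constant functions. -/
def Tm.lam (ρ : Ty) : {τ : Ty} → Tm τ → Tm (ρ ⟶ₜ τ)
  | _, .var τ n =>
    if h : ρ = τ then
      match n with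
      | 0 => Eq.rec (motive := fun τ _ => Tm (ρ ⟶ₜ τ)) (Tm.idt ρ) h
      | n + 1 => Tm.const ρ (.var τ n)
    else Tm.const ρ (.var τ n)
  | _, .cst c => Tm.const ρ (.cst c)
  | _, .app t s =>
    if (Tm.app t s).closed then Tm.const ρ (.app t s)
    else .cst (.comb ρ _ _) ⬝ Tm.lam ρ t ⬝ Tm.lam ρ s

/-! ### Arithmetic of type `0` -/

abbrev nv (n : ℕ) : Tm Ty.nat := .var Ty.nat n
abbrev rv (n : ℕ) : Tm Ty.one := .var Ty.one n
abbrev xv (n : ℕ) : Tm Ty.X := .var Ty.X n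

abbrev lamN {τ : Ty} (t : Tm τ) : Tm (Ty.nat ⟶ₜ τ) := Tm.lam Ty.nat t
abbrev lamR {τ : Ty} (t : Tm τ) : Tm (Ty.one ⟶ₜ τ) := Tm.lam Ty.one t

abbrev Op1 : Ty := Ty.nat ⟶ₜ Ty.nat
abbrev Op2 : Ty := Ty.nat ⟶ₜ Ty.nat ⟶ₜ Ty.nat

def O : Tm Ty.nat := .cst .zero
def Sc (t : Tm Ty.nat) : Tm Ty.nat := .cst .succ ⬝ t

/-- `recN n b s`: primitive recursion with `recN 0 b s = b`, `recN (n + 1) b s = s (recN n b s) n`. -/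
def recN (n b : Tm Ty.nat) (s : Tm Op2) : Tm Ty.nat :=
  Tm.app (ρ := Op2) (Tm.app (ρ := Ty.nat)
    (Tm.app (.cst (.recr (k := 1) (fun _ => Ty.nat) 0)) n) b) s

def plusT : Tm Op2 := lamN (lamN (recN (nv 0) (nv 1) (lamN (lamN (Sc (nv 1))))))
abbrev plusN (s t : Tm Ty.nat) : Tm Ty.nat := plusT ⬝ s ⬝ t

def timesT : Tm Op2 := lamN (lamN (recN (nv 0) O (lamN (lamN (plusN (nv 1) (nv 3))))))
abbrev timesN (s t : Tm Ty.nat) : Tm Ty.nat := timesT ⬝ s ⬝ t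

def predT : Tm Op1 := lamN (recN (nv 0) O (lamN (lamN (nv 0))))
abbrev predN (t : Tm Ty.nat) : Tm Ty.nat := predT ⬝ t

/-- truncated subtraction -/
def monusT : Tm Op2 := lamN (lamN (recN (nv 0) (nv 1) (lamN (lamN (predN (nv 1))))))
abbrev monusN (s t : Tm Ty.nat) : Tm Ty.nat := monusT ⬝ s ⬝ t

/-- `condN c a b` is `a` if `c = 0` and `b` otherwise. -/
def condT : Tm (Ty.nat ⟶ₜ Op2) :=
  lamN (lamN (lamN (recN (nv 2) (nv 1) (lamN (lamN (nv 2))))))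
abbrev condN (c a b : Tm Ty.nat) : Tm Ty.nat := condT ⬝ c ⬝ a ⬝ b

/-- `n ↦ 2 ^ n` -/
def powT : Tm Op1 := lamN (recN (nv 0) (Sc O) (lamN (lamN (plusN (nv 1) (nv 1)))))
abbrev powN (t : Tm Ty.nat) : Tm Ty.nat := powT ⬝ t

/-- triangular numbers `n ↦ n (n + 1) / 2` -/
def triT : Tm Op1 := lamN (recN (nv 0) O (lamN (lamN (plusN (nv 1) (Sc (nv 0))))))
abbrev triN (t : Tm Ty.nat) : Tm Ty.nat := triT ⬝ t

/-- The pairing function `j (n, m) = ((n + m) ^ 2 + 3 n + m) / 2`. -/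
def pairT : Tm Op2 := lamN (lamN (plusN (triN (plusN (nv 1) (nv 0))) (nv 1)))
abbrev pairN (s t : Tm Ty.nat) : Tm Ty.nat := pairT ⬝ s ⬝ t

/-- `diagN u` is the largest `w` whose triangular number is at most `u`. -/
def diagT : Tm Op1 := lamN (recN (nv 0) O (lamN (lamN
  (condN (monusN (triN (Sc (nv 1))) (Sc (nv 0))) (Sc (nv 1)) (nv 1)))))
abbrev diagN (t : Tm Ty.nat) : Tm Ty.nat := diagT ⬝ t

/-- the projections of the pairing function -/
def fstT : Tm Op1 := lamN (monusN (nv 0) (triN (diagN (nv 0))))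
abbrev fstN (t : Tm Ty.nat) : Tm Ty.nat := fstT ⬝ t
def sndT : Tm Op1 := lamN (monusN (diagN (nv 0)) (fstN (nv 0)))
abbrev sndN (t : Tm Ty.nat) : Tm Ty.nat := sndT ⬝ t

/-- remainder and quotient by `2` -/
def parT : Tm Op1 := lamN (recN (nv 0) O (lamN (lamN (monusN (Sc O) (nv 1)))))
abbrev parN (t : Tm Ty.nat) : Tm Ty.nat := parT ⬝ t
def halfT : Tm Op1 := lamN (recN (nv 0) O (lamN (lamN (plusN (nv 1) (parN (nv 0))))))
abbrev halfN (t : Tm Ty.nat) : Tm Ty.nat := halfT ⬝ t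

/-! ### Rationals

The code `j (n, m)` stands for `(n / 2) / (m + 1)` if `n` is even and for `- ((n + 1) / 2) / (m + 1)`
if `n` is odd. The numerator is `posQ - negpQ`, with one of the two equal to `0`. -/

def posT : Tm Op1 :=
  lamN (condN (parN (fstN (nv 0))) (halfN (fstN (nv 0))) O)
abbrev posQ (t : Tm Ty.nat) : Tm Ty.nat := posT ⬝ t
def negpT : Tm Op1 :=
  lamN (condN (parN (fstN (nv 0))) O (Sc (halfN (fstN (nv 0)))))
abbrev negpQ (t : Tm Ty.nat) : Tm Ty.nat := negpT ⬝ t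
/-- the denominator -/
abbrev denQ (t : Tm Ty.nat) : Tm Ty.nat := Sc (sndN t)

/-- `mkQ a b d` is a code of `(a - b) / d`, for `d > 0`. -/
def mkT : Tm (Ty.nat ⟶ₜ Op2) := lamN (lamN (lamN (pairN
  (condN (monusN (nv 1) (nv 2)) (timesN (Sc (Sc O)) (monusN (nv 2) (nv 1)))
    (predN (timesN (Sc (Sc O)) (monusN (nv 1) (nv 2)))))
  (predN (nv 0)))))
abbrev mkQ (a b d : Tm Ty.nat) : Tm Ty.nat := mkT ⬝ a ⬝ b ⬝ d

def plusQT : Tm Op2 := lamN (lamN (mkQ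
  (plusN (timesN (posQ (nv 1)) (denQ (nv 0))) (timesN (posQ (nv 0)) (denQ (nv 1))))
  (plusN (timesN (negpQ (nv 1)) (denQ (nv 0))) (timesN (negpQ (nv 0)) (denQ (nv 1))))
  (timesN (denQ (nv 1)) (denQ (nv 0)))))
abbrev plusQ (s t : Tm Ty.nat) : Tm Ty.nat := plusQT ⬝ s ⬝ t

def timesQT : Tm Op2 := lamN (lamN (mkQ
  (plusN (timesN (posQ (nv 1)) (posQ (nv 0))) (timesN (negpQ (nv 1)) (negpQ (nv 0))))
  (plusN (timesN (posQ (nv 1)) (negpQ (nv 0))) (timesN (negpQ (nv 1)) (posQ (nv 0))))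
  (timesN (denQ (nv 1)) (denQ (nv 0)))))
abbrev timesQ (s t : Tm Ty.nat) : Tm Ty.nat := timesQT ⬝ s ⬝ t

def negQT : Tm Op1 := lamN (mkQ (negpQ (nv 0)) (posQ (nv 0)) (denQ (nv 0)))
abbrev negQ (t : Tm Ty.nat) : Tm Ty.nat := negQT ⬝ t

def absQT : Tm Op1 := lamN (mkQ (plusN (posQ (nv 0)) (negpQ (nv 0))) O (denQ (nv 0)))
abbrev absQ (t : Tm Ty.nat) : Tm Ty.nat := absQT ⬝ t

/-- the reciprocal, with value `0` at `0` -/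
def invQT : Tm Op1 := lamN (mkQ
  (condN (posQ (nv 0)) O (denQ (nv 0))) (condN (negpQ (nv 0)) O (denQ (nv 0)))
  (plusN (posQ (nv 0)) (negpQ (nv 0))))
abbrev invQ (t : Tm Ty.nat) : Tm Ty.nat := invQT ⬝ t

/-- a code of `2 ^ (-n)` -/
def tpowT : Tm Op1 := lamN (mkQ (Sc O) O (powN (nv 0)))
abbrev tpowQ (t : Tm Ty.nat) : Tm Ty.nat := tpowT ⬝ t

/-- a code of the natural number `n` -/
def natQT : Tm Op1 := lamN (mkQ (nv 0) O (Sc O))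
abbrev natQ (t : Tm Ty.nat) : Tm Ty.nat := natQT ⬝ t

/-- `ltcQ s t = 0` iff `s < t`, and `lecQ s t = 0` iff `s ≤ t`. -/
def ltcT : Tm Op2 := lamN (lamN (monusN
  (Sc (plusN (timesN (posQ (nv 1)) (denQ (nv 0))) (timesN (negpQ (nv 0)) (denQ (nv 1)))))
  (plusN (timesN (posQ (nv 0)) (denQ (nv 1))) (timesN (negpQ (nv 1)) (denQ (nv 0))))))
abbrev ltcQ (s t : Tm Ty.nat) : Tm Ty.nat := ltcT ⬝ s ⬝ t
def lecT : Tm Op2 := lamN (lamN (monusN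
  (plusN (timesN (posQ (nv 1)) (denQ (nv 0))) (timesN (negpQ (nv 0)) (denQ (nv 1))))
  (plusN (timesN (posQ (nv 0)) (denQ (nv 1))) (timesN (negpQ (nv 1)) (denQ (nv 0))))))
abbrev lecQ (s t : Tm Ty.nat) : Tm Ty.nat := lecT ⬝ s ⬝ t

def Fm.ltQ (s t : Tm Ty.nat) : Fm := ltcQ s t ≐ O
def Fm.leQ (s t : Tm Ty.nat) : Fm := lecQ s t ≐ O

/-- the distance of two rationals -/
abbrev distQ (s t : Tm Ty.nat) : Tm Ty.nat := absQ (plusQ s (negQ t))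

/-! ### Reals

A real is represented by a sequence `f` of rationals with `|f n - f (n + 1)| < 2 ^ (-n-1)`. Every `f`
of type `1` represents a real through `hat f`, which follows `f` and stays at `f k` for the least `k`
with `|f k - f (k + 1)| ≥ 2 ^ (-k-1)`, if there is one. -/

def hatT : Tm (Ty.one ⟶ₜ Ty.one) := lamR (lamN (rv 0 ⬝
  recN (nv 0) O (lamN (lamN (condN
    (plusN (monusN (nv 0) (nv 1))
      (ltcQ (distQ (rv 0 ⬝ nv 0) (rv 0 ⬝ Sc (nv 0))) (tpowQ (Sc (nv 0)))))
    (Sc (nv 0)) (nv 1))))))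
abbrev hat (f : Tm Ty.one) : Tm Ty.one := hatT ⬝ f

/-- the real given by a rational, as a constant sequence -/
abbrev ratR (q : Tm Ty.nat) : Tm Ty.one := Tm.const Ty.nat q
def zeroR : Tm Ty.one := ratR (natQ O)
def oneR : Tm Ty.one := ratR (natQ (Sc O))
/-- the real `2 ^ (-l)` -/
abbrev tpowR (l : Tm Ty.nat) : Tm Ty.one := ratR (tpowQ l)

def plusRT : Tm (Ty.one ⟶ₜ Ty.one ⟶ₜ Ty.one) := lamR (lamR (lamN
  (plusQ (hat (rv 1) ⬝ Sc (nv 0)) (hat (rv 0) ⬝ Sc (nv 0)))))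
abbrev plusR (f g : Tm Ty.one) : Tm Ty.one := plusRT ⬝ f ⬝ g

def negRT : Tm (Ty.one ⟶ₜ Ty.one) := lamR (lamN (negQ (hat (rv 0) ⬝ nv 0)))
abbrev negR (f : Tm Ty.one) : Tm Ty.one := negRT ⬝ f
abbrev minusR (f g : Tm Ty.one) : Tm Ty.one := plusR f (negR g)

def absRT : Tm (Ty.one ⟶ₜ Ty.one) := lamR (lamN (absQ (hat (rv 0) ⬝ nv 0)))
abbrev absR (f : Tm Ty.one) : Tm Ty.one := absRT ⬝ f

/-- a natural number that is at least `|q| + 1` -/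
abbrev boundQ (q : Tm Ty.nat) : Tm Ty.nat := Sc (plusN (posQ q) (negpQ q))

/-- The product: the index is shifted by a natural number that is at least `|f 0| + 1` and
`|g 0| + 1`. -/
def timesRT : Tm (Ty.one ⟶ₜ Ty.one ⟶ₜ Ty.one) := lamR (lamR (lamN (timesQ
  (hat (rv 1) ⬝ plusN (nv 0) (plusN (boundQ (rv 1 ⬝ O)) (boundQ (rv 0 ⬝ O))))
  (hat (rv 0) ⬝ plusN (nv 0) (plusN (boundQ (rv 1 ⬝ O)) (boundQ (rv 0 ⬝ O)))))))
abbrev timesR (f g : Tm Ty.one) : Tm Ty.one := timesRT ⬝ f ⬝ g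

/-- The reciprocal `(f)⁻¹_l`, which represents `1 / f` if `|f| > 2 ^ (-l)`. -/
def invRT : Tm (Ty.one ⟶ₜ Ty.nat ⟶ₜ Ty.one) := lamR (lamN (lamN
  (invQ (hat (rv 0) ⬝ plusN (nv 0) (timesN (Sc (Sc O)) (Sc (nv 1)))))))
abbrev invR (f : Tm Ty.one) (l : Tm Ty.nat) : Tm Ty.one := invRT ⬝ f ⬝ l

def Fm.bot : Fm := O ≐ Sc O
def Fm.neg (φ : Fm) : Fm := φ ⇒ᶠ Fm.bot

/-- `f =_ℝ g` -/
def Fm.eqR (f g : Tm Ty.one) : Fm :=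
  .all Ty.nat (Fm.ltQ
    (distQ (hat (f.wk Ty.nat) ⬝ Sc (nv 0)) (hat (g.wk Ty.nat) ⬝ Sc (nv 0))) (tpowQ (nv 0)))

/-- `f <_ℝ g` -/
def Fm.ltR (f g : Tm Ty.one) : Fm :=
  .ex Ty.nat (Fm.leQ (tpowQ (nv 0))
    (plusQ (hat (g.wk Ty.nat) ⬝ Sc (nv 0)) (negQ (hat (f.wk Ty.nat) ⬝ Sc (nv 0)))))

/-- `f ≤_ℝ g` -/
def Fm.leR (f g : Tm Ty.one) : Fm := Fm.neg (Fm.ltR g f)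

/-! ### The normed space, the operator and the resolvent -/

abbrev vplus (x y : Tm Ty.X) : Tm Ty.X := .cst .plusX ⬝ x ⬝ y
abbrev vneg (x : Tm Ty.X) : Tm Ty.X := .cst .negX ⬝ x
abbrev vminus (x y : Tm Ty.X) : Tm Ty.X := vplus x (vneg y)
abbrev vsmul (a : Tm Ty.one) (x : Tm Ty.X) : Tm Ty.X := .cst .smulX ⬝ a ⬝ x
abbrev vnorm (x : Tm Ty.X) : Tm Ty.one := .cst .normX ⬝ x

/-- the resolvent `J^A_γ x` -/
abbrev J (γ : Tm Ty.one) (x : Tm Ty.X) : Tm Ty.X := .cst .resA ⬝ γ ⬝ x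

/-- `y ∈ A x` -/
def Fm.inA (y x : Tm Ty.X) : Fm := .cst .chiA ⬝ x ⬝ y ≐ O

/-- Equality of arbitrary type: equality of type `X` is `‖x - y‖ =_ℝ 0`, and equality of functionals
is pointwise equality. -/
def Fm.eqT : (ρ : Ty) → Tm ρ → Tm ρ → Fm
  | .nat, s, t => s ≐ t
  | .X, s, t => Fm.eqR (vnorm (vminus s t)) zeroR
  | .arr ρ τ, s, t => .all ρ (Fm.eqT τ (s.wk ρ ⬝ .var ρ 0) (t.wk ρ ⬝ .var ρ 0))

abbrev Fm.eqX (x y : Tm Ty.X) : Fm := Fm.eqT Ty.X x y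

/-! ### Weakly extensional Peano arithmetic in all finite types -/

/-- The non-logical axioms of `WE-PA^ω`. -/
inductive PAAxiom : Fm → Prop
  | eq_refl (s : Tm Ty.nat) : PAAxiom (s ≐ s)
  | eq_symm (s t : Tm Ty.nat) : PAAxiom (s ≐ t ⇒ᶠ t ≐ s)
  | eq_trans (s t u : Tm Ty.nat) : PAAxiom (s ≐ t ⇒ᶠ t ≐ u ⇒ᶠ s ≐ u)
  | succ_ne_zero (s : Tm Ty.nat) : PAAxiom (Fm.neg (Sc s ≐ O))
  | succ_inj (s t : Tm Ty.nat) : PAAxiom (Sc s ≐ Sc t ⇒ᶠ s ≐ t)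
  | induction (φ : Fm) : PAAxiom
      (φ.subst (Sub.inst O) ⇒ᶠ
        .all Ty.nat (φ ⇒ᶠ φ.subst (Sub.cons (Sc (nv 0)) (Sub.shift Ty.nat))) ⇒ᶠ
        .all Ty.nat φ)
  | proj (ρ τ : Ty) (s : Tm ρ) (t : Tm τ) :
      PAAxiom (Fm.eqT ρ (.cst (.proj ρ τ) ⬝ s ⬝ t) s)
  | comb (δ ρ τ : Ty) (s : Tm (δ ⟶ₜ ρ ⟶ₜ τ)) (t : Tm (δ ⟶ₜ ρ)) (u : Tm δ) :
      PAAxiom (Fm.eqT τ (.cst (.comb δ ρ τ) ⬝ s ⬝ t ⬝ u) (s ⬝ u ⬝ (t ⬝ u)))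
  | rec_zero {k : ℕ} (ρ : Fin k → Ty) (i : Fin k) (y : (j : Fin k) → Tm (ρ j))
      (z : (j : Fin k) → Tm (Ty.arrs ρ (Ty.nat ⟶ₜ ρ j))) :
      PAAxiom (Fm.eqT (ρ i) (((Tm.cst (.recr ρ i) ⬝ O).apps y).apps z) (y i))
  | rec_succ {k : ℕ} (ρ : Fin k → Ty) (i : Fin k) (n : Tm Ty.nat) (y : (j : Fin k) → Tm (ρ j))
      (z : (j : Fin k) → Tm (Ty.arrs ρ (Ty.nat ⟶ₜ ρ j))) :
      PAAxiom (Fm.eqT (ρ i) (((Tm.cst (.recr ρ i) ⬝ Sc n).apps y).apps z)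
        ((z i).apps (fun j => ((Tm.cst (.recr ρ j) ⬝ n).apps y).apps z) ⬝ n))

/-- `Proves Ax H φ`: the formula `φ` is derivable from the hypotheses `H` in the extension of
`WE-PA^ω` by the axioms `Ax` (classical natural deduction). The quantifier-free rule of
extensionality is only available for premises that do not depend on hypotheses. -/
inductive Proves (Ax : Fm → Prop) : List Fm → Fm → Prop
  | hyp {H φ} : φ ∈ H → Proves Ax H φ
  | ax {H φ} : Ax φ → Proves Ax H φ
  | pa {H φ} : PAAxiom φ → Proves Ax H φ
  | andI {H φ ψ} : Proves Ax H φ → Proves Ax H ψ → Proves Ax H (.and φ ψ)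
  | andE₁ {H φ ψ} : Proves Ax H (.and φ ψ) → Proves Ax H φ
  | andE₂ {H φ ψ} : Proves Ax H (.and φ ψ) → Proves Ax H ψ
  | orI₁ {H φ ψ} : Proves Ax H φ → Proves Ax H (.or φ ψ)
  | orI₂ {H φ ψ} : Proves Ax H ψ → Proves Ax H (.or φ ψ)
  | orE {H φ ψ χ} : Proves Ax H (.or φ ψ) → Proves Ax (φ :: H) χ → Proves Ax (ψ :: H) χ →
      Proves Ax H χ
  | impI {H φ ψ} : Proves Ax (φ :: H) ψ → Proves Ax H (.imp φ ψ)
  | impE {H φ ψ} : Proves Ax H (.imp φ ψ) → Proves Ax H φ → Proves Ax H ψ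
  | efq {H φ} : Proves Ax H Fm.bot → Proves Ax H φ
  | lem {H} (φ : Fm) : Proves Ax H (.or φ φ.neg)
  | allI {H τ φ} : Proves Ax (H.map (Fm.wk τ)) φ → Proves Ax H (.all τ φ)
  | allE {H τ φ} (t : Tm τ) : Proves Ax H (.all τ φ) → Proves Ax H (φ.subst (Sub.inst t))
  | exI {H τ φ} (t : Tm τ) : Proves Ax H (φ.subst (Sub.inst t)) → Proves Ax H (.ex τ φ)
  | exE {H τ φ ψ} : Proves Ax H (.ex τ φ) → Proves Ax (φ :: H.map (Fm.wk τ)) (ψ.wk τ) →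
      Proves Ax H ψ
  | qfER {H ρ τ} {φ : Fm} {s t : Tm ρ} (r : Tm τ) : φ.QF →
      Proves Ax [] (φ ⇒ᶠ Fm.eqT ρ s t) →
      Proves Ax H (φ ⇒ᶠ Fm.eqT τ (r.subst (Sub.inst s)) (r.subst (Sub.inst t)))

/-! ### Choice -/

/-- Quantifier-free choice and dependent choice, for tuples of variables of arbitrary types. -/
inductive ChoiceAxiom : Fm → Prop
  /-- `∀ x ∃ y φ(x, y) → ∃ Y ∀ x φ(x, Y x)` for quantifier-free `φ` -/
  | qfAC {m k : ℕ} (ρ : Fin m → Ty) (τ : Fin k → Ty) (φ : Fm) : φ.QF → ChoiceAxiom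
      (Fm.alls ρ (Fm.exs τ φ) ⇒ᶠ
        Fm.exs (fun i => Ty.arrs ρ (τ i)) (Fm.alls ρ (φ.subst
          (Sub.conss (fun i => ((Tm.vars (fun i => Ty.arrs ρ (τ i)) i).wks ρ).apps (Tm.vars ρ))
            (Sub.conss (Tm.vars ρ)
              (fun σ n => ((Tm.var σ n).wks (fun i => Ty.arrs ρ (τ i))).wks ρ))))))
  /-- `∀ x^0 ∀ y ∃ z φ(x, y, z) → ∃ f ∀ x^0 φ(x, f x, f (x + 1))` -/
  | dc {k : ℕ} (ρ : Fin k → Ty) (φ : Fm) : ChoiceAxiom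
      (.all Ty.nat (Fm.alls ρ (Fm.exs ρ φ)) ⇒ᶠ
        Fm.exs (fun i => Ty.nat ⟶ₜ ρ i) (.all Ty.nat (φ.subst
          (Sub.conss (fun i => (Tm.vars (fun i => Ty.nat ⟶ₜ ρ i) i).wk Ty.nat ⬝ Sc (nv 0))
            (Sub.conss (fun i => (Tm.vars (fun i => Ty.nat ⟶ₜ ρ i) i).wk Ty.nat ⬝ nv 0)
              (Sub.cons (nv 0)
                (fun σ n => ((Tm.var σ n).wks (fun i => Ty.nat ⟶ₜ ρ i)).wk Ty.nat)))))))

/-! ### Normed spaces -/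

abbrev allN (φ : Fm) : Fm := .all Ty.nat φ
abbrev allR (φ : Fm) : Fm := .all Ty.one φ
abbrev allX (φ : Fm) : Fm := .all Ty.X φ

/-- `X` is a real normed space with a vector `1_X` of norm one. The variables of type `X` are
`x, y, z, …` from the outermost to the innermost, and similarly for the scalars `α, β`. -/
inductive NormedAxiom : Fm → Prop
  /-- `x + (y + z) = (x + y) + z` -/
  | plus_assoc : NormedAxiom (allX (allX (allX (Fm.eqX
      (vplus (xv 2) (vplus (xv 1) (xv 0))) (vplus (vplus (xv 2) (xv 1)) (xv 0))))))
  /-- `x + y = y + x` -/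
  | plus_comm : NormedAxiom (allX (allX (Fm.eqX (vplus (xv 1) (xv 0)) (vplus (xv 0) (xv 1)))))
  /-- `x + 0 = x` -/
  | plus_zero : NormedAxiom (allX (Fm.eqX (vplus (xv 0) (.cst .zeroX)) (xv 0)))
  /-- `x + (- x) = 0` -/
  | plus_neg : NormedAxiom (allX (Fm.eqX (vplus (xv 0) (vneg (xv 0))) (.cst .zeroX)))
  /-- `1 x = x` -/
  | one_smul : NormedAxiom (allX (Fm.eqX (vsmul oneR (xv 0)) (xv 0)))
  /-- `(α β) x = α (β x)` -/
  | mul_smul : NormedAxiom (allR (allR (allX (Fm.eqX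
      (vsmul (timesR (rv 1) (rv 0)) (xv 0)) (vsmul (rv 1) (vsmul (rv 0) (xv 0)))))))
  /-- `α (x + y) = α x + α y` -/
  | smul_plus : NormedAxiom (allR (allX (allX (Fm.eqX
      (vsmul (rv 0) (vplus (xv 1) (xv 0))) (vplus (vsmul (rv 0) (xv 1)) (vsmul (rv 0) (xv 0)))))))
  /-- `(α + β) x = α x + β x` -/
  | plus_smul : NormedAxiom (allR (allR (allX (Fm.eqX
      (vsmul (plusR (rv 1) (rv 0)) (xv 0)) (vplus (vsmul (rv 1) (xv 0)) (vsmul (rv 0) (xv 0)))))))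
  /-- `‖x - x‖ = 0` -/
  | norm_self : NormedAxiom (allX (Fm.eqR (vnorm (vminus (xv 0) (xv 0))) zeroR))
  /-- `‖x - y‖ = ‖y - x‖` -/
  | norm_symm : NormedAxiom (allX (allX (Fm.eqR
      (vnorm (vminus (xv 1) (xv 0))) (vnorm (vminus (xv 0) (xv 1))))))
  /-- `‖x - z‖ ≤ ‖x - y‖ + ‖y - z‖` -/
  | norm_triangle : NormedAxiom (allX (allX (allX (Fm.leR (vnorm (vminus (xv 2) (xv 0)))
      (plusR (vnorm (vminus (xv 2) (xv 1))) (vnorm (vminus (xv 1) (xv 0))))))))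
  /-- `‖α x - α y‖ = |α| ‖x - y‖` -/
  | norm_smul : NormedAxiom (allR (allX (allX (Fm.eqR
      (vnorm (vminus (vsmul (rv 0) (xv 1)) (vsmul (rv 0) (xv 0))))
      (timesR (absR (rv 0)) (vnorm (vminus (xv 1) (xv 0))))))))
  /-- `‖α x - β x‖ = |α - β| ‖x‖` -/
  | norm_smul' : NormedAxiom (allR (allR (allX (Fm.eqR
      (vnorm (vminus (vsmul (rv 1) (xv 0)) (vsmul (rv 0) (xv 0))))
      (timesR (absR (minusR (rv 1) (rv 0))) (vnorm (xv 0)))))))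
  /-- `‖(x + y) - (u + v)‖ ≤ ‖x - u‖ + ‖y - v‖` -/
  | norm_plus : NormedAxiom (allX (allX (allX (allX (Fm.leR
      (vnorm (vminus (vplus (xv 3) (xv 2)) (vplus (xv 1) (xv 0))))
      (plusR (vnorm (vminus (xv 3) (xv 1))) (vnorm (vminus (xv 2) (xv 0)))))))))
  /-- `‖(- x) - (- y)‖ = ‖x - y‖` -/
  | norm_neg : NormedAxiom (allX (allX (Fm.eqR
      (vnorm (vminus (vneg (xv 1)) (vneg (xv 0)))) (vnorm (vminus (xv 1) (xv 0))))))
  /-- `|‖x‖ - ‖y‖| ≤ ‖x - y‖` -/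
  | norm_dist : NormedAxiom (allX (allX (Fm.leR
      (absR (minusR (vnorm (xv 1)) (vnorm (xv 0)))) (vnorm (vminus (xv 1) (xv 0))))))
  /-- `‖1_X‖ = 1` -/
  | norm_one : NormedAxiom (Fm.eqR (vnorm (.cst .oneX)) oneR)

/-! ### Accretive operators with total resolvents -/

/-- The axioms on `χ_A`, `J^A`, `γ̃` and `m_γ̃`. In the resolvent axiom the reciprocal of `γ` is
`(γ)⁻¹_l` under the premise `γ > 2 ^ (-l)`. -/
inductive AccretiveAxiom : Fm → Prop
  /-- `∀ x y (χ_A x y ≤ 1)` -/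
  | char : AccretiveAxiom (allX (allX (monusN (.cst .chiA ⬝ xv 1 ⬝ xv 0) (Sc O) ≐ O)))
  /-- `∀ γ x l (γ > 2 ^ (-l) → γ⁻¹ (x - J_γ x) ∈ A (J_γ x))` -/
  | resolvent : AccretiveAxiom (allR (allX (allN (Fm.ltR (tpowR (nv 0)) (rv 0) ⇒ᶠ
      Fm.inA (vsmul (invR (rv 0) (nv 0)) (vminus (xv 0) (J (rv 0) (xv 0)))) (J (rv 0) (xv 0))))))
  /-- `∀ x y u v λ (u ∈ A x ∧ v ∈ A y → ‖x - y‖ ≤ ‖x - y + |λ| (u - v)‖)` -/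
  | accretive : AccretiveAxiom (allX (allX (allX (allX (allR
      (Fm.inA (xv 1) (xv 3) ⊓ᶠ Fm.inA (xv 0) (xv 2) ⇒ᶠ
        Fm.leR (vnorm (vminus (xv 3) (xv 2)))
          (vnorm (vplus (vminus (xv 3) (xv 2))
            (vsmul (absR (rv 0)) (vminus (xv 1) (xv 0)))))))))))
  /-- `γ̃ ≥ 2 ^ (-m_γ̃)` -/
  | gamma : AccretiveAxiom (Fm.leR (tpowR (.cst .mT)) (.cst .gammaT))

/-- The axioms of `V^ω` beyond `WE-PA^ω`. -/
def VAxiom (φ : Fm) : Prop := ChoiceAxiom φ ∨ NormedAxiom φ ∨ AccretiveAxiom φ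

/-- `V^ω ⊢ φ` for the system `V^ω` of accretive operators with total resolvents. -/
def VProves (φ : Fm) : Prop := Proves VAxiom [] φ

end FinType

open FinType

namespace FinType

/-! ### Substitutions -/

/-! The mathematical core is one inequality. If `(x - p)/γ ∈ A p` and `(y - q)/γ ∈ A q`, then
accretivity with the scalar `λ = r γ` gives `‖p - q‖ ≤ ‖p - q + r ((x - p) - (y - q))‖` for every `r
> 0`; this is `Completion.nrm_sub_le`. The vector on the right equals `r (x - y) + (1 - r) (p - q)`,
which is firm nonexpansivity. For `r = 1` it is `x - y`: this is nonexpansivity, and for equal `x`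
and `y` it forces `p = q`, hence uniqueness and extensionality. In the last case the two memberships
may use different representatives of the same real `γ`. Extensionality of `χ_A` is not needed,
because each membership keeps its own scalar and only the extensionality of scalar multiplication
enters.

The remaining work is to know that such reasoning is available inside the formal system. No
derivations in real arithmetic are written out. By Henkin's method (`exists_model`, `complete`) a
formula is derivable as soon as it belongs to every complete theory with witnesses, and membership
in such a theory can be computed by ordinary mathematics: terms of type `0` up to provable equality
in the theory form a discretely ordered semiring with induction for definable predicates; its
differences, their fractions and a Cauchy completion form an ordered field `R`
(`exists_complete_field`), possibly not Archimedean, in which every term of type `1` denotes an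
element, so that `=_ℝ`, `<_ℝ`, `≤_ℝ` and the coded operations become those of `R`; terms of type `X`
up to `=_X` form an abelian group with scalar multiplications and an `R`-valued norm, where the
inequality above is proved.

Functionals of higher type are never interpreted. Their defining equations enter through `CEq`,
interchangeability in all contexts of type `0`, which the quantifier-free extensionality rule
provides and which suffices for beta reduction and recursion. Choice is not used: the models satisfy
only `SpaceAxiom`, and the derivations are transferred to the full system at the end. -/

/-- Composition of substitutions: first `σ`, then `τ`. -/
def Sub.comp (σ τ : Sub) : Sub := fun ρ n => (σ ρ n).subst τ

section
variable {ρ τ : Ty} (t : Tm ρ) (σ σ' : Sub)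

@[simp] theorem Sub.cons_zero : Sub.cons t σ ρ 0 = t := by simp [Sub.cons]

@[simp] theorem Sub.cons_succ (n : ℕ) : Sub.cons t σ ρ (n + 1) = σ ρ n := by simp [Sub.cons]

theorem Sub.cons_of_ne (h : ρ ≠ τ) (n : ℕ) : Sub.cons t σ τ n = σ τ n := by simp [Sub.cons, h]

@[simp] theorem Sub.shift_self (n : ℕ) : Sub.shift ρ ρ n = .var ρ (n + 1) := by simp [Sub.shift]

theorem Sub.shift_of_ne (h : ρ ≠ τ) (n : ℕ) : Sub.shift ρ τ n = .var τ n := by simp [Sub.shift, h]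

@[simp] theorem Tm.subst_var (n : ℕ) : (Tm.var τ n).subst σ = σ τ n := rfl

@[simp] theorem Tm.subst_cst (c : Cst τ) : (Tm.cst c).subst σ = .cst c := rfl

@[simp] theorem Tm.subst_app (s : Tm (ρ ⟶ₜ τ)) : (s ⬝ t).subst σ = s.subst σ ⬝ t.subst σ := rfl

theorem Sub.ext_cons {α β : Sub} (h₀ : α ρ 0 = β ρ 0) (h₁ : ∀ n, α ρ (n + 1) = β ρ (n + 1))
    (h₂ : ∀ τ n, ρ ≠ τ → α τ n = β τ n) : α = β := by
  funext τ n
  by_cases h : ρ = τ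
  · subst h
    cases n with
    | zero => exact h₀
    | succ n => exact h₁ n
  · exact h₂ τ n h

@[simp] theorem Tm.subst_id (s : Tm τ) : s.subst Tm.var = s := by
  induction s with
  | var => rfl
  | cst => rfl
  | app t s ht hs => simp [ht, hs]

theorem Tm.subst_subst (s : Tm τ) : (s.subst σ).subst σ' = s.subst (σ.comp σ') := by
  induction s with
  | var => rfl
  | cst => rfl
  | app t s ht hs => simp [ht, hs]

theorem Sub.shift_comp_cons : (Sub.shift ρ).comp (Sub.cons t σ) = σ := by
  apply Sub.ext_cons (ρ := ρ)
  · simp [Sub.comp]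
  · simp [Sub.comp]
  · intro τ n h
    simp [Sub.comp, Sub.shift_of_ne h, Sub.cons_of_ne _ _ h]

@[simp] theorem Tm.wk_subst_cons (s : Tm τ) : (s.wk ρ).subst (Sub.cons t σ) = s.subst σ := by
  rw [Tm.wk, Tm.subst_subst, Sub.shift_comp_cons]

@[simp] theorem Tm.wk_subst_inst (s : Tm τ) : (s.wk ρ).subst (Sub.inst t) = s := by
  simp [Sub.inst]

/-- The basic law of binders: the composition of lifted substitutions and all rules for
instantiating a quantifier are derived from it. -/
theorem Sub.lift_comp_cons : (Sub.lift ρ σ).comp (Sub.cons t σ') = Sub.cons t (σ.comp σ') := by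
  apply Sub.ext_cons (ρ := ρ)
  · simp [Sub.comp, Sub.lift]
  · intro n
    simpa [Sub.comp, Sub.lift, Tm.wk, -Tm.wk_subst_cons] using Tm.wk_subst_cons t σ' (σ ρ n)
  · intro τ n h
    simpa [Sub.comp, Sub.lift, Sub.cons_of_ne _ _ h, Tm.wk, -Tm.wk_subst_cons] using Tm.wk_subst_cons t σ' (σ τ n)

theorem Sub.comp_assoc (σ'' : Sub) : (σ.comp σ').comp σ'' = σ.comp (σ'.comp σ'') := by
  funext τ n
  simp [Sub.comp, Tm.subst_subst]

@[simp] theorem Sub.comp_var : σ.comp Tm.var = σ := by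
  funext τ n
  simp [Sub.comp]

@[simp] theorem Sub.var_comp : Sub.comp Tm.var σ = σ := rfl

theorem Sub.comp_cons : (Sub.cons t σ).comp σ' = Sub.cons (t.subst σ') (σ.comp σ') := by
  apply Sub.ext_cons (ρ := ρ)
  · simp [Sub.comp]
  · simp [Sub.comp]
  · intro τ n h
    simp [Sub.comp, Sub.cons_of_ne _ _ h]

theorem Sub.lift_eq : Sub.lift ρ σ = Sub.cons (.var ρ 0) (σ.comp (Sub.shift ρ)) := rfl

theorem Sub.lift_comp_lift : (Sub.lift ρ σ).comp (Sub.lift ρ σ') = Sub.lift ρ (σ.comp σ') := by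
  rw [Sub.lift_eq σ', Sub.lift_comp_cons, Sub.lift_eq, Sub.comp_assoc]

theorem Sub.cons_var_shift : Sub.cons (.var ρ 0) (Sub.shift ρ) = Tm.var := by
  apply Sub.ext_cons (ρ := ρ)
  · simp
  · simp
  · intro τ n h
    simp [Sub.cons_of_ne _ _ h, Sub.shift_of_ne h]

@[simp] theorem Sub.lift_var : Sub.lift ρ Tm.var = Tm.var := by
  rw [Sub.lift_eq, Sub.var_comp, Sub.cons_var_shift]

theorem Sub.shift_comp_lift : (Sub.shift ρ).comp (Sub.lift ρ σ) = σ.comp (Sub.shift ρ) := by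
  rw [Sub.lift_eq, Sub.shift_comp_cons]

theorem Tm.wk_subst_lift (s : Tm τ) : (s.wk ρ).subst (Sub.lift ρ σ) = (s.subst σ).wk ρ := by
  rw [Tm.wk, Tm.wk, Tm.subst_subst, Tm.subst_subst, Sub.shift_comp_lift]

@[simp] theorem Fm.subst_id (φ : Fm) : φ.subst Tm.var = φ := by
  induction φ <;> simp_all [Fm.subst]

theorem Fm.subst_subst (φ : Fm) (σ σ' : Sub) :
    (φ.subst σ).subst σ' = φ.subst (σ.comp σ') := by
  induction φ generalizing σ σ' <;>
    simp_all [Fm.subst, Tm.subst_subst, Sub.lift_comp_lift]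

theorem Fm.wk_subst_lift (φ : Fm) : (φ.wk ρ).subst (Sub.lift ρ σ) = (φ.subst σ).wk ρ := by
  rw [Fm.wk, Fm.wk, Fm.subst_subst, Fm.subst_subst, Sub.shift_comp_lift]

theorem Fm.subst_inst_subst (φ : Fm) :
    (φ.subst (Sub.inst t)).subst σ = (φ.subst (Sub.lift ρ σ)).subst (Sub.inst (t.subst σ)) := by
  rw [Fm.subst_subst, Fm.subst_subst, Sub.inst, Sub.inst, Sub.comp_cons, Sub.lift_comp_cons]
  simp

theorem Tm.subst_inst_subst (s : Tm τ) :
    (s.subst (Sub.inst t)).subst σ = (s.subst (Sub.lift ρ σ)).subst (Sub.inst (t.subst σ)) := by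
  rw [Tm.subst_subst, Tm.subst_subst, Sub.inst, Sub.inst, Sub.comp_cons, Sub.lift_comp_cons]
  simp

theorem Fm.subst_lift_inst (φ : Fm) :
    (φ.subst (Sub.lift ρ σ)).subst (Sub.inst t) = φ.subst (Sub.cons t σ) := by
  rw [Fm.subst_subst, Sub.inst, Sub.lift_comp_cons]
  simp

/-- Serves to reopen a weakened quantifier with the very variable that the weakening introduced. -/
theorem Fm.subst_lift_shift_inst_var (ρ : Ty) (φ : Fm) :
    (φ.subst (Sub.lift ρ (Sub.shift ρ))).subst (Sub.inst (.var ρ 0)) = φ := by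
  rw [Fm.subst_lift_inst, Sub.cons_var_shift, Fm.subst_id]

end

/-- Lets the coded operations behave like constants: closedness is checked by kernel computation,
and their combinator terms are not unfolded under substitutions. -/
theorem Tm.subst_of_closed {τ : Ty} {t : Tm τ} (h : t.closed = true) (σ : Sub) :
    t.subst σ = t := by
  induction t with
  | var => simp [Tm.closed] at h
  | cst => rfl
  | app t s ht hs =>
    simp only [Tm.closed, Bool.and_eq_true] at h
    simp [ht h.1, hs h.2]

theorem Tm.apps_subst {k : ℕ} {ρ : Fin k → Ty} {τ : Ty} (t : Tm (Ty.arrs ρ τ))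
    (s : (i : Fin k) → Tm (ρ i)) (σ : Sub) :
    (t.apps s).subst σ = (t.subst σ).apps (fun i => (s i).subst σ) := by
  induction k with
  | zero => rfl
  | succ k ih => exact ih _ _

theorem Fm.QF.subst {φ : Fm} (h : φ.QF) (σ : Sub) : (φ.subst σ).QF := by
  induction φ <;> simp_all [Fm.QF, Fm.subst]

section
variable (σ : Sub)

@[simp] theorem plusT_subst : plusT.subst σ = plusT := Tm.subst_of_closed (by decide +kernel) σ

@[simp] theorem timesT_subst : timesT.subst σ = timesT := Tm.subst_of_closed (by decide +kernel) σ

@[simp] theorem predT_subst : predT.subst σ = predT := Tm.subst_of_closed (by decide +kernel) σ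

@[simp] theorem monusT_subst : monusT.subst σ = monusT := Tm.subst_of_closed (by decide +kernel) σ

@[simp] theorem condT_subst : condT.subst σ = condT := Tm.subst_of_closed (by decide +kernel) σ

@[simp] theorem powT_subst : powT.subst σ = powT := Tm.subst_of_closed (by decide +kernel) σ

@[simp] theorem triT_subst : triT.subst σ = triT := Tm.subst_of_closed (by decide +kernel) σ

@[simp] theorem pairT_subst : pairT.subst σ = pairT := Tm.subst_of_closed (by decide +kernel) σ

@[simp] theorem diagT_subst : diagT.subst σ = diagT := Tm.subst_of_closed (by decide +kernel) σ

@[simp] theorem fstT_subst : fstT.subst σ = fstT := Tm.subst_of_closed (by decide +kernel) σ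

@[simp] theorem sndT_subst : sndT.subst σ = sndT := Tm.subst_of_closed (by decide +kernel) σ

@[simp] theorem parT_subst : parT.subst σ = parT := Tm.subst_of_closed (by decide +kernel) σ

@[simp] theorem halfT_subst : halfT.subst σ = halfT := Tm.subst_of_closed (by decide +kernel) σ

@[simp] theorem posT_subst : posT.subst σ = posT := Tm.subst_of_closed (by decide +kernel) σ

@[simp] theorem negpT_subst : negpT.subst σ = negpT := Tm.subst_of_closed (by decide +kernel) σ

@[simp] theorem mkT_subst : mkT.subst σ = mkT := Tm.subst_of_closed (by decide +kernel) σ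

@[simp] theorem plusQT_subst : plusQT.subst σ = plusQT := Tm.subst_of_closed (by decide +kernel) σ

@[simp] theorem timesQT_subst : timesQT.subst σ = timesQT := Tm.subst_of_closed (by decide +kernel) σ

@[simp] theorem negQT_subst : negQT.subst σ = negQT := Tm.subst_of_closed (by decide +kernel) σ

@[simp] theorem absQT_subst : absQT.subst σ = absQT := Tm.subst_of_closed (by decide +kernel) σ

@[simp] theorem invQT_subst : invQT.subst σ = invQT := Tm.subst_of_closed (by decide +kernel) σ

@[simp] theorem tpowT_subst : tpowT.subst σ = tpowT := Tm.subst_of_closed (by decide +kernel) σ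

@[simp] theorem ltcT_subst : ltcT.subst σ = ltcT := Tm.subst_of_closed (by decide +kernel) σ

@[simp] theorem lecT_subst : lecT.subst σ = lecT := Tm.subst_of_closed (by decide +kernel) σ

@[simp] theorem hatT_subst : hatT.subst σ = hatT := Tm.subst_of_closed (by decide +kernel) σ

@[simp] theorem zeroR_subst : zeroR.subst σ = zeroR := Tm.subst_of_closed (by decide +kernel) σ

@[simp] theorem oneR_subst : oneR.subst σ = oneR := Tm.subst_of_closed (by decide +kernel) σ

@[simp] theorem plusRT_subst : plusRT.subst σ = plusRT := Tm.subst_of_closed (by decide +kernel) σ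

@[simp] theorem negRT_subst : negRT.subst σ = negRT := Tm.subst_of_closed (by decide +kernel) σ

@[simp] theorem absRT_subst : absRT.subst σ = absRT := Tm.subst_of_closed (by decide +kernel) σ

@[simp] theorem timesRT_subst : timesRT.subst σ = timesRT := Tm.subst_of_closed (by decide +kernel) σ

@[simp] theorem invRT_subst : invRT.subst σ = invRT := Tm.subst_of_closed (by decide +kernel) σ

end
end FinType
namespace FinType

/-! ### Substitution in the formulas of real arithmetic -/

section
variable {ρ τ : Ty} (σ : Sub)

@[simp] theorem Sub.lift_zero : Sub.lift ρ σ ρ 0 = .var ρ 0 := by simp [Sub.lift]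

@[simp] theorem Sub.lift_succ (n : ℕ) : Sub.lift ρ σ ρ (n + 1) = (σ ρ n).wk ρ := by
  simp [Sub.lift, Tm.wk]

theorem Sub.lift_of_ne (h : ρ ≠ τ) (n : ℕ) : Sub.lift ρ σ τ n = (σ τ n).wk ρ := by
  simp [Sub.lift, Sub.cons_of_ne _ _ h, Tm.wk]

@[simp] theorem O_subst : O.subst σ = O := rfl

@[simp] theorem Sc_subst (t : Tm Ty.nat) : (Sc t).subst σ = Sc (t.subst σ) := rfl

@[simp] theorem Tm.const_subst (t : Tm τ) : (Tm.const ρ t).subst σ = Tm.const ρ (t.subst σ) := rfl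

@[simp] theorem Fm.bot_subst : Fm.bot.subst σ = Fm.bot := rfl

@[simp] theorem Fm.neg_subst (φ : Fm) : φ.neg.subst σ = (φ.subst σ).neg := rfl

@[simp] theorem Fm.ltQ_subst (s t : Tm Ty.nat) :
    (Fm.ltQ s t).subst σ = Fm.ltQ (s.subst σ) (t.subst σ) := by simp [Fm.ltQ, Fm.subst]

@[simp] theorem Fm.leQ_subst (s t : Tm Ty.nat) :
    (Fm.leQ s t).subst σ = Fm.leQ (s.subst σ) (t.subst σ) := by simp [Fm.leQ, Fm.subst]

@[simp] theorem Fm.eqR_subst (f g : Tm Ty.one) :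
    (Fm.eqR f g).subst σ = Fm.eqR (f.subst σ) (g.subst σ) := by
  simp [Fm.eqR, Fm.subst, Tm.wk_subst_lift]

@[simp] theorem Fm.ltR_subst (f g : Tm Ty.one) :
    (Fm.ltR f g).subst σ = Fm.ltR (f.subst σ) (g.subst σ) := by
  simp [Fm.ltR, Fm.subst, Tm.wk_subst_lift]

@[simp] theorem Fm.leR_subst (f g : Tm Ty.one) :
    (Fm.leR f g).subst σ = Fm.leR (f.subst σ) (g.subst σ) := by
  simp [Fm.leR]

@[simp] theorem Fm.inA_subst (x y : Tm Ty.X) :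
    (Fm.inA x y).subst σ = Fm.inA (x.subst σ) (y.subst σ) := rfl

@[simp] theorem Fm.eqT_subst (s t : Tm ρ) (σ : Sub) :
    (Fm.eqT ρ s t).subst σ = Fm.eqT ρ (s.subst σ) (t.subst σ) := by
  induction ρ generalizing σ with
  | nat => rfl
  | X => simp [Fm.eqT]
  | arr ρ τ _ ih => simp [Fm.eqT, Fm.subst, ih, Tm.wk_subst_lift]

end

theorem PAAxiom.subst {φ : Fm} (h : PAAxiom φ) (σ : Sub) : PAAxiom (φ.subst σ) := by
  cases h with
  | eq_refl s => exact .eq_refl _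
  | eq_symm s t => exact .eq_symm _ _
  | eq_trans s t u => exact .eq_trans _ _ _
  | succ_ne_zero s => exact .succ_ne_zero _
  | succ_inj s t => exact .succ_inj _ _
  | induction φ =>
    have := PAAxiom.induction (φ.subst (Sub.lift Ty.nat σ))
    simp only [Fm.subst, Fm.subst_inst_subst]
    convert this using 4
    · rfl
    -- Both sides send the induction variable to its successor and every other variable to its image
    -- under `σ`, shifted.
    rw [Fm.subst_subst, Fm.subst_subst, Sub.comp_cons, Sub.lift_comp_cons, Sub.shift_comp_lift]
    simp
  | proj ρ τ s t => simpa using PAAxiom.proj ρ τ (s.subst σ) (t.subst σ)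
  | comb δ ρ τ s t u => simpa using PAAxiom.comb δ ρ τ (s.subst σ) (t.subst σ) (u.subst σ)
  | rec_zero ρ i y z =>
    simpa [Tm.apps_subst] using
      PAAxiom.rec_zero ρ i (fun j => (y j).subst σ) (fun j => (z j).subst σ)
  | rec_succ ρ i n y z =>
    simpa [Tm.apps_subst] using
      PAAxiom.rec_succ ρ i (n.subst σ) (fun j => (y j).subst σ) (fun j => (z j).subst σ)

/-! ### Structural properties of derivations -/

section
variable {Ax Ax' : Fm → Prop} {H H' : List Fm} {φ ψ χ : Fm}

theorem Proves.weaken (h : Proves Ax H φ) (hH : H ⊆ H') : Proves Ax H' φ := by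
  induction h generalizing H' with
  | hyp h => exact .hyp (hH h)
  | ax h => exact .ax h
  | pa h => exact .pa h
  | andI _ _ h₁ h₂ => exact .andI (h₁ hH) (h₂ hH)
  | andE₁ _ h => exact .andE₁ (h hH)
  | andE₂ _ h => exact .andE₂ (h hH)
  | orI₁ _ h => exact .orI₁ (h hH)
  | orI₂ _ h => exact .orI₂ (h hH)
  | orE _ _ _ h h₁ h₂ =>
    exact .orE (h hH) (h₁ (List.cons_subset_cons _ hH)) (h₂ (List.cons_subset_cons _ hH))
  | impI _ h => exact .impI (h (List.cons_subset_cons _ hH))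
  | impE _ _ h₁ h₂ => exact .impE (h₁ hH) (h₂ hH)
  | efq _ h => exact .efq (h hH)
  | lem φ => exact .lem φ
  | allI _ h => exact .allI (h (List.map_subset _ hH))
  | allE t _ h => exact .allE t (h hH)
  | exI t _ h => exact .exI t (h hH)
  | exE _ _ h₁ h₂ => exact .exE (h₁ hH) (h₂ (List.cons_subset_cons _ (List.map_subset _ hH)))
  -- The premise of the extensionality rule has no hypotheses, so it is reused unchanged.
  | qfER r hq h _ => exact .qfER r hq h

/-- Transfers derivations from the axioms that the models satisfy to those of the full system with
choice. -/
theorem Proves.mono (h : Proves Ax H φ) (hA : ∀ φ, Ax φ → Ax' φ) : Proves Ax' H φ := by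
  induction h with
  | hyp h => exact .hyp h
  | ax h => exact .ax (hA _ h)
  | pa h => exact .pa h
  | andI _ _ h₁ h₂ => exact .andI h₁ h₂
  | andE₁ _ h => exact .andE₁ h
  | andE₂ _ h => exact .andE₂ h
  | orI₁ _ h => exact .orI₁ h
  | orI₂ _ h => exact .orI₂ h
  | orE _ _ _ h h₁ h₂ => exact .orE h h₁ h₂
  | impI _ h => exact .impI h
  | impE _ _ h₁ h₂ => exact .impE h₁ h₂
  | efq _ h => exact .efq h
  | lem φ => exact .lem φ
  | allI _ h => exact .allI h
  | allE t _ h => exact .allE t h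
  | exI t _ h => exact .exI t h
  | exE _ _ h₁ h₂ => exact .exE h₁ h₂
  | qfER r hq _ h => exact .qfER r hq h

theorem map_wk_map_lift (H : List Fm) (τ : Ty) (σ : Sub) :
    (H.map (Fm.wk τ)).map (Fm.subst (Sub.lift τ σ)) = (H.map (Fm.subst σ)).map (Fm.wk τ) := by
  simp [Fm.wk_subst_lift]

/-- Needed to turn a fresh free variable into the eigenvariable of an elimination of `∃`; this is
why axiom sets are required to be closed under substitution. -/
theorem Proves.subst (hA : ∀ φ σ, Ax φ → Ax (φ.subst σ)) (h : Proves Ax H φ) (σ : Sub) :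
    Proves Ax (H.map (Fm.subst σ)) (φ.subst σ) := by
  induction h generalizing σ with
  | hyp h => exact .hyp (List.mem_map_of_mem h)
  | ax h => exact .ax (hA _ _ h)
  | pa h => exact .pa (h.subst σ)
  | andI _ _ h₁ h₂ => exact .andI (h₁ σ) (h₂ σ)
  | andE₁ _ h => exact .andE₁ (h σ)
  | andE₂ _ h => exact .andE₂ (h σ)
  | orI₁ _ h => exact .orI₁ (h σ)
  | orI₂ _ h => exact .orI₂ (h σ)
  | orE _ _ _ h h₁ h₂ => exact .orE (h σ) (h₁ σ) (h₂ σ)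
  | impI _ h => exact .impI (h σ)
  | impE _ _ h₁ h₂ => exact .impE (h₁ σ) (h₂ σ)
  | efq _ h => exact .efq (h σ)
  | lem φ => exact .lem (φ.subst σ)
  | @allI H τ φ _ h =>
    refine .allI ?_
    rw [← map_wk_map_lift]
    exact h _
  | allE t _ h =>
    rw [Fm.subst_inst_subst]
    exact .allE _ (h σ)
  | @exI H τ φ t _ h =>
    refine .exI (t.subst σ) ?_
    rw [← Fm.subst_inst_subst]
    exact h σ
  | @exE H τ φ ψ _ _ h₁ h₂ =>
    refine .exE (h₁ σ) ?_
    have := h₂ (Sub.lift τ σ)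
    rwa [List.map_cons, map_wk_map_lift, Fm.wk_subst_lift] at this
  | @qfER H ρ τ φ s t r hq _ h =>
    have := h σ
    simp only [Fm.subst, Fm.eqT_subst, Tm.subst_inst_subst, List.map_nil] at this ⊢
    exact .qfER _ (hq.subst σ) this

theorem Proves.cut (h : Proves Ax H φ) (h' : Proves Ax (φ :: H) ψ) : Proves Ax H ψ :=
  .impE (.impI h') h

theorem Proves.imp_self : Proves Ax H (φ ⇒ᶠ φ) := .impI (.hyp (by simp))

theorem Proves.byContra (h : Proves Ax (φ.neg :: H) Fm.bot) : Proves Ax H φ :=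
  .orE (.lem φ) (.hyp (by simp)) (.efq h)

/-- Classical logic yields a witness against a refuted universal formula, so that Henkin witnesses
for `∃` also take care of `∀`. -/
theorem Proves.ex_neg_of_neg_all {τ : Ty} (h : Proves Ax H (Fm.neg (.all τ φ))) :
    Proves Ax H (.ex τ φ.neg) := by
  refine .byContra (.impE (h.weaken (by simp)) (.allI (.byContra (.impE (φ := .ex τ (φ.subst (Sub.lift τ (Sub.shift τ))).neg) (.hyp ?_) (.exI (.var τ 0) (.hyp ?_))))))
  · simp [Fm.wk, Fm.subst, Fm.neg]
  · simp only [Fm.neg_subst, Fm.subst_lift_shift_inst_var]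
    simp

end

/-! ### Provable equality and beta reduction -/

/-- Equality of terms that is provable without hypotheses. -/
def PEq (Ax : Fm → Prop) {ρ : Ty} (s t : Tm ρ) : Prop := Proves Ax [] (Fm.eqT ρ s t)

/-- Equality in all contexts of type `0`. -/
def CEq (Ax : Fm → Prop) {ρ : Ty} (s t : Tm ρ) : Prop :=
  ∀ r : Tm Ty.nat, Proves Ax [] (r.subst (Sub.inst s) ≐ r.subst (Sub.inst t))

/-- The extensionality rule with the trivial premise `O ≐ O`. With contexts of type `0` only,
transitivity at all types comes from that of `=₀` alone. -/
theorem PEq.ceq {Ax : Fm → Prop} {ρ : Ty} {s t : Tm ρ} (h : PEq Ax s t) : CEq Ax s t := fun r =>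
  have : Proves Ax [] (O ≐ O) := .pa (.eq_refl O)
  .impE (.qfER (φ := O ≐ O) r trivial (.impI (h.weaken (by simp)))) this

namespace CEq
variable {Ax : Fm → Prop} {ρ τ : Ty}

theorem trans {s t u : Tm ρ} (h : CEq Ax s t) (h' : CEq Ax t u) : CEq Ax s u := fun r =>
  .impE (.impE (.pa (.eq_trans _ _ _)) (h r)) (h' r)

theorem subst_congr {s t : Tm ρ} (h : CEq Ax s t) (σ : Sub) (r : Tm τ) :
    CEq Ax (r.subst (Sub.cons s σ)) (r.subst (Sub.cons t σ)) := fun q => by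
  have key : ∀ s : Tm ρ, q.subst (Sub.inst (r.subst (Sub.cons s σ))) =
      (q.subst (Sub.cons (r.subst (Sub.lift ρ σ)) (Sub.shift ρ))).subst (Sub.inst s) := fun s => by
    simp only [Tm.subst_subst, Sub.comp_cons, Sub.inst, Sub.shift_comp_cons, Sub.lift_comp_cons,
      Sub.comp_var]
  rw [key, key]
  exact h _

theorem app_right (u : Tm (ρ ⟶ₜ τ)) {s t : Tm ρ} (h : CEq Ax s t) :
    CEq Ax (u ⬝ s) (u ⬝ t) := by
  simpa using h.subst_congr Tm.var (u.wk ρ ⬝ .var ρ 0)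

theorem app_left {s t : Tm (ρ ⟶ₜ τ)} (h : CEq Ax s t) (u : Tm ρ) : CEq Ax (s ⬝ u) (t ⬝ u) := by
  simpa using h.subst_congr Tm.var (.var (ρ ⟶ₜ τ) 0 ⬝ u.wk (ρ ⟶ₜ τ))

theorem app {s t : Tm (ρ ⟶ₜ τ)} {u v : Tm ρ} (h : CEq Ax s t) (h' : CEq Ax u v) :
    CEq Ax (s ⬝ u) (t ⬝ v) := (h.app_left u).trans (h'.app_right t)

theorem proves {s t : Tm Ty.nat} (h : CEq Ax s t) : Proves Ax [] (s ≐ t) := by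
  simpa [Sub.inst] using h (.var Ty.nat 0)

theorem const (t : Tm τ) (s : Tm ρ) : CEq Ax (Tm.const ρ t ⬝ s) t :=
  PEq.ceq (.pa (.proj _ _ _ _))

theorem idt (s : Tm ρ) : CEq Ax (Tm.idt ρ ⬝ s) s :=
  (PEq.ceq (.pa (.comb _ _ _ _ _ _))).trans (PEq.ceq (.pa (.proj _ _ _ _)))

/-- Beta reduction. -/
theorem beta (t : Tm τ) (σ : Sub) (s : Tm ρ) :
    CEq Ax ((Tm.lam ρ t).subst σ ⬝ s) (t.subst (Sub.cons s σ)) := by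
  induction t with
  | var τ n =>
    by_cases h : ρ = τ
    · subst h
      cases n with
      | zero =>
        simp only [Tm.lam, dite_true, Tm.subst_var, Sub.cons_zero]
        exact idt s
      | succ n => simpa [Tm.lam] using const _ s
    · simpa [Tm.lam, h, Sub.cons_of_ne _ _ h] using const _ s
  | cst c => exact const _ s
  | app t u ht hu =>
    by_cases h : (Tm.app t u).closed = true
    -- Closed applications are abstracted to constant functions, so the induction hypotheses play no
    -- role here.
    · rw [Tm.subst_of_closed h, Tm.lam, if_pos h, Tm.const_subst, Tm.subst_of_closed h]
      exact const _ s
    · rw [Tm.lam, if_neg h]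
      exact (PEq.ceq (.pa (.comb _ _ _ _ _ _))).trans (ht.app hu)

theorem beta₂ {ρ' : Ty} (t : Tm τ) (σ : Sub) (s : Tm ρ) (s' : Tm ρ') :
    CEq Ax ((Tm.lam ρ (Tm.lam ρ' t)).subst σ ⬝ s ⬝ s')
      (t.subst (Sub.cons s' (Sub.cons s σ))) :=
  ((beta _ σ s).app_left s').trans (beta _ _ s')

theorem beta₃ {ρ' ρ'' : Ty} (t : Tm τ) (σ : Sub) (s : Tm ρ) (s' : Tm ρ') (s'' : Tm ρ'') :
    CEq Ax ((Tm.lam ρ (Tm.lam ρ' (Tm.lam ρ'' t))).subst σ ⬝ s ⬝ s' ⬝ s'')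
      (t.subst (Sub.cons s'' (Sub.cons s' (Sub.cons s σ)))) :=
  ((beta₂ _ σ s s').app_left s'').trans (beta _ _ s'')

theorem recN_zero (b : Tm Ty.nat) (s : Tm Op2) : CEq Ax (recN O b s) b :=
  PEq.ceq (.pa (.rec_zero (k := 1) (fun _ => Ty.nat) 0 (fun _ => b) (fun _ => s)))

theorem recN_succ (n b : Tm Ty.nat) (s : Tm Op2) :
    CEq Ax (recN (Sc n) b s) (s ⬝ recN n b s ⬝ n) :=
  PEq.ceq (.pa (.rec_succ (k := 1) (fun _ => Ty.nat) 0 n (fun _ => b) (fun _ => s)))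

end CEq

/-- Equals may be substituted for equals of type `0`, under hypotheses. -/
theorem Proves.nat_congr {Ax : Fm → Prop} {H : List Fm} (s t r : Tm Ty.nat)
    (h : Proves Ax H (s ≐ t)) :
    Proves Ax H (r.subst (Sub.inst s) ≐ r.subst (Sub.inst t)) :=
  -- The equation itself is the quantifier-free premise of the rule; `s ≐ t ⇒ᶠ s ≐ t` needs no
  -- hypotheses, and the assumed equation is used only afterwards.
  .impE (.qfER (φ := s ≐ t) (ρ := Ty.nat) (τ := Ty.nat) r trivial .imp_self) h

end FinType
namespace FinType

/-! ### Countability of the language -/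

deriving instance Countable for Ty

/-- Countability is used twice: formulas are enumerated in Henkin's construction, and the numbers of
a term model contain a cofinal sequence. -/
instance : Countable (Σ τ, Cst τ) := by
  let f : (Bool ⊕ Fin 11) ⊕ (Ty × Ty) ⊕ (Ty × Ty × Ty) ⊕ (Σ (k : ℕ) (_ : Fin k → Ty), Fin k) →
      Σ τ, Cst τ
    | .inl (.inl false) => ⟨_, .zero⟩
    | .inl (.inl true) => ⟨_, .succ⟩
    | .inl (.inr 0) => ⟨_, .zeroX⟩
    | .inl (.inr 1) => ⟨_, .oneX⟩
    | .inl (.inr 2) => ⟨_, .plusX⟩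
    | .inl (.inr 3) => ⟨_, .negX⟩
    | .inl (.inr 4) => ⟨_, .smulX⟩
    | .inl (.inr 5) => ⟨_, .normX⟩
    | .inl (.inr 6) => ⟨_, .chiA⟩
    | .inl (.inr 7) => ⟨_, .resA⟩
    | .inl (.inr 8) => ⟨_, .gammaT⟩
    | .inl (.inr 9) => ⟨_, .mT⟩
    | .inl (.inr 10) => ⟨_, .cX⟩
    | .inr (.inl (ρ, τ)) => ⟨_, .proj ρ τ⟩
    | .inr (.inr (.inl (δ, ρ, τ))) => ⟨_, .comb δ ρ τ⟩
    | .inr (.inr (.inr ⟨_, ρ, i⟩)) => ⟨_, .recr ρ i⟩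
  refine Function.Surjective.countable (f := f) ?_
  rintro ⟨_, c⟩
  cases c with
  | zero => exact ⟨.inl (.inl false), rfl⟩
  | succ => exact ⟨.inl (.inl true), rfl⟩
  | zeroX => exact ⟨.inl (.inr 0), rfl⟩
  | oneX => exact ⟨.inl (.inr 1), rfl⟩
  | plusX => exact ⟨.inl (.inr 2), rfl⟩
  | negX => exact ⟨.inl (.inr 3), rfl⟩
  | smulX => exact ⟨.inl (.inr 4), rfl⟩
  | normX => exact ⟨.inl (.inr 5), rfl⟩
  | chiA => exact ⟨.inl (.inr 6), rfl⟩
  | resA => exact ⟨.inl (.inr 7), rfl⟩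
  | gammaT => exact ⟨.inl (.inr 8), rfl⟩
  | mT => exact ⟨.inl (.inr 9), rfl⟩
  | cX => exact ⟨.inl (.inr 10), rfl⟩
  | proj ρ τ => exact ⟨.inr (.inl (ρ, τ)), rfl⟩
  | comb δ ρ τ => exact ⟨.inr (.inr (.inl (δ, ρ, τ))), rfl⟩
  | recr ρ i => exact ⟨.inr (.inr (.inr ⟨_, ρ, i⟩)), rfl⟩

/-- Terms whose applications need not be typed correctly. -/
inductive RawTm : Type
  | var (τ : Ty) (n : ℕ) : RawTm
  | cst (c : Σ τ, Cst τ) : RawTm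
  | app (s t : RawTm) : RawTm
  deriving Countable

def RawTm.ofTm : {τ : Ty} → Tm τ → RawTm
  | _, .var τ n => .var τ n
  | _, .cst c => .cst ⟨_, c⟩
  | _, .app s t => .app (ofTm s) (ofTm t)

/-- Types and terms are recovered together, since the type of an application does not determine the
type of its argument. -/
theorem RawTm.ofTm_injective {τ τ' : Ty} {s : Tm τ} {t : Tm τ'} (h : ofTm s = ofTm t) :
    (⟨τ, s⟩ : Σ τ, Tm τ) = ⟨τ', t⟩ := by
  induction s generalizing τ' with
  | var τ n =>
    cases t <;> simp only [ofTm, RawTm.var.injEq, reduceCtorEq] at h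
    obtain ⟨rfl, rfl⟩ := h
    rfl
  | cst c =>
    cases t <;> simp only [ofTm, RawTm.cst.injEq, Sigma.mk.injEq, reduceCtorEq] at h
    obtain ⟨rfl, h⟩ := h
    rw [eq_of_heq h]
  | app s u hs hu =>
    cases t with
    | app s' u' =>
      simp only [ofTm, RawTm.app.injEq] at h
      have h₁ := hs h.1
      have h₂ := hu h.2
      simp only [Sigma.mk.injEq, Ty.arr.injEq] at h₁ h₂ 
      obtain ⟨⟨rfl, rfl⟩, h₁⟩ := h₁
      obtain ⟨-, h₂⟩ := h₂
      rw [eq_of_heq h₁, eq_of_heq h₂]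
    | _ => simp [ofTm] at h

instance (τ : Ty) : Countable (Tm τ) :=
  Function.Injective.countable (f := RawTm.ofTm) fun s t h => by
    simpa using RawTm.ofTm_injective h

deriving instance Countable for Fm

/-! ### Fresh variables -/

/-- Only variables with indices below `N` matter. -/
def Fm.Below (N : ℕ) (φ : Fm) : Prop :=
  ∀ σ σ' : Sub, (∀ τ n, n < N → σ τ n = σ' τ n) → φ.subst σ = φ.subst σ'

def Tm.Below (N : ℕ) {τ : Ty} (t : Tm τ) : Prop :=
  ∀ σ σ' : Sub, (∀ τ n, n < N → σ τ n = σ' τ n) → t.subst σ = t.subst σ'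

theorem Tm.exists_below {τ : Ty} (t : Tm τ) : ∃ N, t.Below N := by
  induction t with
  | var τ n => exact ⟨n + 1, fun σ σ' h => h τ n n.lt_succ_self⟩
  | cst c => exact ⟨0, fun _ _ _ => rfl⟩
  | app s t hs ht =>
    obtain ⟨N, hN⟩ := hs
    obtain ⟨N', hN'⟩ := ht
    exact ⟨max N N', fun σ σ' h => by
      rw [Tm.subst_app, Tm.subst_app, hN σ σ' fun τ n hn => h τ n (by omega),
        hN' σ σ' fun τ n hn => h τ n (by omega)]⟩

/-- A binder moves the index `n` of its type to `n + 1`, so agreement below `N` survives and the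
bound need not change with quantifier depth. -/
theorem Sub.lift_congr {N : ℕ} {σ σ' : Sub} (h : ∀ τ n, n < N → σ τ n = σ' τ n) (ρ τ : Ty) (n : ℕ)
    (hn : n < N) : Sub.lift ρ σ τ n = Sub.lift ρ σ' τ n := by
  by_cases hρ : ρ = τ
  · subst hρ
    cases n with
    | zero => simp
    | succ n => simp [h ρ n (by omega)]
  · simp [Sub.lift_of_ne _ hρ, h τ n hn]

theorem Fm.exists_below (φ : Fm) : ∃ N, φ.Below N := by
  have two : ∀ {φ ψ : Fm}, (∃ N, φ.Below N) → (∃ N, ψ.Below N) → ∃ N, φ.Below N ∧ ψ.Below N := by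
    rintro φ ψ ⟨N, hN⟩ ⟨N', hN'⟩
    exact ⟨max N N', fun σ σ' h => hN σ σ' fun τ n hn => h τ n (by omega),
      fun σ σ' h => hN' σ σ' fun τ n hn => h τ n (by omega)⟩
  induction φ with
  | eq s t =>
    obtain ⟨N, hN⟩ := s.exists_below
    obtain ⟨N', hN'⟩ := t.exists_below
    exact ⟨max N N', fun σ σ' h => by
      rw [Fm.subst, Fm.subst, hN σ σ' fun τ n hn => h τ n (by omega),
        hN' σ σ' fun τ n hn => h τ n (by omega)]⟩
  | and φ ψ hφ hψ =>
    obtain ⟨N, h₁, h₂⟩ := two hφ hψ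
    exact ⟨N, fun σ σ' h => by rw [Fm.subst, Fm.subst, h₁ σ σ' h, h₂ σ σ' h]⟩
  | or φ ψ hφ hψ =>
    obtain ⟨N, h₁, h₂⟩ := two hφ hψ
    exact ⟨N, fun σ σ' h => by rw [Fm.subst, Fm.subst, h₁ σ σ' h, h₂ σ σ' h]⟩
  | imp φ ψ hφ hψ =>
    obtain ⟨N, h₁, h₂⟩ := two hφ hψ
    exact ⟨N, fun σ σ' h => by rw [Fm.subst, Fm.subst, h₁ σ σ' h, h₂ σ σ' h]⟩
  | all τ φ hφ =>
    obtain ⟨N, hN⟩ := hφ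
    exact ⟨N, fun σ σ' h => by rw [Fm.subst, Fm.subst, hN _ _ (Sub.lift_congr h τ)]⟩
  | ex τ φ hφ =>
    obtain ⟨N, hN⟩ := hφ
    exact ⟨N, fun σ σ' h => by rw [Fm.subst, Fm.subst, hN _ _ (Sub.lift_congr h τ)]⟩

theorem Fm.Below.mono {N N' : ℕ} {φ : Fm} (h : φ.Below N) (hN : N ≤ N') : φ.Below N' :=
  fun σ σ' hσ => h σ σ' fun τ n hn => hσ τ n (hn.trans_le hN)

theorem Fm.exists_below_list (H : List Fm) : ∃ N, ∀ φ ∈ H, φ.Below N := by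
  induction H with
  | nil => exact ⟨0, by simp⟩
  | cons φ H ih =>
    obtain ⟨N, hN⟩ := ih
    obtain ⟨N', hN'⟩ := φ.exists_below
    refine ⟨max N N', ?_⟩
    simp only [List.mem_cons, forall_eq_or_imp]
    exact ⟨hN'.mono (by omega), fun ψ hψ => (hN ψ hψ).mono (by omega)⟩

/-- The substitution that makes the variable `N` of type `ρ` the innermost one. -/
def Sub.bind (ρ : Ty) (N : ℕ) : Sub := fun τ n =>
  if ρ = τ ∧ n = N then .var τ 0 else Sub.shift ρ τ n

section
variable {Ax : Fm → Prop} {H : List Fm}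

/-- A fresh variable may serve as a witness. -/
theorem Proves.of_fresh_witness (hA : ∀ φ σ, Ax φ → Ax (φ.subst σ)) {ρ : Ty} {φ : Fm} {N : ℕ}
    (hH : ∀ ψ ∈ H, ψ.Below N) (hφ : (Fm.ex ρ φ).Below N) (hex : Fm.ex ρ φ ∈ H)
    (h : Proves Ax (φ.subst (Sub.inst (.var ρ N)) :: H) Fm.bot) : Proves Ax H Fm.bot := by
  -- Renaming the fresh variable to the innermost one weakens all hypotheses and restores the body
  -- `φ`, which is the shape demanded by `exE`.
  have h' := h.subst hA (Sub.bind ρ N)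
  have h₁ : ∀ ψ : Fm, ψ.Below N → ψ.subst (Sub.bind ρ N) = ψ.wk ρ := fun ψ hψ =>
    hψ _ _ fun τ n hn => by simp [Sub.bind, hn.ne]
  have h₂ : (φ.subst (Sub.inst (.var ρ N))).subst (Sub.bind ρ N) = φ := by
    have h₃ := h₁ _ hφ
    simp only [Fm.subst, Fm.wk, Fm.ex.injEq, true_and] at h₃
    rw [Fm.subst_inst_subst, h₃]
    convert φ.subst_lift_shift_inst_var ρ
    simp [Sub.bind]
  rw [List.map_cons, h₂, List.map_congr_left fun ψ hψ => h₁ ψ (hH ψ hψ)] at h'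
  exact .exE (.hyp hex) h'

end

/-! ### Term models -/

/-- Complete theories with witnesses that contain all theorems of `Ax`. -/
structure Model (Ax : Fm → Prop) where
  th : Set Fm
  thm : ∀ {φ}, Proves Ax [] φ → φ ∈ th
  and_iff : ∀ φ ψ, (φ ⊓ᶠ ψ) ∈ th ↔ φ ∈ th ∧ ψ ∈ th
  or_iff : ∀ φ ψ, Fm.or φ ψ ∈ th ↔ φ ∈ th ∨ ψ ∈ th
  imp_iff : ∀ φ ψ, (φ ⇒ᶠ ψ) ∈ th ↔ (φ ∈ th → ψ ∈ th)
  all_iff : ∀ ρ φ, Fm.all ρ φ ∈ th ↔ ∀ t : Tm ρ, φ.subst (Sub.inst t) ∈ th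
  ex_iff : ∀ ρ φ, Fm.ex ρ φ ∈ th ↔ ∃ t : Tm ρ, φ.subst (Sub.inst t) ∈ th
  bot_not_mem : Fm.bot ∉ th

section
variable (Ax : Fm → Prop)

/-- One step of Henkin's construction. -/
noncomputable def henkinStep (H : List Fm) (φ : Fm) : List Fm :=
  open Classical in
  if Proves Ax (φ :: H) Fm.bot then H
  else
    match φ with
    -- The index of the witness bounds all variables of the current list, including those of the new
    -- formula.
    | .ex ρ ψ => ψ.subst (Sub.inst (.var ρ (Fm.exists_below_list (.ex ρ ψ :: H)).choose)) ::
        .ex ρ ψ :: H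
    | φ => φ :: H

variable {Ax}

theorem henkinStep_consistent (hA : ∀ φ σ, Ax φ → Ax (φ.subst σ)) {H : List Fm}
    (hH : ¬ Proves Ax H Fm.bot) (φ : Fm) : ¬ Proves Ax (henkinStep Ax H φ) Fm.bot := by
  unfold henkinStep
  split_ifs with h
  · exact hH
  · split
    · rename_i ρ ψ
      have hN := (Fm.exists_below_list (.ex ρ ψ :: H)).choose_spec
      exact fun h' => h (.of_fresh_witness hA hN (hN _ (by simp)) (by simp) h')
    · exact h

theorem subset_henkinStep (H : List Fm) (φ : Fm) : H ⊆ henkinStep Ax H φ := by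
  unfold henkinStep
  split_ifs
  · simp
  · split
    · exact fun ψ h => by simp [h]
    · simp

theorem mem_henkinStep {H : List Fm} {φ : Fm} (h : ¬ Proves Ax (φ :: H) Fm.bot) :
    φ ∈ henkinStep Ax H φ := by
  unfold henkinStep
  rw [if_neg h]
  split <;> simp

theorem exists_mem_henkinStep {H : List Fm} {ρ : Ty} {φ : Fm}
    (h : ¬ Proves Ax (.ex ρ φ :: H) Fm.bot) :
    ∃ t : Tm ρ, φ.subst (Sub.inst t) ∈ henkinStep Ax H (.ex ρ φ) := by
  unfold henkinStep
  rw [if_neg h]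
  exact ⟨_, by simp; left; rfl⟩

/-- A consistent set of hypotheses is part of a complete theory with witnesses. -/
theorem exists_model (hA : ∀ φ σ, Ax φ → Ax (φ.subst σ)) {H : List Fm}
    (hH : ¬ Proves Ax H Fm.bot) : ∃ 𝔐 : Model Ax, ∀ φ ∈ H, φ ∈ 𝔐.th := by
  have : Nonempty Fm := ⟨Fm.bot⟩
  obtain ⟨e, he⟩ := exists_surjective_nat Fm
  let G : ℕ → List Fm := fun n => Nat.rec H (fun n K => henkinStep Ax K (e n)) n
  have hG : ∀ n, G (n + 1) = henkinStep Ax (G n) (e n) := fun n => rfl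
  have mono : ∀ {m n}, m ≤ n → G m ⊆ G n := fun {m n} h => by
    induction h with
    | refl => exact List.Subset.refl _
    | step _ ih => exact fun φ hφ => subset_henkinStep _ _ (ih hφ)
  have cons : ∀ n, ¬ Proves Ax (G n) Fm.bot := fun n => by
    induction n with
    | zero => exact hH
    | succ n ih => exact henkinStep_consistent hA ih _
  -- The deductive closure of the union of all stages.
  let T : Set Fm := {φ | ∃ n, Proves Ax (G n) φ}
  have ded : ∀ {n φ ψ}, φ ∈ T → Proves Ax (φ :: G n) ψ → ψ ∈ T := by
    rintro n φ ψ ⟨m, hm⟩ h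
    refine ⟨max m n, (hm.weaken (mono (le_max_left _ _))).cut (h.weaken ?_)⟩
    exact List.cons_subset_cons _ (mono (le_max_right _ _))
  have mp : ∀ {φ ψ}, (φ ⇒ᶠ ψ) ∈ T → φ ∈ T → ψ ∈ T := by
    rintro φ ψ ⟨m, hm⟩ h
    exact ded h (.impE (hm.weaken (List.subset_cons_self _ _)) (.hyp (by simp)))
  have bot : Fm.bot ∉ T := fun ⟨n, hn⟩ => cons n hn
  -- Each formula is enumerated at some stage, where it is either refuted or added.
  have total : ∀ φ, φ ∉ T → φ.neg ∈ T := fun φ hφ => by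
    obtain ⟨n, rfl⟩ := he φ
    by_cases h : Proves Ax (e n :: G n) Fm.bot
    · exact ⟨n, .impI h⟩
    · exact (hφ ⟨n + 1, .hyp (hG n ▸ mem_henkinStep h)⟩).elim
  have neg : ∀ φ, φ.neg ∈ T ↔ φ ∉ T := fun φ => ⟨fun h h' => bot (mp h h'), total φ⟩
  have thm : ∀ {φ}, Proves Ax [] φ → φ ∈ T := fun h => ⟨0, h.weaken (by simp)⟩
  have wit : ∀ ρ φ, Fm.ex ρ φ ∈ T ↔ ∃ t : Tm ρ, φ.subst (Sub.inst t) ∈ T := by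
    intro ρ φ
    refine ⟨fun h => ?_, fun ⟨t, n, h⟩ => ⟨n, .exI t h⟩⟩
    obtain ⟨n, hn⟩ := he (.ex ρ φ)
    have h' : ¬ Proves Ax (.ex ρ φ :: G n) Fm.bot := fun h' => bot (ded h h')
    obtain ⟨t, ht⟩ := exists_mem_henkinStep h'
    exact ⟨t, n + 1, .hyp (by rwa [hG, hn])⟩
  refine ⟨⟨T, thm, ?_, ?_, ?_, ?_, wit, bot⟩, fun φ hφ => ⟨0, .hyp hφ⟩⟩
  · refine fun φ ψ => ⟨fun ⟨n, h⟩ => ⟨⟨n, .andE₁ h⟩, ⟨n, .andE₂ h⟩⟩, fun ⟨h₁, n, h₂⟩ => ?_⟩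
    exact ded h₁ (.andI (.hyp (by simp)) (h₂.weaken (List.subset_cons_self _ _)))
  · refine fun φ ψ => ⟨fun h => ?_, ?_⟩
    · by_contra! h'
      obtain ⟨n, h₁⟩ := total _ h'.1
      obtain ⟨m, h₂⟩ := total _ h'.2
      refine bot (ded (n := max n m) h (.orE (.hyp (List.mem_cons_self ..)) ?_ ?_))
      · exact .impE (h₁.weaken fun χ hχ => by simp [mono (le_max_left n m) hχ]) (.hyp (by simp))
      · exact .impE (h₂.weaken fun χ hχ => by simp [mono (le_max_right n m) hχ]) (.hyp (by simp))
    · rintro (⟨n, h⟩ | ⟨n, h⟩)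
      · exact ⟨n, .orI₁ h⟩
      · exact ⟨n, .orI₂ h⟩
  · refine fun φ ψ => ⟨mp, fun h => ?_⟩
    by_cases hφ : φ ∈ T
    · obtain ⟨n, hn⟩ := h hφ
      exact ⟨n, .impI (hn.weaken (List.subset_cons_self _ _))⟩
    · obtain ⟨n, hn⟩ := total φ hφ
      exact ⟨n, .impI (.efq (.impE (hn.weaken (List.subset_cons_self _ _)) (.hyp (by simp))))⟩
  -- If `∀` fails, its negation yields a witness of the negated body, which contradicts that all
  -- instances belong to the theory.
  · refine fun ρ φ => ⟨fun ⟨n, h⟩ t => ⟨n, .allE t h⟩, fun h => ?_⟩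
    by_contra h'
    obtain ⟨n, hn⟩ := total _ h'
    obtain ⟨t, ht⟩ := (wit ρ φ.neg).1 ⟨n, hn.ex_neg_of_neg_all⟩
    exact (neg _).1 ht (h t)

theorem complete (hA : ∀ φ σ, Ax φ → Ax (φ.subst σ)) {φ : Fm}
    (h : ∀ 𝔐 : Model Ax, φ ∈ 𝔐.th) : Proves Ax [] φ := by
  by_contra hφ
  obtain ⟨𝔐, h𝔐⟩ := exists_model (H := [φ.neg]) hA fun h => hφ h.byContra
  exact 𝔐.bot_not_mem ((𝔐.imp_iff _ _).1 (h𝔐 φ.neg (by simp)) (h 𝔐))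

end

end FinType
namespace FinType

/-! ### Ordered fields over ordered semirings -/

/-- A commutative domain is ordered by a suitable set of nonnegative elements. -/
theorem exists_linearOrder_of_cone {R : Type} [CommRing R] [IsDomain R] (P : R → Prop)
    (add : ∀ x y, P x → P y → P (x + y)) (mul : ∀ x y, P x → P y → P (x * y))
    (anti : ∀ x, P x → P (-x) → x = 0) (total : ∀ x, P x ∨ P (-x)) :
    ∃ _ : LinearOrder R, IsStrictOrderedRing R ∧ ∀ x : R, 0 ≤ x ↔ P x := by
  classical
  have zero : P 0 := (total 0).elim id fun h => by simpa using h
  have one : P 1 := (total 1).elim id fun h => by simpa using mul _ _ h h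
  let o : LinearOrder R :=
    { le := fun x y => P (y - x)
      le_refl := fun x => by simpa using zero
      le_trans := fun x y z h h' => by simpa using add _ _ h h'
      le_antisymm := fun x y h h' =>
        (sub_eq_zero.1 (anti _ h (by simpa using h'))).symm
      le_total := fun x y => by simpa using total (y - x)
      toDecidableLE := fun _ _ => Classical.propDecidable _ }
  have hle : ∀ x y : R, x ≤ y ↔ P (y - x) := fun _ _ => Iff.rfl
  have h₁ : IsOrderedAddMonoid R :=
    { add_le_add_left := fun x y h z => by simpa [hle] using h }
  have h₂ : ZeroLEOneClass R := ⟨by simpa [hle] using one⟩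
  have h₃ : IsOrderedRing R := .of_mul_nonneg fun x y hx hy => by
    rw [hle, sub_zero] at *
    exact mul _ _ hx hy
  exact ⟨o, inferInstance, fun x => by rw [hle, sub_zero]⟩

section
variable (M : Type) [CommSemiring M] [LinearOrder M] [IsStrictOrderedRing M]

/-- Formal differences of elements of `M`. -/
def diffSetoid : Setoid (M × M) where
  r x y := x.1 + y.2 = y.1 + x.2
  iseqv :=
    { refl := fun _ => rfl
      symm := fun h => h.symm
      trans := fun {x y z} h h' => by linear_combination h + h' }

def Diff : Type := Quotient (diffSetoid M)

namespace Diff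
variable {M}

def mk (a b : M) : Diff M := Quotient.mk (diffSetoid M) (a, b)

theorem mk_eq {a b c d : M} : mk a b = mk c d ↔ a + d = c + b := Quotient.eq (r := diffSetoid M)

theorem ind {P : Diff M → Prop} (h : ∀ a b, P (mk a b)) (x : Diff M) : P x :=
  Quotient.ind (fun ⟨a, b⟩ => h a b) x

instance : Add (Diff M) := ⟨Quotient.map₂ (fun x y => (x.1 + y.1, x.2 + y.2))
  fun x x' h y y' h' => show _ + _ = _ + _ by
    change x.1 + x'.2 = x'.1 + x.2 at h
    change y.1 + y'.2 = y'.1 + y.2 at h'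
    linear_combination h + h'⟩

instance : Mul (Diff M) := ⟨Quotient.map₂
  (fun x y => (x.1 * y.1 + x.2 * y.2, x.1 * y.2 + x.2 * y.1))
  fun x x' h y y' h' => show _ + _ = _ + _ by
    change x.1 + x'.2 = x'.1 + x.2 at h
    change y.1 + y'.2 = y'.1 + y.2 at h'
    dsimp only
    linear_combination y.1 * h + y.2 * h.symm + x'.1 * h' + x'.2 * h'.symm⟩

instance : Neg (Diff M) := ⟨Quotient.map (fun x => (x.2, x.1))
  fun x x' h => show _ + _ = _ + _ by
    change x.1 + x'.2 = x'.1 + x.2 at h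
    linear_combination h.symm⟩

instance : Zero (Diff M) := ⟨mk 0 0⟩
instance : One (Diff M) := ⟨mk 1 0⟩

theorem mk_add (a b c d : M) : mk a b + mk c d = mk (a + c) (b + d) := rfl
theorem mk_mul (a b c d : M) : mk a b * mk c d = mk (a * c + b * d) (a * d + b * c) := rfl
theorem neg_mk (a b : M) : -mk a b = mk b a := rfl
theorem zero_def : (0 : Diff M) = mk 0 0 := rfl
theorem one_def : (1 : Diff M) = mk 1 0 := rfl

instance : CommRing (Diff M) := by
  apply CommRing.ofMinimalAxioms
  · refine ind fun a b => ind fun c d => ind fun e f => ?_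
    simp only [mk_add, mk_eq]; ring
  · refine ind fun a b => ?_
    simp only [mk_add, mk_eq, zero_def]; ring
  · refine ind fun a b => ?_
    simp only [mk_add, mk_eq, zero_def, neg_mk]; ring
  · refine ind fun a b => ind fun c d => ind fun e f => ?_
    simp only [mk_mul, mk_eq]; ring
  · refine ind fun a b => ind fun c d => ?_
    simp only [mk_mul, mk_eq]; ring
  · refine ind fun a b => ?_
    simp only [mk_mul, mk_eq, one_def]; ring
  · refine ind fun a b => ind fun c d => ind fun e f => ?_
    simp only [mk_mul, mk_add, mk_eq]; ring

/-- The embedding of `M`. -/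
def of : M →+* Diff M where
  toFun a := mk a 0
  map_zero' := rfl
  map_one' := rfl
  map_add' a b := by rw [mk_add, add_zero]
  map_mul' a b := by rw [mk_mul]; simp

theorem of_injective : Function.Injective (of (M := M)) := fun a b h => by
  simpa using mk_eq.1 h

theorem eq_or_eq_neg_of (hM : ∀ a b : M, a ≤ b → ∃ c, b = a + c) (x : Diff M) :
    ∃ a : M, x = of a ∨ x = -of a := by
  induction x using ind with | h a b => ?_
  rcases le_total b a with h | h <;> obtain ⟨c, rfl⟩ := hM _ _ h
  · exact ⟨c, .inl (mk_eq.2 (by ring))⟩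
  · exact ⟨c, .inr (mk_eq.2 (by ring))⟩

end Diff

/-- By `hM` every formal difference is an element of `M` up to sign. The absence of zero divisors is
thereby inherited from `M`, and the image of `M` is the cone of nonnegative elements. -/
theorem exists_ordered_ring (h0 : ∀ a : M, 0 ≤ a) (hM : ∀ a b : M, a ≤ b → ∃ c, b = a + c) :
    ∃ (Z : Type) (_ : CommRing Z) (_ : LinearOrder Z) (_ : IsStrictOrderedRing Z) (ι : M →+* Z),
      StrictMono ι ∧ ∀ x, ∃ a, x = ι a ∨ x = -ι a := by
  have sg := Diff.eq_or_eq_neg_of hM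
  have inj := Diff.of_injective (M := M)
  have : Nontrivial (Diff M) := inj.nontrivial
  have : ExistsAddOfLE M := ⟨fun {a b} h => hM a b h⟩
  have : NoZeroDivisors (Diff M) := ⟨by
    intro x y h
    obtain ⟨a, ha⟩ := sg x
    obtain ⟨b, hb⟩ := sg y
    have : Diff.of (a * b) = 0 := by
      rcases ha with rfl | rfl <;> rcases hb with rfl | rfl <;> simpa using h
    rw [← map_zero Diff.of] at this
    rcases mul_eq_zero.1 (inj this) with rfl | rfl
    · left; rcases ha with rfl | rfl <;> simp
    · right; rcases hb with rfl | rfl <;> simp⟩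
  have : IsDomain (Diff M) := NoZeroDivisors.to_isDomain _
  obtain ⟨o, ho, hP⟩ := exists_linearOrder_of_cone (fun x : Diff M => ∃ a, x = Diff.of a)
    (by rintro _ _ ⟨a, rfl⟩ ⟨b, rfl⟩; exact ⟨a + b, by simp⟩)
    (by rintro _ _ ⟨a, rfl⟩ ⟨b, rfl⟩; exact ⟨a * b, by simp⟩)
    (by
      rintro _ ⟨a, rfl⟩ ⟨b, hb⟩
      have : Diff.of (a + b) = Diff.of 0 := by rw [map_add, ← hb]; simp
      have := inj this
      have : a = 0 := le_antisymm (by rw [← this]; exact le_add_of_nonneg_right (h0 b)) (h0 a)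
      simp [this])
    (fun x => by
      obtain ⟨a, rfl | rfl⟩ := sg x
      · exact .inl ⟨a, rfl⟩
      · exact .inr ⟨a, by simp⟩)
  refine ⟨Diff M, inferInstance, o, ho, Diff.of, Monotone.strictMono_of_injective ?_ inj, sg⟩
  intro a b h
  obtain ⟨c, rfl⟩ := hM _ _ h
  rw [map_add]
  exact le_add_of_nonneg_right ((hP _).2 ⟨c, rfl⟩)

end

/-- The cone consists of the fractions with nonnegative numerator and positive denominator; a change
of signs makes any denominator positive. -/
theorem exists_linearOrder_of_isFractionRing (Z K : Type) [CommRing Z] [LinearOrder Z]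
    [IsStrictOrderedRing Z] [Field K] [Algebra Z K] [IsFractionRing Z K] :
    ∃ (_ : LinearOrder K), IsStrictOrderedRing K ∧
      StrictMono (algebraMap Z K) ∧
      ∀ x, ∃ a b, 0 < b ∧ x = algebraMap Z K a / algebraMap Z K b := by
  set ι := algebraMap Z K
  have inj : Function.Injective ι := IsFractionRing.injective Z K
  have ne : ∀ {b : Z}, 0 < b → ι b ≠ 0 := fun {b} hb => by
    rw [← map_zero ι]
    exact fun h => hb.ne' (inj h)
  have rep : ∀ x, ∃ a b, 0 < b ∧ x = ι a / ι b := fun x => by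
    obtain ⟨a, b, hb, rfl⟩ := IsFractionRing.div_surjective (A := Z) x
    have hb0 : b ≠ 0 := nonZeroDivisors.ne_zero hb
    rcases lt_or_gt_of_ne hb0 with h | h
    · refine ⟨-a, -b, by simpa using h, ?_⟩
      rw [map_neg, map_neg, neg_div_neg_eq]
    · exact ⟨a, b, h, rfl⟩
  obtain ⟨o, ho, hP⟩ := exists_linearOrder_of_cone
    (fun x : K => ∃ a b, 0 ≤ a ∧ 0 < b ∧ x = ι a / ι b)
    (by
      rintro _ _ ⟨a, b, ha, hb, rfl⟩ ⟨c, d, hc, hd, rfl⟩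
      refine ⟨a * d + b * c, b * d, by positivity, by positivity, ?_⟩
      rw [div_add_div _ _ (ne hb) (ne hd)]
      simp)
    (by
      rintro _ _ ⟨a, b, ha, hb, rfl⟩ ⟨c, d, hc, hd, rfl⟩
      refine ⟨a * c, b * d, by positivity, by positivity, ?_⟩
      rw [div_mul_div_comm]
      simp)
    (by
      rintro _ ⟨a, b, ha, hb, rfl⟩ ⟨c, d, hc, hd, h⟩
      rw [← neg_div, div_eq_div_iff (ne hb) (ne hd), ← map_neg, ← map_mul, ← map_mul] at h
      have h := inj h
      have : a = 0 := by
        by_contra h'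
        have h₁ : 0 < a * d := mul_pos (lt_of_le_of_ne ha (Ne.symm h')) hd
        have h₂ : 0 ≤ c * b := by positivity
        linarith
      simp [this])
    (fun x => by
      obtain ⟨a, b, hb, rfl⟩ := rep x
      rcases le_total 0 a with h | h
      · exact .inl ⟨a, b, h, hb, rfl⟩
      · exact .inr ⟨-a, b, by simpa using h, hb, by rw [map_neg, neg_div]⟩)
  refine ⟨o, ho, Monotone.strictMono_of_injective ?_ inj, rep⟩
  intro a b h
  rw [← sub_nonneg, ← map_sub]
  exact (hP _).2 ⟨b - a, 1, by simpa using h, by simp, by simp⟩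

theorem exists_ordered_field_of_ring (Z : Type) [CommRing Z] [LinearOrder Z]
    [IsStrictOrderedRing Z] :
    ∃ (K : Type) (_ : Field K) (_ : LinearOrder K) (_ : IsStrictOrderedRing K) (ι : Z →+* K),
      StrictMono ι ∧ ∀ x, ∃ a b, 0 < b ∧ x = ι a / ι b := by
  obtain ⟨o, ho, mono, rep⟩ := exists_linearOrder_of_isFractionRing Z (FractionRing Z)
  exact ⟨FractionRing Z, inferInstance, o, ho, _, mono, rep⟩

/-- The Cauchy completion is an ordered field. -/
theorem exists_ordered_completion (K : Type) [Field K] [LinearOrder K] [IsStrictOrderedRing K] :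
    ∃ (R : Type) (_ : Field R) (_ : LinearOrder R) (_ : IsStrictOrderedRing R) (ι : K →+* R)
      (lim : CauSeq K abs → R), StrictMono ι ∧ Function.Surjective lim ∧
      (∀ x, lim (CauSeq.const abs x) = ι x) ∧ (∀ f g, f ≤ g → lim f ≤ lim g) := by
  obtain ⟨o, ho, hP⟩ := exists_linearOrder_of_cone
    (fun x : CauSeq.Completion.Cauchy (abs : K → K) =>
      ∃ f, x = CauSeq.Completion.mk f ∧ (f.Pos ∨ f.LimZero))
    (by
      rintro _ _ ⟨f, rfl, hf⟩ ⟨g, rfl, hg⟩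
      refine ⟨f + g, by simp, ?_⟩
      rcases hf with hf | hf <;> rcases hg with hg | hg
      · exact .inl (CauSeq.add_pos hf hg)
      · exact .inl (CauSeq.pos_add_limZero hf hg)
      · rw [add_comm]
        exact .inl (CauSeq.pos_add_limZero hg hf)
      · exact .inr (CauSeq.add_limZero hf hg))
    (by
      rintro _ _ ⟨f, rfl, hf⟩ ⟨g, rfl, hg⟩
      refine ⟨f * g, by simp, ?_⟩
      rcases hf with hf | hf
      · rcases hg with hg | hg
        · exact .inl (CauSeq.mul_pos hf hg)
        · exact .inr (CauSeq.mul_limZero_right _ hg)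
      · exact .inr (CauSeq.mul_limZero_left _ hf))
    (by
      rintro _ ⟨f, rfl, hf⟩ ⟨g, h, hg⟩
      rw [CauSeq.Completion.mk_neg, CauSeq.Completion.mk_eq] at h
      rw [CauSeq.Completion.mk_eq_zero]
      refine hf.resolve_left fun hf => ?_
      rcases hg with hg | hg
      · refine CauSeq.not_limZero_of_pos (CauSeq.add_pos hf hg) ?_
        simpa [add_comm] using CauSeq.neg_limZero h
      · refine CauSeq.not_limZero_of_pos hf ?_
        simpa using CauSeq.neg_limZero (CauSeq.add_limZero h hg))
    (fun x => by
      obtain ⟨f, rfl⟩ := Quotient.mk_surjective x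
      rcases f.trichotomy with h | h | h
      · exact .inl ⟨f, rfl, .inl h⟩
      · exact .inl ⟨f, rfl, .inr h⟩
      · exact .inr ⟨-f, rfl, .inl h⟩)
  have mono : ∀ f g : CauSeq K abs, f ≤ g →
      CauSeq.Completion.mk f ≤ CauSeq.Completion.mk g := fun f g h => by
    rw [← sub_nonneg, hP]
    refine ⟨g - f, by simp, h.imp id fun h => ?_⟩
    simpa using CauSeq.neg_limZero h
  refine ⟨CauSeq.Completion.Cauchy (abs : K → K), inferInstance, o, ho,
    CauSeq.Completion.ofRatRingHom, CauSeq.Completion.mk,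
    Monotone.strictMono_of_injective ?_ (RingHom.injective _), Quotient.mk_surjective,
    fun _ => rfl, mono⟩
  intro x y h
  exact mono _ _ (CauSeq.const_le.2 h)

theorem abs_map_le_iff {K R : Type} [Field K] [LinearOrder K] [IsStrictOrderedRing K] [Field R]
    [LinearOrder R] [IsStrictOrderedRing R] {ι : K →+* R} (h : StrictMono ι) {x y : K} :
    |ι x| ≤ ι y ↔ |x| ≤ y := by
  rw [abs_le, abs_le, ← map_neg, h.le_iff_le, h.le_iff_le]

/-- An ordered field over `M` in which the sequences indexed by `M` of fractions that converge with
rate `1 / p` have limits. -/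
theorem exists_complete_field (M : Type) [Countable M] [CommSemiring M] [LinearOrder M]
    [IsStrictOrderedRing M] (h0 : ∀ a : M, 0 ≤ a) (h1 : ∀ a : M, 0 < a → 1 ≤ a)
    (hM : ∀ a b : M, a ≤ b → ∃ c, b = a + c) (p : M → M) (hp : ∀ a, a < p a) :
    ∃ (R : Type) (_ : Field R) (_ : LinearOrder R) (_ : IsStrictOrderedRing R) (ι : M →+* R),
      StrictMono ι ∧ (∀ x, ∃ a, x < ι a) ∧
      ∀ a : M → R, (∀ n, ∃ b c d, d ≠ 0 ∧ a n = (ι b - ι c) / ι d) →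
        (∀ m n, m ≤ n → |a m - a n| ≤ (ι (p m))⁻¹) → ∃ x, ∀ n, |x - a n| ≤ (ι (p n))⁻¹ := by
  obtain ⟨Z, _, _, _, ι₁, mono₁, rep₁⟩ := exists_ordered_ring M h0 hM
  obtain ⟨K, _, _, _, ι₂, mono₂, rep₂⟩ := exists_ordered_field_of_ring Z
  obtain ⟨R, _, _, _, ι₃, lim, mono₃, surj, const, mono⟩ := exists_ordered_completion K
  let κ : M →+* K := ι₂.comp ι₁
  have monoκ : StrictMono κ := mono₂.comp mono₁
  have κnn : ∀ a : M, 0 ≤ κ a := fun a => by simpa using monoκ.monotone (h0 a)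
  have ιnn : ∀ a : M, 0 ≤ ι₁ a := fun a => by simpa using mono₁.monotone (h0 a)
  -- Positive elements of `Z` are at least `1`, so a fraction is bounded by the absolute value of
  -- its numerator.
  have arch : ∀ x : K, ∃ a, x < κ a := fun x => by
    obtain ⟨z, w, hw, rfl⟩ := rep₂ x
    obtain ⟨a, ha⟩ := rep₁ z
    have hz : z ≤ ι₁ a := by
      have := ιnn a
      rcases ha with rfl | rfl <;> linarith
    have hw1 : 1 ≤ w := by
      obtain ⟨b, rfl | rfl⟩ := rep₁ w
      · have hb : 0 < b := mono₁.lt_iff_lt.1 (by simpa using hw)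
        simpa using mono₁.monotone (h1 _ hb)
      · linarith [ιnn b]
    refine ⟨a + 1, ?_⟩
    have hw' : (1 : K) ≤ ι₂ w := by simpa using mono₂.monotone hw1
    have hz' : ι₂ z ≤ κ a := mono₂.monotone hz
    rw [div_lt_iff₀ (by linarith), map_add, map_one]
    nlinarith [κnn a]
  have κp : ∀ n, 0 < κ (p n) := fun n => (κnn n).trans_lt (monoκ (hp n))
  refine ⟨R, inferInstance, inferInstance, inferInstance, ι₃.comp κ, mono₃.comp monoκ,
    fun x => ?_, fun a ha hreg => ?_⟩
  · obtain ⟨f, rfl⟩ := surj x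
    obtain ⟨r, hr⟩ := f.exists_gt
    obtain ⟨a, ha⟩ := arch r
    refine ⟨a, (mono _ _ hr.le).trans_lt ?_⟩
    rw [const]
    exact mono₃ ha
  -- Being fractions over `M`, all `a n` lie in `K`, whose Cauchy sequences have limits in `R` by
  -- construction; completeness of `R` itself is not needed.
  · choose b c d hd hq using ha
    let q : M → K := fun n => (κ (b n) - κ (c n)) / κ (d n)
    have hq' : ∀ n, a n = ι₃ (q n) := fun n => by simp [hq, q]
    have hqreg : ∀ m n, m ≤ n → |q m - q n| ≤ (κ (p m))⁻¹ := fun m n h => by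
      rw [← abs_map_le_iff mono₃, map_sub, ← hq', ← hq', map_inv₀]
      exact hreg m n h
    -- As `M` is countable, a sequence indexed by `ℕ` tends to infinity in `M`; along it the
    -- `M`-indexed family becomes an ordinary Cauchy sequence.
    obtain ⟨s, hs⟩ := Filter.exists_seq_tendsto (Filter.atTop : Filter M)
    have hcau : IsCauSeq abs (fun j => q (s j)) := fun ε hε => by
      -- Since `p m > m > 2 / ε`, all later terms are within `ε / 2` of `q m`.
      obtain ⟨m, hm⟩ := arch (2 / ε)
      obtain ⟨i, hi⟩ := Filter.eventually_atTop.1 (hs.eventually_ge_atTop m)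
      have hpm : (κ (p m))⁻¹ < ε / 2 := by
        rw [inv_lt_comm₀ (κp m) (by positivity), inv_div]
        exact hm.trans (monoκ (hp m))
      refine ⟨i, fun j hj => ?_⟩
      have e₁ := abs_le.1 (hqreg _ _ (hi j hj))
      have e₂ := abs_le.1 (hqreg _ _ (hi i le_rfl))
      rw [abs_lt]
      constructor <;> linarith
    refine ⟨lim ⟨_, hcau⟩, fun n => ?_⟩
    obtain ⟨i, hi⟩ := Filter.eventually_atTop.1 (hs.eventually_ge_atTop n)
    have up := mono ⟨_, hcau⟩ (CauSeq.const abs (q n + (κ (p n))⁻¹)) (CauSeq.le_of_exists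
      ⟨i, fun j hj => by
        have := abs_le.1 (hqreg _ _ (hi j hj))
        simp only [CauSeq.const_apply]
        change q (s j) ≤ _
        linarith⟩)
    have dn := mono (CauSeq.const abs (q n - (κ (p n))⁻¹)) ⟨_, hcau⟩ (CauSeq.le_of_exists
      ⟨i, fun j hj => by
        have := abs_le.1 (hqreg _ _ (hi j hj))
        simp only [CauSeq.const_apply]
        change _ ≤ q (s j)
        linarith⟩)
    rw [const, map_add, ← hq', map_inv₀] at up
    rw [const, map_sub, ← hq', map_inv₀] at dn
    rw [abs_le]
    simp only [RingHom.comp_apply] at *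
    constructor <;> linarith

end FinType
namespace FinType

/-! ### The numbers of a term model -/

namespace Model
variable {Ax : Fm → Prop} (𝔐 : Model Ax)

def numSetoid : Setoid (Tm Ty.nat) where
  r s t := (s ≐ t) ∈ 𝔐.th
  iseqv :=
    { refl := fun s => 𝔐.thm (.pa (.eq_refl s))
      symm := fun {s t} h => (𝔐.imp_iff _ _).1 (𝔐.thm (.pa (.eq_symm s t))) h
      trans := fun {s t u} h h' =>
        (𝔐.imp_iff _ _).1 ((𝔐.imp_iff _ _).1 (𝔐.thm (.pa (.eq_trans s t u))) h) h' }

/-- Terms of type `0` up to equality. -/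
def Num : Type := Quotient 𝔐.numSetoid

def val (t : Tm Ty.nat) : 𝔐.Num := Quotient.mk _ t

theorem val_eq {s t : Tm Ty.nat} : 𝔐.val s = 𝔐.val t ↔ (s ≐ t) ∈ 𝔐.th :=
  Quotient.eq (r := 𝔐.numSetoid)

theorem eq_mem_iff {s t : Tm Ty.nat} : (s ≐ t) ∈ 𝔐.th ↔ 𝔐.val s = 𝔐.val t := 𝔐.val_eq.symm

theorem exists_val (n : 𝔐.Num) : ∃ t, 𝔐.val t = n := Quotient.mk_surjective n

instance : Countable 𝔐.Num := Function.Surjective.countable 𝔐.exists_val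

variable {𝔐} in
theorem forall_num {P : 𝔐.Num → Prop} : (∀ n, P n) ↔ ∀ t, P (𝔐.val t) :=
  ⟨fun h t => h _, fun h n => by obtain ⟨t, rfl⟩ := 𝔐.exists_val n; exact h t⟩

theorem val_ceq {s t : Tm Ty.nat} (h : CEq Ax s t) : 𝔐.val s = 𝔐.val t :=
  𝔐.val_eq.2 (𝔐.thm h.proves)

theorem val_congr {s t : Tm Ty.nat} (h : 𝔐.val s = 𝔐.val t) (r : Tm Ty.nat) :
    𝔐.val (r.subst (Sub.inst s)) = 𝔐.val (r.subst (Sub.inst t)) :=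
  𝔐.val_eq.2 ((𝔐.imp_iff _ _).1
    (𝔐.thm (.impI (Proves.nat_congr s t r (.hyp (by simp))))) (𝔐.val_eq.1 h))

theorem val_app_congr (f : Tm Ty.one) {s t : Tm Ty.nat} (h : 𝔐.val s = 𝔐.val t) :
    𝔐.val (f ⬝ s) = 𝔐.val (f ⬝ t) := by
  simpa [Sub.inst] using 𝔐.val_congr h (f.wk Ty.nat ⬝ nv 0)

theorem val_app₂_congr (f : Tm Op2) {s t s' t' : Tm Ty.nat} (h : 𝔐.val s = 𝔐.val t)
    (h' : 𝔐.val s' = 𝔐.val t') : 𝔐.val (f ⬝ s ⬝ s') = 𝔐.val (f ⬝ t ⬝ t') := by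
  rw [𝔐.val_app_congr (f ⬝ s) h']
  simpa [Sub.inst] using 𝔐.val_congr h (f.wk Ty.nat ⬝ nv 0 ⬝ t'.wk Ty.nat)

/-- The function given by a term of type `1`. -/
def ap (f : Tm Ty.one) : 𝔐.Num → 𝔐.Num :=
  Quotient.map (fun t => f ⬝ t) fun _ _ h => 𝔐.val_eq.1 (𝔐.val_app_congr f (𝔐.val_eq.2 h))

/-- The binary function given by a term. -/
def ap₂ (f : Tm Op2) : 𝔐.Num → 𝔐.Num → 𝔐.Num :=
  Quotient.map₂ (fun s t => f ⬝ s ⬝ t) fun _ _ h _ _ h' =>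
    𝔐.val_eq.1 (𝔐.val_app₂_congr f (𝔐.val_eq.2 h) (𝔐.val_eq.2 h'))

theorem val_ap (f : Tm Ty.one) (t : Tm Ty.nat) : 𝔐.val (f ⬝ t) = 𝔐.ap f (𝔐.val t) := rfl

theorem val_ap₂ (f : Tm Op2) (s t : Tm Ty.nat) :
    𝔐.val (f ⬝ s ⬝ t) = 𝔐.ap₂ f (𝔐.val s) (𝔐.val t) := rfl

/-! Definable functions and predicates. -/

/-- The model may be nonstandard, and induction holds only for predicates given by a formula,
possibly with parameters. Every induction on numbers below therefore comes with a definability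
proof. -/
def DefF (F : 𝔐.Num → 𝔐.Num) : Prop :=
  ∃ r : Tm Ty.nat, ∀ t, 𝔐.val (r.subst (Sub.inst t)) = F (𝔐.val t)

def DefP (P : 𝔐.Num → Prop) : Prop :=
  ∃ φ : Fm, ∀ t, φ.subst (Sub.inst t) ∈ 𝔐.th ↔ P (𝔐.val t)

section
variable {𝔐} {F G : 𝔐.Num → 𝔐.Num} {P Q : 𝔐.Num → Prop}

theorem DefF.id : 𝔐.DefF fun n => n := ⟨nv 0, fun t => by simp [Sub.inst]⟩

theorem DefF.const (n : 𝔐.Num) : 𝔐.DefF fun _ => n := by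
  obtain ⟨s, rfl⟩ := 𝔐.exists_val n
  exact ⟨s.wk Ty.nat, fun t => by simp⟩

theorem DefF.ap (f : Tm Ty.one) (hF : 𝔐.DefF F) : 𝔐.DefF fun n => 𝔐.ap f (F n) := by
  obtain ⟨r, hr⟩ := hF
  exact ⟨f.wk Ty.nat ⬝ r, fun t => by simp [val_ap, hr]⟩

theorem DefF.ap₂ (f : Tm Op2) (hF : 𝔐.DefF F) (hG : 𝔐.DefF G) :
    𝔐.DefF fun n => 𝔐.ap₂ f (F n) (G n) := by
  obtain ⟨r, hr⟩ := hF
  obtain ⟨s, hs⟩ := hG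
  exact ⟨f.wk Ty.nat ⬝ r ⬝ s, fun t => by simp [val_ap₂, hr, hs]⟩

theorem DefP.congr (hP : 𝔐.DefP P) (h : ∀ n, P n ↔ Q n) : 𝔐.DefP Q := by
  obtain ⟨φ, hφ⟩ := hP
  exact ⟨φ, fun t => (hφ t).trans (h _)⟩

theorem DefP.eq (hF : 𝔐.DefF F) (hG : 𝔐.DefF G) : 𝔐.DefP fun n => F n = G n := by
  obtain ⟨r, hr⟩ := hF
  obtain ⟨s, hs⟩ := hG
  exact ⟨r ≐ s, fun t => by simp [Fm.subst, eq_mem_iff, hr, hs]⟩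

theorem DefP.and (hP : 𝔐.DefP P) (hQ : 𝔐.DefP Q) : 𝔐.DefP fun n => P n ∧ Q n := by
  obtain ⟨φ, hφ⟩ := hP
  obtain ⟨ψ, hψ⟩ := hQ
  exact ⟨φ ⊓ᶠ ψ, fun t => by simp [Fm.subst, 𝔐.and_iff, hφ, hψ]⟩

theorem DefP.or (hP : 𝔐.DefP P) (hQ : 𝔐.DefP Q) : 𝔐.DefP fun n => P n ∨ Q n := by
  obtain ⟨φ, hφ⟩ := hP
  obtain ⟨ψ, hψ⟩ := hQ
  exact ⟨.or φ ψ, fun t => by simp [Fm.subst, 𝔐.or_iff, hφ, hψ]⟩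

theorem neg_mem_iff (φ : Fm) : φ.neg ∈ 𝔐.th ↔ φ ∉ 𝔐.th := by
  simp [Fm.neg, 𝔐.imp_iff, 𝔐.bot_not_mem]

theorem DefP.not (hP : 𝔐.DefP P) : 𝔐.DefP fun n => ¬ P n := by
  obtain ⟨φ, hφ⟩ := hP
  exact ⟨φ.neg, fun t => by simp [neg_mem_iff, hφ]⟩

end

/-! Arithmetical operations. -/

instance : Zero 𝔐.Num := ⟨𝔐.val O⟩
instance : One 𝔐.Num := ⟨𝔐.val (Sc O)⟩
instance : Add 𝔐.Num := ⟨𝔐.ap₂ plusT⟩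
instance : Mul 𝔐.Num := ⟨𝔐.ap₂ timesT⟩
instance : _root_.Sub 𝔐.Num := ⟨𝔐.ap₂ monusT⟩

def succ : 𝔐.Num → 𝔐.Num := 𝔐.ap (.cst .succ)
def pred : 𝔐.Num → 𝔐.Num := 𝔐.ap predT

@[simp] theorem val_O : 𝔐.val O = 0 := rfl
theorem val_Sc' (s : Tm Ty.nat) : 𝔐.val (Sc s) = 𝔐.succ (𝔐.val s) := rfl
@[simp] theorem val_plusN (s t : Tm Ty.nat) : 𝔐.val (plusN s t) = 𝔐.val s + 𝔐.val t := rfl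
@[simp] theorem val_timesN (s t : Tm Ty.nat) : 𝔐.val (timesN s t) = 𝔐.val s * 𝔐.val t := rfl
@[simp] theorem val_monusN (s t : Tm Ty.nat) : 𝔐.val (monusN s t) = 𝔐.val s - 𝔐.val t := rfl
@[simp] theorem val_predN (s : Tm Ty.nat) : 𝔐.val (predN s) = 𝔐.pred (𝔐.val s) := rfl

variable {𝔐} in
theorem DefP.ind' {P : 𝔐.Num → Prop} (hP : 𝔐.DefP P) (h0 : P 0)
    (hs : ∀ n, P n → P (𝔐.succ n)) (n : 𝔐.Num) : P n := by
  obtain ⟨φ, hφ⟩ := hP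
  have h := 𝔐.thm (.pa (.induction φ))
  rw [𝔐.imp_iff, 𝔐.imp_iff, 𝔐.all_iff, 𝔐.all_iff] at h
  obtain ⟨t, rfl⟩ := 𝔐.exists_val n
  refine (hφ t).1 (h ((hφ O).2 h0) (fun t => ?_) t)
  have : (φ.subst (Sub.cons (Sc (nv 0)) (Sub.shift Ty.nat))).subst (Sub.inst t) =
      φ.subst (Sub.inst (Sc t)) := by
    rw [Fm.subst_subst, Sub.comp_cons, Sub.inst, Sub.shift_comp_cons]
    simp [Sub.inst]
  rw [Fm.subst, this, 𝔐.imp_iff, hφ, hφ, val_Sc']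
  exact hs _

/-! Recursion equations. -/

theorem val_beta {ρ : Ty} (t : Tm Ty.nat) (σ : Sub) (s : Tm ρ) :
    𝔐.val ((Tm.lam ρ t).subst σ ⬝ s) = 𝔐.val (t.subst (Sub.cons s σ)) :=
  𝔐.val_ceq (.beta t σ s)

theorem val_beta₂ {ρ ρ' : Ty} (t : Tm Ty.nat) (σ : Sub) (s : Tm ρ) (s' : Tm ρ') :
    𝔐.val ((Tm.lam ρ (Tm.lam ρ' t)).subst σ ⬝ s ⬝ s') =
      𝔐.val (t.subst (Sub.cons s' (Sub.cons s σ))) :=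
  𝔐.val_ceq (.beta₂ t σ s s')

theorem val_beta₃ {ρ ρ' ρ'' : Ty} (t : Tm Ty.nat) (σ : Sub) (s : Tm ρ) (s' : Tm ρ')
    (s'' : Tm ρ'') :
    𝔐.val ((Tm.lam ρ (Tm.lam ρ' (Tm.lam ρ'' t))).subst σ ⬝ s ⬝ s' ⬝ s'') =
      𝔐.val (t.subst (Sub.cons s'' (Sub.cons s' (Sub.cons s σ)))) :=
  𝔐.val_ceq (.beta₃ t σ s s' s'')

theorem val_recN_zero (b : Tm Ty.nat) (s : Tm Op2) : 𝔐.val (recN O b s) = 𝔐.val b :=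
  𝔐.val_ceq (.recN_zero b s)

/-- The step is kept as a double abstraction under a substitution, which carries the parameters of
the outer abstractions; the recursive call then has the same form again. -/
theorem val_recN_succ (n b t : Tm Ty.nat) (σ : Sub) :
    𝔐.val (recN (Sc n) b ((lamN (lamN t)).subst σ)) =
      𝔐.val (t.subst (Sub.cons n (Sub.cons (recN n b ((lamN (lamN t)).subst σ)) σ))) :=
  (𝔐.val_ceq (.recN_succ _ _ _)).trans (𝔐.val_beta₂ _ _ _ _)

theorem val_lam {ρ : Ty} (t : Tm Ty.nat) (s : Tm ρ) :
    𝔐.val (Tm.lam ρ t ⬝ s) = 𝔐.val (t.subst (Sub.cons s Tm.var)) := by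
  simpa using 𝔐.val_beta t Tm.var s

theorem val_lam₂ {ρ ρ' : Ty} (t : Tm Ty.nat) (s : Tm ρ) (s' : Tm ρ') :
    𝔐.val (Tm.lam ρ (Tm.lam ρ' t) ⬝ s ⬝ s') =
      𝔐.val (t.subst (Sub.cons s' (Sub.cons s Tm.var))) := by
  simpa using 𝔐.val_beta₂ t Tm.var s s'

theorem val_lam₃ {ρ ρ' ρ'' : Ty} (t : Tm Ty.nat) (s : Tm ρ) (s' : Tm ρ') (s'' : Tm ρ'') :
    𝔐.val (Tm.lam ρ (Tm.lam ρ' (Tm.lam ρ'' t)) ⬝ s ⬝ s' ⬝ s'') =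
      𝔐.val (t.subst (Sub.cons s'' (Sub.cons s' (Sub.cons s Tm.var)))) := by
  simpa using 𝔐.val_beta₃ t Tm.var s s' s''

theorem val_plus_rec (a b : Tm Ty.nat) : 𝔐.val a + 𝔐.val b =
    𝔐.val (recN b a ((lamN (lamN (Sc (nv 1)))).subst Tm.var)) :=
  𝔐.val_lam₂ _ _ _

/-- The recursion argument `b` does not occur in the step, so `O` may take its place in the
substitution; the step is then literally the same term for `b` and for its successor. -/
theorem val_times_rec (a b : Tm Ty.nat) : 𝔐.val a * 𝔐.val b =
    𝔐.val (recN b O ((lamN (lamN (plusN (nv 1) (nv 3)))).subst (Sub.cons O (Sub.cons a Tm.var)))) :=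
  𝔐.val_lam₂ _ _ _

theorem val_pred_rec (a : Tm Ty.nat) : 𝔐.pred (𝔐.val a) =
    𝔐.val (recN a O ((lamN (lamN (nv 0))).subst Tm.var)) :=
  𝔐.val_lam _ _

theorem val_monus_rec (a b : Tm Ty.nat) : 𝔐.val a - 𝔐.val b =
    𝔐.val (recN b a ((lamN (lamN (predN (nv 1)))).subst Tm.var)) :=
  𝔐.val_lam₂ _ _ _

theorem val_condN' (c a b : Tm Ty.nat) : 𝔐.val (condN c a b) =
    𝔐.val (recN c a ((lamN (lamN (nv 2))).subst (Sub.cons b Tm.var))) :=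
  𝔐.val_lam₃ _ _ _ _

theorem add_zero' (a : 𝔐.Num) : a + 0 = a := by
  obtain ⟨a, rfl⟩ := 𝔐.exists_val a
  exact (𝔐.val_plus_rec a O).trans (𝔐.val_recN_zero _ _)

theorem add_succ (a b : 𝔐.Num) : a + 𝔐.succ b = 𝔐.succ (a + b) := by
  obtain ⟨a, rfl⟩ := 𝔐.exists_val a
  obtain ⟨b, rfl⟩ := 𝔐.exists_val b
  rw [val_plus_rec]
  exact (𝔐.val_plus_rec a (Sc b)).trans (𝔐.val_recN_succ _ _ _ _)

theorem mul_zero' (a : 𝔐.Num) : a * 0 = 0 := by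
  obtain ⟨a, rfl⟩ := 𝔐.exists_val a
  exact (𝔐.val_times_rec a O).trans (𝔐.val_recN_zero _ _)

theorem mul_succ (a b : 𝔐.Num) : a * 𝔐.succ b = a * b + a := by
  obtain ⟨a, rfl⟩ := 𝔐.exists_val a
  obtain ⟨b, rfl⟩ := 𝔐.exists_val b
  rw [val_times_rec]
  exact (𝔐.val_times_rec a (Sc b)).trans (𝔐.val_recN_succ _ _ _ _)

theorem pred_zero : 𝔐.pred 0 = 0 := (𝔐.val_pred_rec O).trans (𝔐.val_recN_zero _ _)

theorem pred_succ (a : 𝔐.Num) : 𝔐.pred (𝔐.succ a) = a := by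
  obtain ⟨a, rfl⟩ := 𝔐.exists_val a
  exact (𝔐.val_pred_rec (Sc a)).trans (𝔐.val_recN_succ _ _ _ _)

theorem sub_zero' (a : 𝔐.Num) : a - 0 = a := by
  obtain ⟨a, rfl⟩ := 𝔐.exists_val a
  exact (𝔐.val_monus_rec a O).trans (𝔐.val_recN_zero _ _)

theorem sub_succ (a b : 𝔐.Num) : a - 𝔐.succ b = 𝔐.pred (a - b) := by
  obtain ⟨a, rfl⟩ := 𝔐.exists_val a
  obtain ⟨b, rfl⟩ := 𝔐.exists_val b
  rw [val_monus_rec]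
  exact (𝔐.val_monus_rec a (Sc b)).trans (𝔐.val_recN_succ _ _ _ _)

section
variable {𝔐} {F G : 𝔐.Num → 𝔐.Num}

theorem DefF.add (hF : 𝔐.DefF F) (hG : 𝔐.DefF G) : 𝔐.DefF fun n => F n + G n := hF.ap₂ plusT hG
theorem DefF.mul (hF : 𝔐.DefF F) (hG : 𝔐.DefF G) : 𝔐.DefF fun n => F n * G n := hF.ap₂ timesT hG
theorem DefF.sub (hF : 𝔐.DefF F) (hG : 𝔐.DefF G) : 𝔐.DefF fun n => F n - G n := hF.ap₂ monusT hG
theorem DefF.succ (hF : 𝔐.DefF F) : 𝔐.DefF fun n => 𝔐.succ (F n) := hF.ap _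
theorem DefF.pred (hF : 𝔐.DefF F) : 𝔐.DefF fun n => 𝔐.pred (F n) := hF.ap _

end

theorem eq_zero_or_eq_succ' (a : 𝔐.Num) : a = 0 ∨ a = 𝔐.succ (𝔐.pred a) :=
  DefP.ind' (P := fun a => a = 0 ∨ a = 𝔐.succ (𝔐.pred a))
    (.or (.eq .id (.const 0)) (.eq .id (.succ (.pred .id))))
    (.inl rfl) (fun a _ => .inr (by rw [pred_succ])) a

theorem succ_ne_zero (a : 𝔐.Num) : 𝔐.succ a ≠ 0 := by
  obtain ⟨a, rfl⟩ := 𝔐.exists_val a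
  have := 𝔐.thm (.pa (.succ_ne_zero a))
  rw [neg_mem_iff, eq_mem_iff] at this
  exact this

theorem val_condN (c a b : Tm Ty.nat) : 𝔐.val (condN c a b) =
    open Classical in if 𝔐.val c = 0 then 𝔐.val a else 𝔐.val b := by
  -- The recursion equations apply to `O` and `Sc c'` only, whereas `c` has such a form merely up to
  -- equality in the theory; congruence replaces it.
  have key : ∀ c' : Tm Ty.nat, 𝔐.val c = 𝔐.val c' →
      𝔐.val (condN c a b) = 𝔐.val (condN c' a b) := fun c' h => by
    simpa [Sub.inst] using
      𝔐.val_congr h (condN (nv 0) (a.wk Ty.nat) (b.wk Ty.nat))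
  split_ifs with h
  · rw [key O h, val_condN', val_recN_zero]
  · obtain ⟨c', hc'⟩ := 𝔐.exists_val (𝔐.pred (𝔐.val c))
    have h' := (𝔐.eq_zero_or_eq_succ' _).resolve_left h
    rw [key (Sc c') (by rw [val_Sc', hc', ← h']), val_condN', val_recN_succ]
    rfl

/-! ### The laws of a commutative semiring -/

theorem zero_add' (a : 𝔐.Num) : 0 + a = a :=
  DefP.ind' (P := fun a => 0 + a = a) (.eq (.add (.const 0) .id) .id) (𝔐.add_zero' 0)
    (fun a h => by rw [add_succ, h]) a

theorem succ_add (a b : 𝔐.Num) : 𝔐.succ a + b = 𝔐.succ (a + b) :=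
  DefP.ind' (P := fun b => 𝔐.succ a + b = 𝔐.succ (a + b))
    (.eq (.add (.const _) .id) (.succ (.add (.const _) .id))) (by rw [add_zero', add_zero'])
    (fun b h => by rw [add_succ, h, add_succ]) b

theorem add_comm' (a b : 𝔐.Num) : a + b = b + a :=
  DefP.ind' (P := fun b => a + b = b + a)
    (.eq (.add (.const _) .id) (.add .id (.const _))) (by rw [add_zero', zero_add'])
    (fun b h => by rw [add_succ, h, succ_add]) b

theorem add_assoc' (a b c : 𝔐.Num) : a + b + c = a + (b + c) :=
  DefP.ind' (P := fun c => a + b + c = a + (b + c))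
    (.eq (.add (.const _) .id) (.add (.const _) (.add (.const _) .id)))
    (by rw [add_zero', add_zero']) (fun c h => by rw [add_succ, h, add_succ, add_succ]) c

theorem zero_mul' (a : 𝔐.Num) : 0 * a = 0 :=
  DefP.ind' (P := fun a => 0 * a = 0) (.eq (.mul (.const 0) .id) (.const 0)) (𝔐.mul_zero' 0)
    (fun a h => by rw [mul_succ, h, add_zero']) a

theorem succ_mul (a b : 𝔐.Num) : 𝔐.succ a * b = a * b + b :=
  DefP.ind' (P := fun b => 𝔐.succ a * b = a * b + b)
    (.eq (.mul (.const _) .id) (.add (.mul (.const _) .id) .id))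
    (by rw [mul_zero', mul_zero', add_zero'])
    (fun b h => by
      rw [mul_succ, h, mul_succ, add_succ, add_succ, add_assoc', 𝔐.add_comm' b a, add_assoc']) b

theorem mul_comm' (a b : 𝔐.Num) : a * b = b * a :=
  DefP.ind' (P := fun b => a * b = b * a)
    (.eq (.mul (.const _) .id) (.mul .id (.const _))) (by rw [mul_zero', zero_mul'])
    (fun b h => by rw [mul_succ, h, succ_mul]) b

theorem mul_add' (a b c : 𝔐.Num) : a * (b + c) = a * b + a * c :=
  DefP.ind' (P := fun c => a * (b + c) = a * b + a * c)
    (.eq (.mul (.const _) (.add (.const _) .id)) (.add (.const _) (.mul (.const _) .id)))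
    (by rw [add_zero', mul_zero', add_zero'])
    (fun c h => by rw [add_succ, mul_succ, h, mul_succ, add_assoc']) c

theorem mul_assoc' (a b c : 𝔐.Num) : a * b * c = a * (b * c) :=
  DefP.ind' (P := fun c => a * b * c = a * (b * c))
    (.eq (.mul (.const _) .id) (.mul (.const _) (.mul (.const _) .id)))
    (by rw [mul_zero', mul_zero', mul_zero'])
    (fun c h => by rw [mul_succ, h, mul_succ, mul_add']) c

theorem succ_eq' (a : 𝔐.Num) : 𝔐.succ a = a + 1 := by
  change _ = a + 𝔐.succ 0
  rw [add_succ, add_zero']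

theorem mul_one' (a : 𝔐.Num) : a * 1 = a := by
  change a * 𝔐.succ 0 = a
  rw [mul_succ, mul_zero', zero_add']

instance : CommSemiring 𝔐.Num where
  add_assoc := 𝔐.add_assoc'
  zero_add := 𝔐.zero_add'
  add_zero := 𝔐.add_zero'
  add_comm := 𝔐.add_comm'
  nsmul := nsmulRec
  left_distrib := 𝔐.mul_add'
  right_distrib a b c := by rw [mul_comm', mul_add', 𝔐.mul_comm' c, 𝔐.mul_comm' c]
  zero_mul := 𝔐.zero_mul'
  mul_zero := 𝔐.mul_zero'
  mul_assoc := 𝔐.mul_assoc'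
  one_mul a := by rw [mul_comm', mul_one']
  mul_one := 𝔐.mul_one'
  mul_comm := 𝔐.mul_comm'

theorem succ_eq (a : 𝔐.Num) : 𝔐.succ a = a + 1 := 𝔐.succ_eq' a

@[simp] theorem val_Sc (s : Tm Ty.nat) : 𝔐.val (Sc s) = 𝔐.val s + 1 := by rw [val_Sc', succ_eq]

variable {𝔐} in
/-- Induction for definable predicates. -/
theorem DefP.ind {P : 𝔐.Num → Prop} (hP : 𝔐.DefP P) (h0 : P 0)
    (hs : ∀ n, P n → P (n + 1)) (n : 𝔐.Num) : P n :=
  hP.ind' h0 (fun n h => by rw [succ_eq]; exact hs n h) n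

theorem add_one_ne_zero (a : 𝔐.Num) : a + 1 ≠ 0 := by
  rw [← succ_eq]
  exact 𝔐.succ_ne_zero a

@[simp] theorem pred_add_one (a : 𝔐.Num) : 𝔐.pred (a + 1) = a := by rw [← succ_eq, pred_succ]

theorem eq_zero_or_eq_add_one (a : 𝔐.Num) : a = 0 ∨ ∃ b, a = b + 1 :=
  (𝔐.eq_zero_or_eq_succ' a).imp _root_.id fun h => ⟨𝔐.pred a, by rw [← succ_eq]; exact h⟩

theorem sub_zero_eq (a : 𝔐.Num) : a - 0 = a := 𝔐.sub_zero' a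

theorem sub_add_one (a b : 𝔐.Num) : a - (b + 1) = 𝔐.pred (a - b) := by rw [← succ_eq, sub_succ]

theorem zero_sub_eq (a : 𝔐.Num) : 0 - a = 0 :=
  DefP.ind (P := fun a => 0 - a = 0) (.eq (.sub (.const 0) .id) (.const 0)) (𝔐.sub_zero_eq 0)
    (fun a h => by rw [sub_add_one, h, pred_zero]) a

theorem add_one_sub_add_one (a b : 𝔐.Num) : a + 1 - (b + 1) = a - b :=
  DefP.ind (P := fun b => a + 1 - (b + 1) = a - b)
    (.eq (.sub (.const _) (.add .id (.const _))) (.sub (.const _) .id))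
    (by rw [sub_add_one, sub_zero_eq, sub_zero_eq, pred_add_one])
    (fun b h => by rw [sub_add_one, h, sub_add_one]) b

theorem add_sub_cancel_left' (b c : 𝔐.Num) : b + c - b = c :=
  DefP.ind (P := fun b => b + c - b = c)
    (.eq (.sub (.add .id (.const _)) .id) (.const _)) (by rw [zero_add, sub_zero_eq])
    (fun b h => by rw [add_right_comm, add_one_sub_add_one, h]) b

theorem sub_add_self (a c : 𝔐.Num) : a - (a + c) = 0 :=
  DefP.ind (P := fun a => a - (a + c) = 0)
    (.eq (.sub .id (.add .id (.const _))) (.const _)) (by rw [zero_sub_eq])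
    (fun b h => by rw [add_right_comm, add_one_sub_add_one, h]) a

/-- Truncated subtraction names the difference explicitly, so the totality of the order becomes
quantifier-free and accessible to induction. -/
theorem add_sub_total (a b : 𝔐.Num) : a + (b - a) = b ∨ b + (a - b) = a :=
  DefP.ind (P := fun a => a + (b - a) = b ∨ b + (a - b) = a)
    (.or (.eq (.add .id (.sub (.const _) .id)) (.const _))
      (.eq (.add (.const _) (.sub .id (.const _))) .id))
    (.inl (by rw [sub_zero_eq, zero_add]))
    (fun a h => by
      rcases h with h | h
      · rcases 𝔐.eq_zero_or_eq_add_one (b - a) with hc | ⟨c, hc⟩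
        · rw [hc, add_zero] at h
          subst h
          exact .inr (by rw [add_sub_cancel_left'])
        · rw [hc] at h
          refine .inl ?_
          rw [sub_add_one, hc, pred_add_one, ← h]
          ring
      · refine .inr ?_
        obtain ⟨c, hc⟩ : ∃ c, c = a - b := ⟨_, rfl⟩
        rw [← hc] at h
        rw [← h, add_assoc, add_sub_cancel_left']) a

theorem add_right_cancel' (a b c : 𝔐.Num) (h : a + c = b + c) : a = b := by
  have := 𝔐.add_sub_cancel_left' c a
  rw [add_comm, h, add_comm, add_sub_cancel_left'] at this
  exact this.symm

theorem eq_zero_of_add_eq_zero' (a b : 𝔐.Num) (h : a + b = 0) : b = 0 := by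
  rcases 𝔐.eq_zero_or_eq_add_one b with hc | ⟨c, rfl⟩
  · exact hc
  · exact (𝔐.add_one_ne_zero (a + c) (by rw [← h, add_assoc])).elim

/-! ### The order of the numbers -/

noncomputable instance : LinearOrder 𝔐.Num where
  le a b := ∃ c, b = a + c
  le_refl a := ⟨0, by rw [add_zero]⟩
  le_trans := by
    rintro a _ _ ⟨c, rfl⟩ ⟨d, rfl⟩
    exact ⟨c + d, by rw [add_assoc]⟩
  le_antisymm := by
    rintro a _ ⟨c, rfl⟩ ⟨d, h⟩
    have : c + d = 0 := 𝔐.add_right_cancel' _ _ a (by rw [zero_add, add_comm, ← add_assoc, ← h])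
    rw [𝔐.eq_zero_of_add_eq_zero' d c (by rw [add_comm, this]), add_zero]
  le_total a b := by
    rcases 𝔐.add_sub_total a b with h | h
    · exact .inl ⟨_, h.symm⟩
    · exact .inr ⟨_, h.symm⟩
  toDecidableLE := fun _ _ => Classical.propDecidable _

theorem le_def {a b : 𝔐.Num} : a ≤ b ↔ ∃ c, b = a + c := Iff.rfl

instance : IsOrderedCancelAddMonoid 𝔐.Num where
  add_le_add_left := by
    rintro a _ ⟨c, rfl⟩ d
    exact ⟨c, by ring⟩
  le_of_add_le_add_left := by
    rintro a b c ⟨d, h⟩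
    exact ⟨d, 𝔐.add_right_cancel' _ _ a (by rw [add_comm, h]; ring)⟩

theorem num_nonneg (a : 𝔐.Num) : 0 ≤ a := ⟨a, by rw [zero_add]⟩

theorem one_le_of_pos (a : 𝔐.Num) (h : 0 < a) : 1 ≤ a := by
  rcases 𝔐.eq_zero_or_eq_add_one a with rfl | ⟨c, rfl⟩
  · exact (lt_irrefl _ h).elim
  · exact ⟨c, add_comm _ _⟩

instance : Nontrivial 𝔐.Num := ⟨0 + 1, 0, 𝔐.add_one_ne_zero 0⟩

instance : ExistsAddOfLE 𝔐.Num := ⟨fun h => h⟩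

instance : ZeroLEOneClass 𝔐.Num := ⟨𝔐.num_nonneg 1⟩

theorem mul_pos' {a b : 𝔐.Num} (ha : 0 < a) (hb : 0 < b) : 0 < a * b := by
  obtain ⟨c, rfl⟩ := 𝔐.one_le_of_pos a ha
  obtain ⟨d, rfl⟩ := 𝔐.one_le_of_pos b hb
  refine lt_of_le_of_ne (𝔐.num_nonneg _) fun h => 𝔐.add_one_ne_zero (c + d + c * d) ?_
  rw [h]
  ring

theorem mul_lt_mul_of_pos' {a b c : 𝔐.Num} (hc : 0 < c) (h : a < b) : c * a < c * b := by
  obtain ⟨d, rfl⟩ := h.le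
  rw [mul_add]
  refine lt_add_of_pos_right _ (𝔐.mul_pos' hc ((𝔐.num_nonneg d).lt_of_ne fun hd => ?_))
  rw [← hd, add_zero] at h
  exact lt_irrefl _ h

instance : IsStrictOrderedRing 𝔐.Num where
  mul_lt_mul_of_pos_left _ hc _ _ h := 𝔐.mul_lt_mul_of_pos' hc h
  mul_lt_mul_of_pos_right c hc a b h := by
    rw [mul_comm a, mul_comm b]
    exact 𝔐.mul_lt_mul_of_pos' hc h

theorem sub_eq_zero_iff {a b : 𝔐.Num} : a - b = 0 ↔ a ≤ b := by
  constructor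
  · intro h
    rcases 𝔐.add_sub_total a b with h' | h'
    · exact ⟨_, h'.symm⟩
    · rw [h, add_zero] at h'
      exact h'.ge
  · rintro ⟨c, rfl⟩
    exact 𝔐.sub_add_self a c

theorem lt_add_one_iff {a b : 𝔐.Num} : a < b + 1 ↔ a ≤ b := by
  constructor
  · intro h
    obtain ⟨c, hc⟩ := le_def 𝔐 |>.1 h.le
    rcases 𝔐.eq_zero_or_eq_add_one c with rfl | ⟨d, rfl⟩
    · exact (h.ne (by rw [hc, add_zero])).elim
    · exact ⟨d, 𝔐.add_right_cancel' _ _ 1 (by rw [hc]; ring)⟩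
  · exact fun h => h.trans_lt (lt_add_one b)

theorem add_one_le_iff {a b : 𝔐.Num} : a + 1 ≤ b ↔ a < b := by
  rw [← not_lt, lt_add_one_iff, not_le]

section
variable {𝔐} {F G : 𝔐.Num → 𝔐.Num}

/-- The order is defined by an existential statement, but it amounts to the vanishing of a truncated
difference. -/
theorem DefP.le (hF : 𝔐.DefF F) (hG : 𝔐.DefF G) : 𝔐.DefP fun n => F n ≤ G n :=
  (DefP.eq (hF.sub hG) (.const 0)).congr fun _ => 𝔐.sub_eq_zero_iff

theorem DefP.lt (hF : 𝔐.DefF F) (hG : 𝔐.DefF G) : 𝔐.DefP fun n => F n < G n :=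
  (DefP.le hG hF).not.congr fun _ => not_le

end

end Model
end FinType
namespace FinType
namespace Model
variable {Ax : Fm → Prop} (𝔐 : Model Ax)

/-! ### Powers, pairs and parity -/

def pow : 𝔐.Num → 𝔐.Num := 𝔐.ap powT
def tri : 𝔐.Num → 𝔐.Num := 𝔐.ap triT
def diag : 𝔐.Num → 𝔐.Num := 𝔐.ap diagT
def fst : 𝔐.Num → 𝔐.Num := 𝔐.ap fstT
def snd : 𝔐.Num → 𝔐.Num := 𝔐.ap sndT
def par : 𝔐.Num → 𝔐.Num := 𝔐.ap parT
def half : 𝔐.Num → 𝔐.Num := 𝔐.ap halfT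
def pos : 𝔐.Num → 𝔐.Num := 𝔐.ap posT
def negp : 𝔐.Num → 𝔐.Num := 𝔐.ap negpT

@[simp] theorem val_powN (s : Tm Ty.nat) : 𝔐.val (powN s) = 𝔐.pow (𝔐.val s) := rfl
@[simp] theorem val_triN (s : Tm Ty.nat) : 𝔐.val (triN s) = 𝔐.tri (𝔐.val s) := rfl
@[simp] theorem val_diagN (s : Tm Ty.nat) : 𝔐.val (diagN s) = 𝔐.diag (𝔐.val s) := rfl
@[simp] theorem val_fstN (s : Tm Ty.nat) : 𝔐.val (fstN s) = 𝔐.fst (𝔐.val s) := rfl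
@[simp] theorem val_sndN (s : Tm Ty.nat) : 𝔐.val (sndN s) = 𝔐.snd (𝔐.val s) := rfl
@[simp] theorem val_parN (s : Tm Ty.nat) : 𝔐.val (parN s) = 𝔐.par (𝔐.val s) := rfl
@[simp] theorem val_halfN (s : Tm Ty.nat) : 𝔐.val (halfN s) = 𝔐.half (𝔐.val s) := rfl
@[simp] theorem val_posQ (s : Tm Ty.nat) : 𝔐.val (posQ s) = 𝔐.pos (𝔐.val s) := rfl
@[simp] theorem val_negpQ (s : Tm Ty.nat) : 𝔐.val (negpQ s) = 𝔐.negp (𝔐.val s) := rfl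

theorem val_condN_eq (c a b : Tm Ty.nat) : 𝔐.val (condN c a b) =
    if 𝔐.val c = 0 then 𝔐.val a else 𝔐.val b := by
  rw [val_condN]
  congr

attribute [local simp] Sub.cons_of_ne val_condN_eq

theorem val_pow_rec (a : Tm Ty.nat) : 𝔐.pow (𝔐.val a) =
    𝔐.val (recN a (Sc O) ((lamN (lamN (plusN (nv 1) (nv 1)))).subst Tm.var)) :=
  𝔐.val_lam _ _

theorem val_tri_rec (a : Tm Ty.nat) : 𝔐.tri (𝔐.val a) =
    𝔐.val (recN a O ((lamN (lamN (plusN (nv 1) (Sc (nv 0))))).subst Tm.var)) :=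
  𝔐.val_lam _ _

theorem val_diag_rec (a : Tm Ty.nat) : 𝔐.diag (𝔐.val a) =
    𝔐.val (recN a O ((lamN (lamN (condN (monusN (triN (Sc (nv 1))) (Sc (nv 0))) (Sc (nv 1))
      (nv 1)))).subst Tm.var)) :=
  𝔐.val_lam _ _

theorem val_par_rec (a : Tm Ty.nat) : 𝔐.par (𝔐.val a) =
    𝔐.val (recN a O ((lamN (lamN (monusN (Sc O) (nv 1)))).subst Tm.var)) :=
  𝔐.val_lam _ _

theorem val_half_rec (a : Tm Ty.nat) : 𝔐.half (𝔐.val a) =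
    𝔐.val (recN a O ((lamN (lamN (plusN (nv 1) (parN (nv 0))))).subst Tm.var)) :=
  𝔐.val_lam _ _

@[simp] theorem pow_zero' : 𝔐.pow 0 = 1 := by
  rw [← val_O, val_pow_rec, val_recN_zero]
  rfl

theorem pow_add_one (a : 𝔐.Num) : 𝔐.pow (a + 1) = 2 * 𝔐.pow a := by
  obtain ⟨a, rfl⟩ := 𝔐.exists_val a
  rw [← val_Sc, val_pow_rec, val_recN_succ, val_pow_rec, two_mul]
  rfl

@[simp] theorem tri_zero : 𝔐.tri 0 = 0 := by
  rw [← val_O, val_tri_rec, val_recN_zero]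

theorem tri_add_one (a : 𝔐.Num) : 𝔐.tri (a + 1) = 𝔐.tri a + (a + 1) := by
  obtain ⟨a, rfl⟩ := 𝔐.exists_val a
  rw [← val_Sc, val_tri_rec, val_recN_succ, val_tri_rec]
  rfl

@[simp] theorem diag_zero : 𝔐.diag 0 = 0 := by
  rw [← val_O, val_diag_rec, val_recN_zero]

theorem diag_add_one (a : 𝔐.Num) : 𝔐.diag (a + 1) =
    if 𝔐.tri (𝔐.diag a + 1) ≤ a + 1 then 𝔐.diag a + 1 else 𝔐.diag a := by
  obtain ⟨a, rfl⟩ := 𝔐.exists_val a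
  rw [← val_Sc, val_diag_rec, val_recN_succ, val_diag_rec]
  simp [sub_eq_zero_iff]

@[simp] theorem par_zero : 𝔐.par 0 = 0 := by
  rw [← val_O, val_par_rec, val_recN_zero]

theorem par_add_one (a : 𝔐.Num) : 𝔐.par (a + 1) = 1 - 𝔐.par a := by
  obtain ⟨a, rfl⟩ := 𝔐.exists_val a
  rw [← val_Sc, val_par_rec, val_recN_succ, val_par_rec]
  rfl

@[simp] theorem half_zero : 𝔐.half 0 = 0 := by
  rw [← val_O, val_half_rec, val_recN_zero]

theorem half_add_one (a : 𝔐.Num) : 𝔐.half (a + 1) = 𝔐.half a + 𝔐.par a := by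
  obtain ⟨a, rfl⟩ := 𝔐.exists_val a
  rw [← val_Sc, val_half_rec, val_recN_succ, val_half_rec]
  rfl

/-- Makes `2 ^ (-n)` smaller than any positive element of the completion, and is the growth
condition required of `p` there. -/
theorem lt_pow (a : 𝔐.Num) : a < 𝔐.pow a :=
  DefP.ind (P := fun a => a < 𝔐.pow a) (.lt .id (.ap _ .id)) (by simp)
    (fun a h => by
      rw [pow_add_one, two_mul]
      exact add_lt_add_of_lt_of_le h (𝔐.one_le_of_pos _ ((𝔐.num_nonneg a).trans_lt h))) a

theorem pow_pos' (a : 𝔐.Num) : 0 < 𝔐.pow a := (𝔐.num_nonneg a).trans_lt (𝔐.lt_pow a)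

theorem pow_add (a b : 𝔐.Num) : 𝔐.pow (a + b) = 𝔐.pow a * 𝔐.pow b :=
  DefP.ind (P := fun b => 𝔐.pow (a + b) = 𝔐.pow a * 𝔐.pow b)
    (.eq (.ap _ (.add (.const _) .id)) (.mul (.const _) (.ap _ .id))) (by simp)
    (fun b h => by
      rw [← add_assoc, pow_add_one, pow_add_one, h]
      ring) b

theorem tri_mono {a b : 𝔐.Num} (h : a ≤ b) : 𝔐.tri a ≤ 𝔐.tri b := by
  obtain ⟨c, rfl⟩ := h
  refine DefP.ind (P := fun c => 𝔐.tri a ≤ 𝔐.tri (a + c))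
    (.le (.const _) (.ap _ (.add (.const _) .id))) (by simp) (fun c h => ?_) c
  rw [← add_assoc, tri_add_one]
  exact h.trans ⟨_, rfl⟩

/-- Consecutive triangular numbers from `tri 1` on differ by more than `1`, so passing from `u` to
`u + 1` meets at most one new one and advancing by a single step suffices. -/
theorem tri_diag (u : 𝔐.Num) : 𝔐.tri (𝔐.diag u) ≤ u ∧ u < 𝔐.tri (𝔐.diag u + 1) :=
  DefP.ind (P := fun u => 𝔐.tri (𝔐.diag u) ≤ u ∧ u < 𝔐.tri (𝔐.diag u + 1))
    (.and (.le (.ap _ (.ap _ .id)) .id) (.lt .id (.ap _ (.add (.ap _ .id) (.const _)))))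
    (by
      have := 𝔐.tri_add_one 0
      rw [zero_add, tri_zero, zero_add] at this
      simp [this])
    (fun u h => by
      rw [diag_add_one]
      split_ifs with h'
      · refine ⟨h', ?_⟩
        rw [tri_add_one]
        have := 𝔐.add_one_le_iff.2 h.2
        exact this.trans_lt (lt_add_of_pos_right _ (𝔐.lt_add_one_iff.2 (𝔐.num_nonneg _)))
      · exact ⟨h.1.trans (le_add_of_nonneg_right (𝔐.num_nonneg 1)), not_le.1 h'⟩) u

theorem diag_eq {u w : 𝔐.Num} (h : 𝔐.tri w ≤ u) (h' : u < 𝔐.tri (w + 1)) : 𝔐.diag u = w := by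
  obtain ⟨h₁, h₂⟩ := 𝔐.tri_diag u
  refine le_antisymm ?_ ?_
  · rw [← lt_add_one_iff]
    by_contra! hc
    exact (𝔐.tri_mono hc |>.trans h₁).not_gt h'
  · rw [← lt_add_one_iff]
    by_contra! hc
    exact (𝔐.tri_mono hc |>.trans h).not_gt h₂

theorem val_pairN (s t : Tm Ty.nat) :
    𝔐.val (pairN s t) = 𝔐.tri (𝔐.val s + 𝔐.val t) + 𝔐.val s :=
  (𝔐.val_lam₂ _ _ _).trans (by simp)

theorem fst_eq (u : 𝔐.Num) : 𝔐.fst u = u - 𝔐.tri (𝔐.diag u) := by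
  obtain ⟨u, rfl⟩ := 𝔐.exists_val u
  exact (𝔐.val_lam _ _).trans (by simp)

theorem snd_eq (u : 𝔐.Num) : 𝔐.snd u = 𝔐.diag u - 𝔐.fst u := by
  obtain ⟨u, rfl⟩ := 𝔐.exists_val u
  exact (𝔐.val_lam _ _).trans (by simp)

theorem diag_pairN (s t : Tm Ty.nat) : 𝔐.diag (𝔐.val (pairN s t)) = 𝔐.val s + 𝔐.val t := by
  rw [val_pairN]
  apply diag_eq
  · exact ⟨_, rfl⟩
  · rw [tri_add_one, add_assoc (𝔐.val s)]
    refine add_lt_add_right (lt_add_of_pos_right _ ?_) _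
    exact 𝔐.lt_add_one_iff.2 (𝔐.num_nonneg _)

theorem fst_pairN (s t : Tm Ty.nat) : 𝔐.fst (𝔐.val (pairN s t)) = 𝔐.val s := by
  rw [fst_eq, diag_pairN, val_pairN, add_sub_cancel_left']

theorem snd_pairN (s t : Tm Ty.nat) : 𝔐.snd (𝔐.val (pairN s t)) = 𝔐.val t := by
  rw [snd_eq, diag_pairN, fst_pairN, add_sub_cancel_left']

theorem one_sub_one : (1 : 𝔐.Num) - 1 = 0 := 𝔐.sub_eq_zero_iff.2 le_rfl

theorem half_par (n : 𝔐.Num) :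
    n = 2 * 𝔐.half n + 𝔐.par n ∧ (𝔐.par n = 0 ∨ 𝔐.par n = 1) :=
  DefP.ind (P := fun n => n = 2 * 𝔐.half n + 𝔐.par n ∧ (𝔐.par n = 0 ∨ 𝔐.par n = 1))
    (.and (.eq .id (.add (.mul (.const _) (.ap _ .id)) (.ap _ .id)))
      (.or (.eq (.ap _ .id) (.const _)) (.eq (.ap _ .id) (.const _)))) (by simp)
    (fun n ⟨h, h'⟩ => by
      rw [half_add_one, par_add_one]
      rcases h' with h' | h'
      · rw [h', sub_zero_eq]
        refine ⟨?_, .inr rfl⟩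
        nth_rw 1 [h]
        rw [h']
        ring
      · rw [h', one_sub_one]
        refine ⟨?_, .inl rfl⟩
        nth_rw 1 [h]
        rw [h']
        ring) n

theorem par_half_two_mul (k : 𝔐.Num) : 𝔐.par (2 * k) = 0 ∧ 𝔐.half (2 * k) = k := by
  obtain ⟨h, h'⟩ := 𝔐.half_par (2 * k)
  generalize 𝔐.par (2 * k) = r at *
  generalize 𝔐.half (2 * k) = m at *
  rcases h' with rfl | rfl
  · rw [add_zero] at h
    exact ⟨rfl, (mul_left_cancel₀ two_ne_zero h).symm⟩
  · exfalso
    rcases le_or_gt k m with hk | hk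
    · exact absurd h (𝔐.lt_add_one_iff.2 (mul_le_mul_of_nonneg_left hk zero_le_two)).ne
    · obtain ⟨c, rfl⟩ := 𝔐.add_one_le_iff.2 hk
      have : 2 * m + 1 < 2 * (m + 1 + c) := by
        refine 𝔐.add_one_le_iff.1 ⟨2 * c, by ring⟩
      exact absurd h this.ne'

theorem par_half_two_mul_add_one (k : 𝔐.Num) :
    𝔐.par (2 * k + 1) = 1 ∧ 𝔐.half (2 * k + 1) = k := by
  obtain ⟨h, h'⟩ := 𝔐.par_half_two_mul k
  rw [par_add_one, half_add_one, h, h', add_zero, sub_zero_eq]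
  exact ⟨rfl, rfl⟩

theorem pos_eq (u : 𝔐.Num) :
    𝔐.pos u = if 𝔐.par (𝔐.fst u) = 0 then 𝔐.half (𝔐.fst u) else 0 := by
  obtain ⟨u, rfl⟩ := 𝔐.exists_val u
  exact (𝔐.val_lam _ _).trans (by simp; congr)

theorem negp_eq (u : 𝔐.Num) :
    𝔐.negp u = if 𝔐.par (𝔐.fst u) = 0 then 0 else 𝔐.half (𝔐.fst u) + 1 := by
  obtain ⟨u, rfl⟩ := 𝔐.exists_val u
  exact (𝔐.val_lam _ _).trans (by simp)

theorem pos_eq_zero_or_negp_eq_zero (u : 𝔐.Num) : 𝔐.pos u = 0 ∨ 𝔐.negp u = 0 := by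
  rw [pos_eq, negp_eq]
  split_ifs <;> simp

theorem mkQ_spec (a b d : Tm Ty.nat) :
    𝔐.pos (𝔐.val (mkQ a b d)) = 𝔐.val a - 𝔐.val b ∧
    𝔐.negp (𝔐.val (mkQ a b d)) = 𝔐.val b - 𝔐.val a ∧
    𝔐.snd (𝔐.val (mkQ a b d)) = 𝔐.pred (𝔐.val d) := by
  have h : 𝔐.val (mkQ a b d) = _ := 𝔐.val_lam₃ _ _ _ _
  simp only [Tm.subst_app, pairT_subst] at h
  rw [h, pos_eq, negp_eq, fst_pairN, snd_pairN]
  simp only [condT_subst, monusT_subst, timesT_subst, predT_subst, Tm.subst_var,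
    Sc_subst, O_subst, Sub.cons_zero, Sub.cons_succ, val_condN_eq, val_monusN, val_timesN, val_Sc,
    val_O, zero_add, val_predN, sub_eq_zero_iff, one_add_one_eq_two]
  by_cases hab : 𝔐.val b ≤ 𝔐.val a
  · simp only [if_pos hab]
    obtain ⟨h₁, h₂⟩ := 𝔐.par_half_two_mul (𝔐.val a - 𝔐.val b)
    rw [if_pos h₁, if_pos h₁, h₂, 𝔐.sub_eq_zero_iff.2 hab]
    exact ⟨rfl, rfl, trivial⟩
  · simp only [if_neg hab]
    rw [not_le] at hab
    -- A negative numerator `-(c + 1)` has the code `pred (2 (c + 1)) = 2 c + 1`, which is odd with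
    -- half `c`.
    obtain ⟨c, hc⟩ := (𝔐.eq_zero_or_eq_add_one (𝔐.val b - 𝔐.val a)).resolve_left
      fun h => hab.not_ge (𝔐.sub_eq_zero_iff.1 h)
    have hc' : 2 * (c + 1) = 2 * c + 1 + 1 := by ring
    obtain ⟨h₁, h₂⟩ := 𝔐.par_half_two_mul_add_one c
    rw [hc, hc', pred_add_one, h₁, h₂, if_neg one_ne_zero, if_neg one_ne_zero,
      𝔐.sub_eq_zero_iff.2 hab.le]
    exact ⟨rfl, rfl, trivial⟩

end Model
end FinType
namespace FinType

/-- An ordered field in which the fractions of the numbers of a model can be interpreted, and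
which contains the limits of the sequences that converge with rate `2 ^ (-n)`. -/
structure Completion {Ax : Fm → Prop} (𝔐 : Model Ax) where
  R : Type
  [field : Field R]
  [order : LinearOrder R]
  [ordered : IsStrictOrderedRing R]
  ι : 𝔐.Num →+* R
  mono : StrictMono ι
  arch : ∀ x, ∃ a, x < ι a
  complete : ∀ a : 𝔐.Num → R, (∀ n, ∃ b c d, d ≠ 0 ∧ a n = (ι b - ι c) / ι d) →
    (∀ m n, m ≤ n → |a m - a n| ≤ (ι (𝔐.pow m))⁻¹) → ∃ x, ∀ n, |x - a n| ≤ (ι (𝔐.pow n))⁻¹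

namespace Completion

attribute [instance] field order ordered

variable {Ax : Fm → Prop} {𝔐 : Model Ax}

theorem exists_completion (𝔐 : Model Ax) : Nonempty (Completion 𝔐) := by
  obtain ⟨R, _, _, _, ι, h₁, h₂, h₃⟩ := exists_complete_field 𝔐.Num 𝔐.num_nonneg 𝔐.one_le_of_pos
    (fun _ _ h => h) 𝔐.pow 𝔐.lt_pow
  exact ⟨⟨R, ι, h₁, h₂, h₃⟩⟩

variable (𝓡 : Completion 𝔐)

theorem ι_nonneg (a : 𝔐.Num) : 0 ≤ 𝓡.ι a := by simpa using 𝓡.mono.monotone (𝔐.num_nonneg a)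

theorem ι_pos {a : 𝔐.Num} (h : 0 < a) : 0 < 𝓡.ι a := by simpa using 𝓡.mono h

theorem ι_add_one_pos (a : 𝔐.Num) : 0 < 𝓡.ι a + 1 := by linarith [𝓡.ι_nonneg a]

theorem ι_sub (a b : 𝔐.Num) : 𝓡.ι (a - b) - 𝓡.ι (b - a) = 𝓡.ι a - 𝓡.ι b := by
  rcases le_total a b with h | h <;> obtain ⟨c, rfl⟩ := h <;>
    simp [𝔐.sub_add_self, 𝔐.add_sub_cancel_left']

/-- `2 ^ (-n)` -/
def e (n : 𝔐.Num) : 𝓡.R := (𝓡.ι (𝔐.pow n))⁻¹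

theorem e_pos (n : 𝔐.Num) : 0 < 𝓡.e n := inv_pos.2 (𝓡.ι_pos (𝔐.pow_pos' n))

@[simp] theorem e_zero : 𝓡.e 0 = 1 := by simp [e]

theorem e_add (m n : 𝔐.Num) : 𝓡.e (m + n) = 𝓡.e m * 𝓡.e n := by
  simp [e, 𝔐.pow_add, mul_comm]

@[simp] theorem e_one : 𝓡.e 1 = 1 / 2 := by
  have := 𝔐.pow_add_one 0
  rw [zero_add, 𝔐.pow_zero', mul_one] at this
  rw [e, this, ← one_add_one_eq_two, map_add, map_one, one_add_one_eq_two, one_div]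

theorem e_succ (n : 𝔐.Num) : 𝓡.e (n + 1) = 𝓡.e n / 2 := by rw [e_add, e_one]; ring

theorem exists_e_lt {x : 𝓡.R} (h : 0 < x) : ∃ n, 𝓡.e n < x := by
  obtain ⟨n, hn⟩ := 𝓡.arch x⁻¹
  refine ⟨n, inv_lt_of_inv_lt₀ h (hn.trans (𝓡.mono (𝔐.lt_pow n)))⟩

/-- The numbers of the model are cofinal in `R`, so `C * e n` falls below every positive element,
whatever the constant. -/
theorem eq_of_forall_e {x y C : 𝓡.R} (h : ∀ n, |x - y| ≤ C * 𝓡.e n) : x = y := by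
  by_contra hne
  have hpos : 0 < |x - y| := abs_pos.2 (sub_ne_zero.2 hne)
  have hC : 0 < C := by
    by_contra! hC
    have := h 0
    rw [e_zero] at this
    linarith
  obtain ⟨n, hn⟩ := 𝓡.exists_e_lt (div_pos hpos hC)
  rw [lt_div_iff₀ hC, mul_comm] at hn
  exact (h n).not_gt hn

/-! ### The rational coded by a number -/

def qv (n : 𝔐.Num) : 𝓡.R := (𝓡.ι (𝔐.pos n) - 𝓡.ι (𝔐.negp n)) / (𝓡.ι (𝔐.snd n) + 1)

/-- For `d = 0` the code has denominator `pred 0 + 1 = 1`, while division by `0` in `R` gives `0`;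
both agree if the numerator vanishes. The reciprocal of `0` needs this case. -/
theorem qv_mkQ (a b d : Tm Ty.nat) (h : 𝔐.val d = 0 → 𝔐.val a = 𝔐.val b) :
    𝓡.qv (𝔐.val (mkQ a b d)) = (𝓡.ι (𝔐.val a) - 𝓡.ι (𝔐.val b)) / 𝓡.ι (𝔐.val d) := by
  obtain ⟨h₁, h₂, h₃⟩ := 𝔐.mkQ_spec a b d
  rw [qv, h₁, h₂, h₃, ι_sub]
  rcases 𝔐.eq_zero_or_eq_add_one (𝔐.val d) with h' | ⟨c, hc⟩
  · simp [h h']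
  · simp [hc]

theorem qv_eq (t : Tm Ty.nat) : 𝓡.qv (𝔐.val t) =
    (𝓡.ι (𝔐.pos (𝔐.val t)) - 𝓡.ι (𝔐.negp (𝔐.val t))) / (𝓡.ι (𝔐.snd (𝔐.val t)) + 1) := rfl

attribute [local simp] Sub.cons_of_ne

@[simp] theorem qv_plusQ (s t : Tm Ty.nat) :
    𝓡.qv (𝔐.val (plusQ s t)) = 𝓡.qv (𝔐.val s) + 𝓡.qv (𝔐.val t) := by
  have h : 𝔐.val (plusQ s t) = _ := 𝔐.val_lam₂ _ _ _
  have hs := 𝓡.ι_add_one_pos (𝔐.snd (𝔐.val s))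
  have ht := 𝓡.ι_add_one_pos (𝔐.snd (𝔐.val t))
  simp only [Tm.subst_app, mkT_subst] at h
  rw [h, qv_mkQ, qv_eq, qv_eq]
  · simp
    field_simp
    ring
  · intro h'
    simp [Model.add_one_ne_zero] at h'

@[simp] theorem qv_timesQ (s t : Tm Ty.nat) :
    𝓡.qv (𝔐.val (timesQ s t)) = 𝓡.qv (𝔐.val s) * 𝓡.qv (𝔐.val t) := by
  have h : 𝔐.val (timesQ s t) = _ := 𝔐.val_lam₂ _ _ _
  have hs := 𝓡.ι_add_one_pos (𝔐.snd (𝔐.val s))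
  have ht := 𝓡.ι_add_one_pos (𝔐.snd (𝔐.val t))
  simp only [Tm.subst_app, mkT_subst] at h
  rw [h, qv_mkQ, qv_eq, qv_eq]
  · simp
    field_simp
    ring
  · intro h'
    simp [Model.add_one_ne_zero] at h'

@[simp] theorem qv_negQ (s : Tm Ty.nat) : 𝓡.qv (𝔐.val (negQ s)) = -𝓡.qv (𝔐.val s) := by
  have h : 𝔐.val (negQ s) = _ := 𝔐.val_lam _ _
  simp only [Tm.subst_app, mkT_subst] at h
  rw [h, qv_mkQ, qv_eq]
  · simp
    ring
  · intro h'
    simp [Model.add_one_ne_zero] at h'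

@[simp] theorem qv_absQ (s : Tm Ty.nat) : 𝓡.qv (𝔐.val (absQ s)) = |𝓡.qv (𝔐.val s)| := by
  have h : 𝔐.val (absQ s) = _ := 𝔐.val_lam _ _
  have hs := 𝓡.ι_add_one_pos (𝔐.snd (𝔐.val s))
  simp only [Tm.subst_app, mkT_subst] at h
  rw [h, qv_mkQ, qv_eq, abs_div, abs_of_pos hs]
  · have h₁ := 𝓡.ι_nonneg (𝔐.pos (𝔐.val s))
    have h₂ := 𝓡.ι_nonneg (𝔐.negp (𝔐.val s))
    rcases 𝔐.pos_eq_zero_or_negp_eq_zero (𝔐.val s) with h | h <;> simp [h, abs_of_nonneg h₁, abs_of_nonneg h₂]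
  · intro h'
    simp [Model.add_one_ne_zero] at h'

@[simp] theorem qv_invQ (s : Tm Ty.nat) : 𝓡.qv (𝔐.val (invQ s)) = (𝓡.qv (𝔐.val s))⁻¹ := by
  have h : 𝔐.val (invQ s) = _ := 𝔐.val_lam _ _
  simp only [Tm.subst_app, mkT_subst] at h
  rw [h, qv_mkQ, qv_eq]
  · rcases 𝔐.pos_eq_zero_or_negp_eq_zero (𝔐.val s) with h₁ | h₁ <;>
    rcases 𝔐.eq_zero_or_eq_add_one (𝔐.pos (𝔐.val s)) with h₂ | ⟨b, h₂⟩ <;>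
    rcases 𝔐.eq_zero_or_eq_add_one (𝔐.negp (𝔐.val s)) with h₃ | ⟨c, h₃⟩ <;>
    simp_all [Model.val_condN_eq, Model.add_one_ne_zero, neg_div, -neg_add_rev]
  · intro h'
    simp only [plusT_subst, posT_subst, negpT_subst, Tm.subst_var, Sub.cons_zero,
      Model.val_plusN, Model.val_posQ, Model.val_negpQ] at h'
    have h₁ := 𝔐.eq_zero_of_add_eq_zero' _ _ h'
    rw [h₁, add_zero] at h'
    simp [Model.val_condN_eq, h₁, h']

@[simp] theorem qv_tpowQ (s : Tm Ty.nat) : 𝓡.qv (𝔐.val (tpowQ s)) = 𝓡.e (𝔐.val s) := by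
  have h : 𝔐.val (tpowQ s) = _ := 𝔐.val_lam _ _
  simp only [Tm.subst_app, mkT_subst] at h
  rw [h, qv_mkQ]
  · simp [e]
  · intro h'
    simp [(𝔐.pow_pos' _).ne'] at h'

@[simp] theorem qv_natQ (s : Tm Ty.nat) : 𝓡.qv (𝔐.val (natQ s)) = 𝓡.ι (𝔐.val s) := by
  have h : 𝔐.val (natQ s) = _ := 𝔐.val_lam _ _
  simp only [Tm.subst_app, mkT_subst] at h
  rw [h, qv_mkQ]
  · simp
  · intro h'
    simp at h'

theorem leQ_mem_iff (s t : Tm Ty.nat) :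
    Fm.leQ s t ∈ 𝔐.th ↔ 𝓡.qv (𝔐.val s) ≤ 𝓡.qv (𝔐.val t) := by
  have h : 𝔐.val (lecQ s t) = _ := 𝔐.val_lam₂ _ _ _
  have hs := 𝓡.ι_add_one_pos (𝔐.snd (𝔐.val s))
  have ht := 𝓡.ι_add_one_pos (𝔐.snd (𝔐.val t))
  rw [Fm.leQ, Model.eq_mem_iff, h, qv_eq, qv_eq, div_le_div_iff₀ hs ht]
  simp only [Tm.subst_app, monusT_subst, Model.val_monusN, Model.val_O, Model.sub_eq_zero_iff]
  rw [← 𝓡.mono.le_iff_le]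
  simp
  constructor <;> intro h <;> linarith

theorem ltQ_mem_iff (s t : Tm Ty.nat) :
    Fm.ltQ s t ∈ 𝔐.th ↔ 𝓡.qv (𝔐.val s) < 𝓡.qv (𝔐.val t) := by
  have h : 𝔐.val (ltcQ s t) = _ := 𝔐.val_lam₂ _ _ _
  have hs := 𝓡.ι_add_one_pos (𝔐.snd (𝔐.val s))
  have ht := 𝓡.ι_add_one_pos (𝔐.snd (𝔐.val t))
  rw [Fm.ltQ, Model.eq_mem_iff, h, qv_eq, qv_eq, div_lt_div_iff₀ hs ht]
  simp only [Tm.subst_app, monusT_subst, Model.val_monusN, Model.val_O, Model.sub_eq_zero_iff,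
    Sc_subst, Model.val_Sc, Model.add_one_le_iff]
  rw [← 𝓡.mono.lt_iff_lt]
  simp
  constructor <;> intro h <;> linarith

end Completion
end FinType
namespace FinType
namespace Completion
variable {Ax : Fm → Prop} {𝔐 : Model Ax} (𝓡 : Completion 𝔐)

/-! ### Reals -/

/-- Terms without variables of type `ρ`. -/
def _root_.FinType.Tm.avoids (ρ : Ty) : {τ : Ty} → Tm τ → Bool
  | τ, .var _ _ => τ ≠ ρ
  | _, .cst _ => true
  | _, .app t s => t.avoids ρ && s.avoids ρ

theorem _root_.FinType.Tm.subst_cons_of_avoids {ρ τ : Ty} {t : Tm τ} (h : t.avoids ρ = true)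
    (s : Tm ρ) (σ : FinType.Sub) : t.subst (Sub.cons s σ) = t.subst σ := by
  induction t with
  | var τ n =>
    simp only [Tm.avoids, ne_eq, decide_not, Bool.not_eq_true', decide_eq_false_iff_not] at h
    exact Sub.cons_of_ne _ _ (Ne.symm h) n
  | cst c => rfl
  | app t u ht hu =>
    simp only [Tm.avoids, Bool.and_eq_true] at h
    simp [ht h.1, hu h.2]

/-- One step of the recursion in `hatT`. -/
def hatStep : Tm Op2 := lamN (lamN (condN
  (plusN (monusN (nv 0) (nv 1))
    (ltcQ (distQ (rv 0 ⬝ nv 0) (rv 0 ⬝ Sc (nv 0))) (tpowQ (Sc (nv 0)))))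
  (Sc (nv 0)) (nv 1)))

/-- The step refers to the sequence only. Dropping the number from its substitution makes the
recursions at `n` and `n + 1` share one step term. -/
theorem hatStep_subst_cons (t : Tm Ty.nat) (σ : FinType.Sub) :
    hatStep.subst (Sub.cons t σ) = hatStep.subst σ :=
  Tm.subst_cons_of_avoids (by decide +kernel) t σ

/-- The index at which `hat f` evaluates `f`, as a functional. -/
def idxT : Tm (Ty.one ⟶ₜ Ty.one) := lamR (lamN (recN (nv 0) O hatStep))

def idx (𝔐 : Model Ax) (f : Tm Ty.one) : 𝔐.Num → 𝔐.Num := 𝔐.ap (idxT ⬝ f)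

theorem val_idx_rec (f : Tm Ty.one) (t : Tm Ty.nat) : idx 𝔐 f (𝔐.val t) =
    𝔐.val (recN t O (hatStep.subst (Sub.cons f Tm.var))) := by
  rw [← hatStep_subst_cons t]
  exact 𝔐.val_lam₂ _ _ _

theorem hatT_eq : hatT = lamR (lamN (rv 0 ⬝ recN (nv 0) O hatStep)) := rfl

theorem val_hat (f : Tm Ty.one) (t : Tm Ty.nat) :
    𝔐.val (hat f ⬝ t) = 𝔐.ap f (idx 𝔐 f (𝔐.val t)) := by
  rw [val_idx_rec, ← hatStep_subst_cons t, hat, hatT_eq]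
  exact 𝔐.val_lam₂ _ _ _

@[simp] theorem idx_zero (f : Tm Ty.one) : idx 𝔐 f 0 = 0 := by
  rw [← Model.val_O, val_idx_rec, Model.val_recN_zero]

attribute [local simp] Sub.cons_of_ne

/-- As the index never exceeds `n`, the condition `n ≤ idx 𝔐 f n` says that no violation has
occurred before `n`. -/
theorem idx_add_one (f : Tm Ty.one) (n : 𝔐.Num) : idx 𝔐 f (n + 1) =
    if n ≤ idx 𝔐 f n ∧ |𝓡.qv (𝔐.ap f n) - 𝓡.qv (𝔐.ap f (n + 1))| < 𝓡.e (n + 1)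
    then n + 1 else idx 𝔐 f n := by
  obtain ⟨t, rfl⟩ := 𝔐.exists_val n
  have e₁ : 𝔐.ap f (𝔐.val t) = 𝔐.val (f ⬝ t) := rfl
  have e₂ : 𝔐.ap f (𝔐.val t + 1) = 𝔐.val (f ⬝ Sc t) := by rw [Model.val_ap, Model.val_Sc]
  rw [e₁, e₂, ← Model.val_Sc, val_idx_rec, hatStep, Model.val_recN_succ, ← hatStep]
  simp only [Tm.subst_app, condT_subst, Model.val_condN_eq, plusT_subst, monusT_subst,
    Tm.subst_var, Sub.cons_zero, Sub.cons_succ, Model.val_plusN, Model.val_monusN, ltcT_subst,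
    Sc_subst]
  have h : ∀ s t : Tm Ty.nat, 𝔐.val (ltcQ s t) = 0 ↔ 𝓡.qv (𝔐.val s) < 𝓡.qv (𝔐.val t) :=
    fun s t => by rw [← 𝓡.ltQ_mem_iff, Fm.ltQ, Model.eq_mem_iff, Model.val_O]
  have h' : ∀ a b : 𝔐.Num, a + b = 0 ↔ a = 0 ∧ b = 0 := fun a b =>
    ⟨fun h => ⟨𝔐.eq_zero_of_add_eq_zero' b a (by rw [add_comm, h]),
      𝔐.eq_zero_of_add_eq_zero' a b h⟩, by rintro ⟨rfl, rfl⟩; rw [add_zero]⟩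
  simp only [h', h, Model.sub_eq_zero_iff]
  simp [sub_eq_add_neg, val_idx_rec]

theorem idx_le (f : Tm Ty.one) (n : 𝔐.Num) : idx 𝔐 f n ≤ n :=
  Model.DefP.ind (P := fun n => idx 𝔐 f n ≤ n) (.le (.ap _ .id) .id) (by simp)
    (fun n h => by
      -- The index does not depend on a completion; any one will do to express the case distinction.
      obtain ⟨𝓡⟩ := exists_completion 𝔐
      rw [𝓡.idx_add_one]
      split_ifs
      · exact le_rfl
      · exact h.trans (le_add_of_nonneg_right (𝔐.num_nonneg 1))) n

/-- The sequence of rationals that represents the real coded by `f`. -/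
def seq (f : Tm Ty.one) (n : 𝔐.Num) : 𝓡.R := 𝓡.qv (𝔐.ap (hat f) n)

@[simp] theorem qv_hat (f : Tm Ty.one) (t : Tm Ty.nat) :
    𝓡.qv (𝔐.val (hat f ⬝ t)) = 𝓡.seq f (𝔐.val t) := rfl

theorem seq_eq (f : Tm Ty.one) (n : 𝔐.Num) : 𝓡.seq f n = 𝓡.qv (𝔐.ap f (idx 𝔐 f n)) := by
  obtain ⟨t, rfl⟩ := 𝔐.exists_val n
  rw [← qv_hat, val_hat]

theorem seq_zero (f : Tm Ty.one) : 𝓡.seq f 0 = 𝓡.qv (𝔐.ap f 0) := by rw [seq_eq, idx_zero]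

theorem seq_step (f : Tm Ty.one) (n : 𝔐.Num) :
    |𝓡.seq f n - 𝓡.seq f (n + 1)| < 𝓡.e (n + 1) := by
  rw [seq_eq, seq_eq, 𝓡.idx_add_one]
  split_ifs with h
  · rw [le_antisymm (idx_le f n) h.1]
    exact h.2
  · simpa using 𝓡.e_pos _

theorem seq_eq_of_regular {f : Tm Ty.one}
    (h : ∀ n, |𝓡.qv (𝔐.ap f n) - 𝓡.qv (𝔐.ap f (n + 1))| < 𝓡.e (n + 1)) (n : 𝔐.Num) :
    𝓡.seq f n = 𝓡.qv (𝔐.ap f n) := by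
  rw [seq_eq]
  congr
  exact Model.DefP.ind (P := fun n => idx 𝔐 f n = n) (.eq (.ap _ .id) .id) (by simp)
    (fun n hn => by rw [𝓡.idx_add_one, if_pos ⟨hn.ge, h n⟩]) n

/-- The bound is the exact sum of the permitted steps, which lets the induction on `k` close. As `k`
may be nonstandard, the induction has to take place inside the model. -/
theorem seq_far (f : Tm Ty.one) (m k : 𝔐.Num) :
    |𝓡.seq f m - 𝓡.seq f (m + k)| ≤ 𝓡.e m - 𝓡.e (m + k) := by
  obtain ⟨s, rfl⟩ := 𝔐.exists_val m
  refine Model.DefP.ind (P := fun k => |𝓡.seq f (𝔐.val s) - 𝓡.seq f (𝔐.val s + k)| ≤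
    𝓡.e (𝔐.val s) - 𝓡.e (𝔐.val s + k)) ?_ (by simp) (fun k h => ?_) k
  -- The estimate is definable because it compares rationals that are coded by terms.
  · refine ⟨Fm.leQ (distQ (hat (f.wk Ty.nat) ⬝ s.wk Ty.nat)
      (hat (f.wk Ty.nat) ⬝ plusN (s.wk Ty.nat) (nv 0)))
      (plusQ (tpowQ (s.wk Ty.nat)) (negQ (tpowQ (plusN (s.wk Ty.nat) (nv 0))))), fun t => ?_⟩
    rw [Fm.leQ_subst, 𝓡.leQ_mem_iff]
    simp [Sub.inst, sub_eq_add_neg]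
  · have h' := 𝓡.seq_step f (𝔐.val s + k)
    rw [← add_assoc]
    have h₂ := 𝓡.e_succ (𝔐.val s + k)
    rw [abs_lt] at h'
    rw [abs_le] at h ⊢
    constructor <;> linarith

theorem exists_real (f : Tm Ty.one) : ∃ x, ∀ n, |x - 𝓡.seq f n| ≤ 𝓡.e n := by
  refine 𝓡.complete (𝓡.seq f) (fun n => ⟨𝔐.pos (𝔐.ap (hat f) n), 𝔐.negp (𝔐.ap (hat f) n), 𝔐.snd (𝔐.ap (hat f) n) + 1,
    𝔐.add_one_ne_zero _, by rw [seq, qv, map_add, map_one]⟩) fun m n h => ?_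
  obtain ⟨k, rfl⟩ := h
  have := 𝓡.seq_far f m k
  have h' := 𝓡.e_pos (m + k)
  change _ ≤ 𝓡.e m
  linarith

/-- The real represented by `f`. -/
noncomputable def real (f : Tm Ty.one) : 𝓡.R := (𝓡.exists_real f).choose

/-- The limit gives only `≤`; going through the index `n + 1` and adding one strict step makes the
bound strict, as the strict test in `=_ℝ` requires. -/
theorem real_sub_seq (f : Tm Ty.one) (n : 𝔐.Num) : |𝓡.real f - 𝓡.seq f n| < 𝓡.e n := by
  have h₁ := (𝓡.exists_real f).choose_spec (n + 1)
  change |𝓡.real f - _| ≤ _ at h₁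
  have h₂ := 𝓡.seq_step f n
  rw [e_succ] at *
  rw [abs_lt] at *
  rw [abs_le] at h₁
  constructor <;> linarith

theorem real_eq_of_le {f : Tm Ty.one} {x C : 𝓡.R} (h : ∀ n, |x - 𝓡.seq f n| ≤ C * 𝓡.e n) :
    𝓡.real f = x := by
  refine 𝓡.eq_of_forall_e (C := 1 + C) fun n => ?_
  have h₁ := 𝓡.real_sub_seq f n
  have h₂ := h n
  rw [abs_lt] at h₁
  rw [abs_le] at *
  constructor <;> linarith

/-- The real represented by a sequence that satisfies the condition on its rate. -/
theorem real_eq_of_regular {f : Tm Ty.one} (a : 𝔐.Num → 𝓡.R) {x C : 𝓡.R}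
    (ha : ∀ t, 𝓡.qv (𝔐.val (f ⬝ t)) = a (𝔐.val t))
    (h : ∀ n, |a n - a (n + 1)| < 𝓡.e (n + 1)) (hx : ∀ n, |x - a n| ≤ C * 𝓡.e n) :
    𝓡.real f = x := by
  have ha' : ∀ n, 𝓡.qv (𝔐.ap f n) = a n := Model.forall_num.2 ha
  refine 𝓡.real_eq_of_le (C := C) fun n => ?_
  rw [𝓡.seq_eq_of_regular (fun n => by rw [ha', ha']; exact h n), ha']
  exact hx n

/-- The entries at `n + 1` err by less than `2 ^ (-n) / 2` each, so equal reals pass the test at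
every `n`. Conversely, passing it bounds the distance of the reals by `2 * 2 ^ (-n)`. -/
theorem eqR_mem_iff (f g : Tm Ty.one) : Fm.eqR f g ∈ 𝔐.th ↔ 𝓡.real f = 𝓡.real g := by
  have : Fm.eqR f g ∈ 𝔐.th ↔ ∀ n, |𝓡.seq f (n + 1) - 𝓡.seq g (n + 1)| < 𝓡.e n := by
    rw [Model.forall_num, Fm.eqR, 𝔐.all_iff]
    refine forall_congr' fun t => ?_
    rw [Fm.ltQ_subst, 𝓡.ltQ_mem_iff]
    simp [Sub.inst, sub_eq_add_neg]
  rw [this]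
  have key := fun n => (abs_lt.1 (𝓡.real_sub_seq f (n + 1)))
  have key' := fun n => (abs_lt.1 (𝓡.real_sub_seq g (n + 1)))
  constructor
  · intro h
    refine 𝓡.eq_of_forall_e (C := 2) fun n => ?_
    have h₁ := abs_lt.1 (h n)
    have h₂ := key n
    have h₃ := key' n
    rw [e_succ] at h₂ h₃
    rw [abs_le]
    constructor <;> linarith
  · intro h n
    have h₂ := key n
    have h₃ := key' n
    rw [e_succ] at h₂ h₃
    rw [abs_lt]
    constructor <;> linarith

theorem ltR_mem_iff (f g : Tm Ty.one) : Fm.ltR f g ∈ 𝔐.th ↔ 𝓡.real f < 𝓡.real g := by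
  have : Fm.ltR f g ∈ 𝔐.th ↔ ∃ n, 𝓡.e n ≤ 𝓡.seq g (n + 1) - 𝓡.seq f (n + 1) := by
    rw [Fm.ltR, 𝔐.ex_iff]
    have : ∀ t, _ ↔ 𝓡.e (𝔐.val t) ≤ 𝓡.seq g (𝔐.val t + 1) - 𝓡.seq f (𝔐.val t + 1) :=
      fun t => (𝓡.leQ_mem_iff (tpowQ t)
        (plusQ (hat g ⬝ Sc t) (negQ (hat f ⬝ Sc t)))).trans (by simp [sub_eq_add_neg])
    constructor
    · rintro ⟨t, ht⟩
      refine ⟨𝔐.val t, (this t).1 ?_⟩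
      simpa [Sub.inst] using ht
    · rintro ⟨n, hn⟩
      obtain ⟨t, rfl⟩ := 𝔐.exists_val n
      refine ⟨t, ?_⟩
      simpa [Sub.inst] using (this t).2 hn
  rw [this]
  have key := fun n => (abs_lt.1 (𝓡.real_sub_seq f (n + 1)))
  have key' := fun n => (abs_lt.1 (𝓡.real_sub_seq g (n + 1)))
  constructor
  · rintro ⟨n, h⟩
    have h₂ := key n
    have h₃ := key' n
    rw [e_succ] at h₂ h₃
    linarith
  · intro h
    -- Half of the gap is left after the two approximation errors, of total less than `e n`, are
    -- subtracted.
    obtain ⟨n, hn⟩ := 𝓡.exists_e_lt (half_pos (sub_pos.2 h))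
    refine ⟨n, ?_⟩
    have h₂ := key n
    have h₃ := key' n
    rw [e_succ] at h₂ h₃
    linarith

theorem leR_mem_iff (f g : Tm Ty.one) : Fm.leR f g ∈ 𝔐.th ↔ 𝓡.real f ≤ 𝓡.real g := by
  rw [Fm.leR, Model.neg_mem_iff, ltR_mem_iff 𝓡, not_lt]

/-! Operations on reals. -/

@[simp] theorem real_ratR (q : Tm Ty.nat) : 𝓡.real (ratR q) = 𝓡.qv (𝔐.val q) :=
  𝓡.real_eq_of_regular (fun _ => 𝓡.qv (𝔐.val q)) (C := 0)
    (fun t => by rw [𝔐.val_ceq (.const q t)]) (fun n => by simpa using 𝓡.e_pos _)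
    (fun n => by simp)

@[simp] theorem real_zeroR : 𝓡.real zeroR = 0 := by simp [zeroR]

@[simp] theorem real_oneR : 𝓡.real oneR = 1 := by simp [oneR]

@[simp] theorem real_plusR (f g : Tm Ty.one) :
    𝓡.real (plusR f g) = 𝓡.real f + 𝓡.real g := by
  refine 𝓡.real_eq_of_regular (fun n => 𝓡.seq f (n + 1) + 𝓡.seq g (n + 1)) (C := 1)
    (fun t => ?_) (fun n => ?_) (fun n => ?_)
  · rw [show 𝔐.val (plusR f g ⬝ t) = _ from 𝔐.val_lam₃ _ _ _ _]
    simp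
  · have h₁ := 𝓡.seq_step f (n + 1)
    have h₂ := 𝓡.seq_step g (n + 1)
    rw [e_succ] at h₁ h₂
    rw [abs_lt] at *
    constructor <;> linarith
  · have h₁ := 𝓡.real_sub_seq f (n + 1)
    have h₂ := 𝓡.real_sub_seq g (n + 1)
    rw [e_succ] at h₁ h₂
    rw [abs_lt] at h₁ h₂
    rw [abs_le]
    constructor <;> linarith

@[simp] theorem real_negR (f : Tm Ty.one) : 𝓡.real (negR f) = -𝓡.real f := by
  refine 𝓡.real_eq_of_regular (fun n => -𝓡.seq f n) (C := 1)
    (fun t => ?_) (fun n => ?_) (fun n => ?_)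
  · rw [show 𝔐.val (negR f ⬝ t) = _ from 𝔐.val_lam₂ _ _ _]
    simp
  · have h₁ := 𝓡.seq_step f n
    rw [abs_lt] at *
    constructor <;> linarith
  · have h₁ := 𝓡.real_sub_seq f n
    rw [abs_lt] at h₁
    rw [abs_le]
    constructor <;> linarith

@[simp] theorem real_absR (f : Tm Ty.one) : 𝓡.real (absR f) = |𝓡.real f| := by
  refine 𝓡.real_eq_of_regular (fun n => |𝓡.seq f n|) (C := 1)
    (fun t => ?_) (fun n => ?_) (fun n => ?_)
  · rw [show 𝔐.val (absR f ⬝ t) = _ from 𝔐.val_lam₂ _ _ _]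
    simp
  · exact (abs_abs_sub_abs_le _ _).trans_lt (𝓡.seq_step f n)
  · rw [one_mul]
    exact (abs_abs_sub_abs_le _ _).trans (𝓡.real_sub_seq f n).le

theorem abs_qv_lt (t : Tm Ty.nat) : |𝓡.qv (𝔐.val t)| + 1 ≤ 𝓡.ι (𝔐.val (boundQ t)) := by
  have h₁ := 𝓡.ι_nonneg (𝔐.pos (𝔐.val t))
  have h₂ := 𝓡.ι_nonneg (𝔐.negp (𝔐.val t))
  have h₃ := 𝓡.ι_nonneg (𝔐.snd (𝔐.val t))
  have h₄ := 𝓡.ι_add_one_pos (𝔐.snd (𝔐.val t))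
  rw [qv_eq, abs_div, abs_of_pos h₄]
  simp only [Model.val_Sc, Model.val_plusN, Model.val_posQ, Model.val_negpQ, map_add, map_one]
  have : |𝓡.ι (𝔐.pos (𝔐.val t)) - 𝓡.ι (𝔐.negp (𝔐.val t))| ≤
      𝓡.ι (𝔐.pos (𝔐.val t)) + 𝓡.ι (𝔐.negp (𝔐.val t)) := by
    rw [abs_le]
    constructor <;> linarith
  have h₅ := (div_le_self (abs_nonneg _) (by linarith : (1 : 𝓡.R) ≤ 𝓡.ι (𝔐.snd (𝔐.val t)) + 1)).trans
    this
  linarith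

/-- The sequence stays within distance `1` of its first entry, and there `hat f` coincides with `f`.
-/
theorem abs_seq_lt (f : Tm Ty.one) (n : 𝔐.Num) :
    |𝓡.seq f n| ≤ 𝓡.ι (𝔐.val (boundQ (f ⬝ O))) := by
  have h₁ := 𝓡.abs_qv_lt (f ⬝ O)
  have h₂ := 𝓡.seq_far f 0 n
  have h₃ := 𝓡.e_pos n
  rw [zero_add, e_zero, seq_zero] at h₂
  rw [Model.val_ap, Model.val_O] at h₁
  have := abs_sub_abs_le_abs_sub (𝓡.seq f n) (𝓡.qv (𝔐.ap f 0))
  rw [abs_sub_comm] at this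
  linarith

theorem ι_mul_e_lt (n : 𝔐.Num) : 𝓡.ι n * 𝓡.e n < 1 := by
  rw [e, ← div_eq_mul_inv, div_lt_one (𝓡.ι_pos (𝔐.pow_pos' n))]
  exact 𝓡.mono (𝔐.lt_pow n)

theorem e_le_one (n : 𝔐.Num) : 𝓡.e n ≤ 1 := by
  have := 𝓡.mono.monotone (𝔐.one_le_of_pos _ (𝔐.pow_pos' n))
  rw [map_one] at this
  exact inv_le_one_of_one_le₀ this

-- With bounds `F`, `G` of the factors and the shift `N = F + G`, a step of the product is at most
-- `N * e (n + N + 1) = (N * e N) * e (n + 1)`, and `N < 2 ^ N` makes this smaller than `e (n + 1)`.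
@[simp] theorem real_timesR (f g : Tm Ty.one) :
    𝓡.real (timesR f g) = 𝓡.real f * 𝓡.real g := by
  obtain ⟨F, hF⟩ : ∃ F, F = 𝔐.val (boundQ (f ⬝ O)) := ⟨_, rfl⟩
  obtain ⟨G, hG⟩ : ∃ G, G = 𝔐.val (boundQ (g ⬝ O)) := ⟨_, rfl⟩
  have hf := 𝓡.abs_seq_lt f
  have hg := 𝓡.abs_seq_lt g
  rw [← hF] at hf
  rw [← hG] at hg
  refine 𝓡.real_eq_of_regular (fun n => 𝓡.seq f (n + (F + G)) * 𝓡.seq g (n + (F + G)))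
    (C := |𝓡.real f| + 𝓡.ι G) (fun t => ?_) (fun n => ?_) (fun n => ?_)
  · rw [show 𝔐.val (timesR f g ⬝ t) = _ from 𝔐.val_lam₃ _ _ _ _, hF, hG]
    simp
  · obtain ⟨N, hN⟩ : ∃ N, N = F + G := ⟨_, rfl⟩
    have h₁ := 𝓡.seq_step f (n + N)
    have h₂ := 𝓡.seq_step g (n + N)
    have e₁ : n + 1 + N = n + N + 1 := by ring
    have e₂ : 𝓡.e (n + N + 1) = 𝓡.e (n + 1) * 𝓡.e N := by rw [← e_add, e₁]
    have h₃ := hf (n + N)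
    have h₄ := hg (n + N + 1)
    rw [← hN, e₁]
    calc |𝓡.seq f (n + N) * 𝓡.seq g (n + N) - 𝓡.seq f (n + N + 1) * 𝓡.seq g (n + N + 1)|
        = |𝓡.seq f (n + N) * (𝓡.seq g (n + N) - 𝓡.seq g (n + N + 1)) +
            (𝓡.seq f (n + N) - 𝓡.seq f (n + N + 1)) * 𝓡.seq g (n + N + 1)| := by ring_nf
      _ ≤ |𝓡.seq f (n + N)| * |𝓡.seq g (n + N) - 𝓡.seq g (n + N + 1)| +
            |𝓡.seq f (n + N) - 𝓡.seq f (n + N + 1)| * |𝓡.seq g (n + N + 1)| := by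
          rw [← abs_mul, ← abs_mul]
          exact abs_add_le _ _
      _ ≤ 𝓡.ι F * 𝓡.e (n + N + 1) + 𝓡.e (n + N + 1) * 𝓡.ι G := by
          gcongr
          · exact 𝓡.ι_nonneg F
          · exact (𝓡.e_pos _).le
      _ = (𝓡.ι N * 𝓡.e N) * 𝓡.e (n + 1) := by
          rw [e₂, hN, map_add]
          ring
      _ < 𝓡.e (n + 1) := by
          have := mul_lt_mul_of_pos_right (𝓡.ι_mul_e_lt N) (𝓡.e_pos (n + 1))
          rwa [one_mul] at this
  · obtain ⟨N, hN⟩ : ∃ N, N = F + G := ⟨_, rfl⟩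
    have h₁ := (𝓡.real_sub_seq f (n + N)).le
    have h₂ := (𝓡.real_sub_seq g (n + N)).le
    have h₄ := hg (n + N)
    rw [← hN]
    calc |𝓡.real f * 𝓡.real g - 𝓡.seq f (n + N) * 𝓡.seq g (n + N)|
        = |𝓡.real f * (𝓡.real g - 𝓡.seq g (n + N)) +
            (𝓡.real f - 𝓡.seq f (n + N)) * 𝓡.seq g (n + N)| := by ring_nf
      _ ≤ |𝓡.real f| * |𝓡.real g - 𝓡.seq g (n + N)| +
            |𝓡.real f - 𝓡.seq f (n + N)| * |𝓡.seq g (n + N)| := by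
          rw [← abs_mul, ← abs_mul]
          exact abs_add_le _ _
      _ ≤ |𝓡.real f| * 𝓡.e (n + N) + 𝓡.e (n + N) * 𝓡.ι G := by
          gcongr
          exact (𝓡.e_pos _).le
      _ = (|𝓡.real f| + 𝓡.ι G) * (𝓡.e n * 𝓡.e N) := by
          rw [e_add]
          ring
      _ ≤ (|𝓡.real f| + 𝓡.ι G) * 𝓡.e n := by
          have := 𝓡.ι_nonneg G
          have := abs_nonneg (𝓡.real f)
          refine mul_le_mul_of_nonneg_left ?_ (by linarith)
          exact mul_le_of_le_one_right (𝓡.e_pos n).le (𝓡.e_le_one N)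

/-- Put `k = l + 1`. From `|f| > 2 * e k`, the entries from `2 * k` on have absolute value above `e
k`. There the reciprocal has Lipschitz constant `1 / (e k * e k)`, which the index shift by `2 * k`
compensates exactly. -/
theorem real_invR {f : Tm Ty.one} {l : Tm Ty.nat} (h : 𝓡.e (𝔐.val l) < |𝓡.real f|) :
    𝓡.real (invR f l) = (𝓡.real f)⁻¹ := by
  obtain ⟨k, hk⟩ : ∃ k, k = 𝔐.val l + 1 := ⟨_, rfl⟩
  have hk2 : 𝓡.e (𝔐.val l) = 2 * 𝓡.e k := by rw [hk, e_succ]; ring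
  have hkpos := 𝓡.e_pos k
  have hfar : ∀ n, 𝓡.e k < |𝓡.seq f (n + 2 * k)| := fun n => by
    have h₁ := 𝓡.real_sub_seq f (n + 2 * k)
    have h₂ := abs_sub_abs_le_abs_sub (𝓡.real f) (𝓡.seq f (n + 2 * k))
    rw [two_mul, e_add, e_add] at h₁
    have h₃ : 𝓡.e n * (𝓡.e k * 𝓡.e k) ≤ 𝓡.e k := by
      have a₁ := 𝓡.e_le_one n
      have a₂ := 𝓡.e_le_one k
      have a₃ := (𝓡.e_pos n)
      calc 𝓡.e n * (𝓡.e k * 𝓡.e k) ≤ 1 * (1 * 𝓡.e k) := by gcongr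
        _ = 𝓡.e k := by ring
    rw [← two_mul] at h₁
    linarith
  have he : ∀ n, 𝓡.e (n + 2 * k) = 𝓡.e n * (𝓡.e k * 𝓡.e k) := fun n => by
    rw [two_mul, e_add, e_add]
  have key : ∀ u v : 𝓡.R, 𝓡.e k < |u| → 𝓡.e k < |v| →
      |u⁻¹ - v⁻¹| ≤ |u - v| / (𝓡.e k * 𝓡.e k) := fun u v hu hv => by
    have hu0 : u ≠ 0 := abs_pos.1 (hkpos.trans hu)
    have hv0 : v ≠ 0 := abs_pos.1 (hkpos.trans hv)
    rw [inv_sub_inv hu0 hv0, abs_div, abs_mul, abs_sub_comm]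
    gcongr
  refine 𝓡.real_eq_of_regular (fun n => (𝓡.seq f (n + 2 * k))⁻¹) (C := 1)
    (fun t => ?_) (fun n => ?_) (fun n => ?_)
  · rw [show 𝔐.val (invR f l ⬝ t) = _ from 𝔐.val_lam₃ _ _ _ _, hk]
    simp [one_add_one_eq_two]
  · have e₁ : n + 1 + 2 * k = n + 2 * k + 1 := by ring
    refine (key _ _ (hfar n) (hfar (n + 1))).trans_lt ?_
    rw [div_lt_iff₀ (mul_pos hkpos hkpos), ← he, e₁]
    exact 𝓡.seq_step f _
  · refine (key _ _ (by linarith) (hfar n)).trans ?_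
    rw [div_le_iff₀ (mul_pos hkpos hkpos), one_mul, ← he]
    exact (𝓡.real_sub_seq f _).le

end Completion
end FinType
namespace FinType

/-! ### Normed spaces with accretive operators -/

/-- The axioms on the normed space and the operator. -/
def SpaceAxiom (φ : Fm) : Prop := NormedAxiom φ ∨ AccretiveAxiom φ

section
attribute [local simp] Sub.lift_of_ne Sub.shift_of_ne Fm.subst Fm.eqT Tm.wk

theorem NormedAxiom.subst {φ : Fm} (h : NormedAxiom φ) (σ : Sub) : φ.subst σ = φ := by
  cases h <;> simp

theorem AccretiveAxiom.subst {φ : Fm} (h : AccretiveAxiom φ) (σ : Sub) : φ.subst σ = φ := by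
  cases h <;> simp

end

theorem SpaceAxiom.subst (φ : Fm) (σ : Sub) (h : SpaceAxiom φ) : SpaceAxiom (φ.subst σ) :=
  h.imp (fun h => by rwa [h.subst]) fun h => by rwa [h.subst]

/-- Substitutions act as assignments: a quantifier extends the assignment by a term, so no iterated
lifts have to be simplified. -/
theorem Model.all_subst_mem_iff {Ax : Fm → Prop} (𝔐 : Model Ax) (ρ : Ty) (φ : Fm) (σ : Sub) :
    (Fm.all ρ φ).subst σ ∈ 𝔐.th ↔ ∀ t : Tm ρ, φ.subst (Sub.cons t σ) ∈ 𝔐.th := by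
  rw [Fm.subst, 𝔐.all_iff]
  simp only [Fm.subst_lift_inst]

theorem Model.imp_subst_mem_iff {Ax : Fm → Prop} (𝔐 : Model Ax) (φ ψ : Fm) (σ : Sub) :
    (φ ⇒ᶠ ψ).subst σ ∈ 𝔐.th ↔ (φ.subst σ ∈ 𝔐.th → ψ.subst σ ∈ 𝔐.th) := 𝔐.imp_iff _ _

theorem Model.and_subst_mem_iff {Ax : Fm → Prop} (𝔐 : Model Ax) (φ ψ : Fm) (σ : Sub) :
    (φ ⊓ᶠ ψ).subst σ ∈ 𝔐.th ↔ (φ.subst σ ∈ 𝔐.th ∧ ψ.subst σ ∈ 𝔐.th) := 𝔐.and_iff _ _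

theorem Model.subst_var_mem {Ax : Fm → Prop} (𝔐 : Model Ax) {φ : Fm} (h : Ax φ) :
    φ.subst Tm.var ∈ 𝔐.th := by
  rw [Fm.subst_id]
  exact 𝔐.thm (.ax h)

namespace Completion
variable {𝔐 : Model SpaceAxiom} (𝓡 : Completion 𝔐)

/-- The norm of a vector. -/
noncomputable def nm (x : Tm Ty.X) : 𝓡.R := 𝓡.real (vnorm x)

@[simp] theorem real_vnorm (x : Tm Ty.X) : 𝓡.real (vnorm x) = 𝓡.nm x := rfl

theorem eqX_mem_iff (x y : Tm Ty.X) : Fm.eqT Ty.X x y ∈ 𝔐.th ↔ 𝓡.nm (vminus x y) = 0 := by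
  rw [Fm.eqT, 𝓡.eqR_mem_iff, real_zeroR, real_vnorm]

attribute [local simp] Sub.cons_of_ne Model.imp_subst_mem_iff Model.and_subst_mem_iff

/-! ### The axioms of the space and the operator, read in the completion -/

theorem nm_plus_assoc (x y z : Tm Ty.X) :
    𝓡.nm (vminus (vplus x (vplus y z)) (vplus (vplus x y) z)) = 0 := by
  have h := 𝔐.subst_var_mem (.inl .plus_assoc)
  simp only [Model.all_subst_mem_iff] at h
  simpa [𝓡.eqX_mem_iff] using h x y z

theorem nm_plus_comm (x y : Tm Ty.X) :
    𝓡.nm (vminus (vplus x y) (vplus y x)) = 0 := by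
  have h := 𝔐.subst_var_mem (.inl .plus_comm)
  simp only [Model.all_subst_mem_iff] at h
  simpa [𝓡.eqX_mem_iff] using h x y

theorem nm_plus_zero (x : Tm Ty.X) :
    𝓡.nm (vminus (vplus x (.cst .zeroX)) x) = 0 := by
  have h := 𝔐.subst_var_mem (.inl .plus_zero)
  simp only [Model.all_subst_mem_iff] at h
  simpa [𝓡.eqX_mem_iff] using h x

theorem nm_plus_neg (x : Tm Ty.X) :
    𝓡.nm (vminus (vplus x (vneg x)) (.cst .zeroX)) = 0 := by
  have h := 𝔐.subst_var_mem (.inl .plus_neg)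
  simp only [Model.all_subst_mem_iff] at h
  simpa [𝓡.eqX_mem_iff] using h x

theorem nm_one_smul (x : Tm Ty.X) :
    𝓡.nm (vminus (vsmul oneR x) x) = 0 := by
  have h := 𝔐.subst_var_mem (.inl .one_smul)
  simp only [Model.all_subst_mem_iff] at h
  simpa [𝓡.eqX_mem_iff] using h x

theorem nm_mul_smul (a b : Tm Ty.one) (x : Tm Ty.X) :
    𝓡.nm (vminus (vsmul (timesR a b) x) (vsmul a (vsmul b x))) = 0 := by
  have h := 𝔐.subst_var_mem (.inl .mul_smul)
  simp only [Model.all_subst_mem_iff] at h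
  simpa [𝓡.eqX_mem_iff] using h a b x

theorem nm_smul_plus (a : Tm Ty.one) (x y : Tm Ty.X) :
    𝓡.nm (vminus (vsmul a (vplus x y)) (vplus (vsmul a x) (vsmul a y))) = 0 := by
  have h := 𝔐.subst_var_mem (.inl .smul_plus)
  simp only [Model.all_subst_mem_iff] at h
  simpa [𝓡.eqX_mem_iff] using h a x y

theorem nm_plus_smul (a b : Tm Ty.one) (x : Tm Ty.X) :
    𝓡.nm (vminus (vsmul (plusR a b) x) (vplus (vsmul a x) (vsmul b x))) = 0 := by
  have h := 𝔐.subst_var_mem (.inl .plus_smul)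
  simp only [Model.all_subst_mem_iff] at h
  simpa [𝓡.eqX_mem_iff] using h a b x

theorem nm_self (x : Tm Ty.X) :
    𝓡.nm (vminus x x) = 0 := by
  have h := 𝔐.subst_var_mem (.inl .norm_self)
  simp only [Model.all_subst_mem_iff] at h
  simpa [𝓡.eqR_mem_iff] using h x

theorem nm_symm (x y : Tm Ty.X) :
    𝓡.nm (vminus x y) = 𝓡.nm (vminus y x) := by
  have h := 𝔐.subst_var_mem (.inl .norm_symm)
  simp only [Model.all_subst_mem_iff] at h
  simpa [𝓡.eqR_mem_iff] using h x y

theorem nm_triangle (x y z : Tm Ty.X) :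
    𝓡.nm (vminus x z) ≤ 𝓡.nm (vminus x y) + 𝓡.nm (vminus y z) := by
  have h := 𝔐.subst_var_mem (.inl .norm_triangle)
  simp only [Model.all_subst_mem_iff] at h
  simpa [𝓡.leR_mem_iff] using h x y z

theorem nm_smul (a : Tm Ty.one) (x y : Tm Ty.X) :
    𝓡.nm (vminus (vsmul a x) (vsmul a y)) = |𝓡.real a| * 𝓡.nm (vminus x y) := by
  have h := 𝔐.subst_var_mem (.inl .norm_smul)
  simp only [Model.all_subst_mem_iff] at h
  simpa [𝓡.eqR_mem_iff] using h a x y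

theorem nm_smul' (a b : Tm Ty.one) (x : Tm Ty.X) :
    𝓡.nm (vminus (vsmul a x) (vsmul b x)) = |𝓡.real a - 𝓡.real b| * 𝓡.nm x := by
  have h := 𝔐.subst_var_mem (.inl .norm_smul')
  simp only [Model.all_subst_mem_iff] at h
  simpa [𝓡.eqR_mem_iff, ← sub_eq_add_neg] using h a b x

theorem nm_plus (x y u v : Tm Ty.X) :
    𝓡.nm (vminus (vplus x y) (vplus u v)) ≤ 𝓡.nm (vminus x u) + 𝓡.nm (vminus y v) := by
  have h := 𝔐.subst_var_mem (.inl .norm_plus)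
  simp only [Model.all_subst_mem_iff] at h
  simpa [𝓡.leR_mem_iff] using h x y u v

theorem nm_neg (x y : Tm Ty.X) :
    𝓡.nm (vminus (vneg x) (vneg y)) = 𝓡.nm (vminus x y) := by
  have h := 𝔐.subst_var_mem (.inl .norm_neg)
  simp only [Model.all_subst_mem_iff] at h
  simpa [𝓡.eqR_mem_iff] using h x y

theorem nm_dist (x y : Tm Ty.X) :
    |𝓡.nm x - 𝓡.nm y| ≤ 𝓡.nm (vminus x y) := by
  have h := 𝔐.subst_var_mem (.inl .norm_dist)
  simp only [Model.all_subst_mem_iff] at h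
  simpa [𝓡.leR_mem_iff, ← sub_eq_add_neg] using h x y

theorem nm_accretive {x y u v : Tm Ty.X} (a : Tm Ty.one) (hu : Fm.inA u x ∈ 𝔐.th)
    (hv : Fm.inA v y ∈ 𝔐.th) : 𝓡.nm (vminus x y) ≤
      𝓡.nm (vplus (vminus x y) (vsmul (absR a) (vminus u v))) := by
  have h := 𝔐.subst_var_mem (.inr .accretive)
  simp only [Model.all_subst_mem_iff] at h
  have h := h x y u v a
  simp [𝓡.leR_mem_iff] at h
  exact h hu hv

theorem inA_resolvent {g : Tm Ty.one} (x : Tm Ty.X) {l : Tm Ty.nat}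
    (hl : 𝓡.e (𝔐.val l) < 𝓡.real g) :
    Fm.inA (vsmul (invR g l) (vminus x (J g x))) (J g x) ∈ 𝔐.th := by
  have h := 𝔐.subst_var_mem (.inr .resolvent)
  simp only [Model.all_subst_mem_iff] at h
  have h := h g x l
  simp [𝓡.ltR_mem_iff] at h
  exact h hl

/-- Obtained from `‖x - x‖ = 0`, symmetry and the triangle inequality, as no axiom states it. -/
theorem nm_minus_nonneg (x y : Tm Ty.X) : 0 ≤ 𝓡.nm (vminus x y) := by
  have h := 𝓡.nm_triangle x y x
  rw [𝓡.nm_self, 𝓡.nm_symm y x] at h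
  linarith

/-! ### The vectors of the model and their norm -/

def vecSetoid : Setoid (Tm Ty.X) where
  r x y := 𝓡.nm (vminus x y) = 0
  iseqv := ⟨𝓡.nm_self, fun h => by rwa [𝓡.nm_symm], fun {x y z} h h' =>
    le_antisymm ((𝓡.nm_triangle x y z).trans (by rw [h, h', add_zero])) (𝓡.nm_minus_nonneg _ _)⟩

/-- The vectors of the model. -/
def Vec : Type := Quotient 𝓡.vecSetoid

def vec (x : Tm Ty.X) : 𝓡.Vec := Quotient.mk _ x

theorem vec_eq_iff {x y : Tm Ty.X} : 𝓡.vec x = 𝓡.vec y ↔ 𝓡.nm (vminus x y) = 0 :=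
  Quotient.eq (r := 𝓡.vecSetoid)

theorem eqX_mem_iff_vec {x y : Tm Ty.X} : Fm.eqT Ty.X x y ∈ 𝔐.th ↔ 𝓡.vec x = 𝓡.vec y := by
  rw [eqX_mem_iff, vec_eq_iff]

theorem exists_vec (v : 𝓡.Vec) : ∃ x, 𝓡.vec x = v := Quotient.mk_surjective v

instance : Zero 𝓡.Vec := ⟨𝓡.vec (.cst .zeroX)⟩

instance : Add 𝓡.Vec := ⟨Quotient.map₂ vplus fun _ _ h _ _ h' =>
  le_antisymm ((𝓡.nm_plus _ _ _ _).trans (by rw [h, h', add_zero])) (𝓡.nm_minus_nonneg _ _)⟩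

instance : Neg 𝓡.Vec := ⟨Quotient.map (fun x => vneg x) fun _ _ h => (𝓡.nm_neg _ _).trans h⟩

@[simp] theorem vec_vplus (x y : Tm Ty.X) : 𝓡.vec (vplus x y) = 𝓡.vec x + 𝓡.vec y := rfl

@[simp] theorem vec_vneg (x : Tm Ty.X) : 𝓡.vec (vneg x) = -𝓡.vec x := rfl

instance : AddCommGroup 𝓡.Vec where
  add_assoc u v w := by
    obtain ⟨x, rfl⟩ := 𝓡.exists_vec u
    obtain ⟨y, rfl⟩ := 𝓡.exists_vec v
    obtain ⟨z, rfl⟩ := 𝓡.exists_vec w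
    exact (𝓡.vec_eq_iff.2 (𝓡.nm_plus_assoc x y z)).symm
  add_comm u v := by
    obtain ⟨x, rfl⟩ := 𝓡.exists_vec u
    obtain ⟨y, rfl⟩ := 𝓡.exists_vec v
    exact 𝓡.vec_eq_iff.2 (𝓡.nm_plus_comm x y)
  zero_add u := by
    obtain ⟨x, rfl⟩ := 𝓡.exists_vec u
    exact (𝓡.vec_eq_iff.2 (𝓡.nm_plus_comm _ _)).trans (𝓡.vec_eq_iff.2 (𝓡.nm_plus_zero x))
  add_zero u := by
    obtain ⟨x, rfl⟩ := 𝓡.exists_vec u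
    exact 𝓡.vec_eq_iff.2 (𝓡.nm_plus_zero x)
  neg_add_cancel u := by
    obtain ⟨x, rfl⟩ := 𝓡.exists_vec u
    exact (𝓡.vec_eq_iff.2 (𝓡.nm_plus_comm _ _)).trans (𝓡.vec_eq_iff.2 (𝓡.nm_plus_neg x))
  nsmul := nsmulRec
  zsmul := zsmulRec

@[simp] theorem vec_vminus (x y : Tm Ty.X) : 𝓡.vec (vminus x y) = 𝓡.vec x - 𝓡.vec y := by
  rw [vec_vplus, vec_vneg, sub_eq_add_neg]

/-- Multiplication of vectors by the scalar `a`. -/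
def sm (a : Tm Ty.one) : 𝓡.Vec →+ 𝓡.Vec :=
  .mk' (Quotient.map (vsmul a) fun x y h => by
    change 𝓡.nm _ = 0
    rw [𝓡.nm_smul, show 𝓡.nm (vminus x y) = 0 from h, mul_zero]) fun u v => by
    obtain ⟨x, rfl⟩ := 𝓡.exists_vec u
    obtain ⟨y, rfl⟩ := 𝓡.exists_vec v
    exact 𝓡.vec_eq_iff.2 (𝓡.nm_smul_plus a x y)

@[simp] theorem vec_vsmul (a : Tm Ty.one) (x : Tm Ty.X) :
    𝓡.vec (vsmul a x) = 𝓡.sm a (𝓡.vec x) := rfl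

/-- Scalars remain terms, since elements of `R` are not assumed to be denoted by any. This allows
identities between scalars to be checked in `R`. -/
theorem sm_congr {a b : Tm Ty.one} (h : 𝓡.real a = 𝓡.real b) (v : 𝓡.Vec) :
    𝓡.sm a v = 𝓡.sm b v := by
  obtain ⟨x, rfl⟩ := 𝓡.exists_vec v
  exact 𝓡.vec_eq_iff.2 (by rw [𝓡.nm_smul', h, sub_self, abs_zero, zero_mul])

@[simp] theorem sm_oneR (v : 𝓡.Vec) : 𝓡.sm oneR v = v := by
  obtain ⟨x, rfl⟩ := 𝓡.exists_vec v
  exact 𝓡.vec_eq_iff.2 (𝓡.nm_one_smul x)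

theorem sm_timesR (a b : Tm Ty.one) (v : 𝓡.Vec) :
    𝓡.sm (timesR a b) v = 𝓡.sm a (𝓡.sm b v) := by
  obtain ⟨x, rfl⟩ := 𝓡.exists_vec v
  exact 𝓡.vec_eq_iff.2 (𝓡.nm_mul_smul a b x)

theorem sm_plusR (a b : Tm Ty.one) (v : 𝓡.Vec) :
    𝓡.sm (plusR a b) v = 𝓡.sm a v + 𝓡.sm b v := by
  obtain ⟨x, rfl⟩ := 𝓡.exists_vec v
  exact 𝓡.vec_eq_iff.2 (𝓡.nm_plus_smul a b x)

theorem sm_zeroR (v : 𝓡.Vec) : 𝓡.sm zeroR v = 0 := by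
  have h := 𝓡.sm_plusR zeroR zeroR v
  rwa [𝓡.sm_congr (b := zeroR) (by simp), left_eq_add] at h

theorem sm_negR (a : Tm Ty.one) (v : 𝓡.Vec) : 𝓡.sm (negR a) v = -𝓡.sm a v := by
  rw [eq_neg_iff_add_eq_zero, ← sm_plusR, ← 𝓡.sm_zeroR v]
  exact 𝓡.sm_congr (by simp) v

/-- The norm on the vectors of the model. -/
noncomputable def nrm : 𝓡.Vec → 𝓡.R :=
  Quotient.lift 𝓡.nm fun x y h => sub_eq_zero.1 <| abs_eq_zero.1 <|
    le_antisymm ((𝓡.nm_dist x y).trans_eq h) (abs_nonneg _)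

theorem nrm_vec (x : Tm Ty.X) : 𝓡.nm x = 𝓡.nrm (𝓡.vec x) := rfl

theorem vec_eq_of_nrm_sub_nonpos {x y : Tm Ty.X} (h : 𝓡.nrm (𝓡.vec x - 𝓡.vec y) ≤ 0) :
    𝓡.vec x = 𝓡.vec y := by
  rw [← vec_vminus] at h
  exact 𝓡.vec_eq_iff.2 (le_antisymm h (𝓡.nm_minus_nonneg x y))

theorem nrm_zero : 𝓡.nrm 0 = 0 := by
  rw [← sub_self (𝓡.vec (.cst .zeroX)), ← vec_vminus]
  exact 𝓡.nm_self _

/-- The main property of resolvents, for `p = J_γ x` and `q = J_γ y`. -/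
theorem nrm_sub_le {g g' r : Tm Ty.one} {l : Tm Ty.nat} {p q x y : Tm Ty.X}
    (hg : 𝓡.real g = 𝓡.real g') (hl : 𝓡.e (𝔐.val l) < 𝓡.real g) (hr : 0 < 𝓡.real r)
    (hp : Fm.inA (vsmul (invR g l) (vminus x p)) p ∈ 𝔐.th)
    (hq : Fm.inA (vsmul (invR g' l) (vminus y q)) q ∈ 𝔐.th) :
    𝓡.nrm (𝓡.vec p - 𝓡.vec q) ≤ 𝓡.nrm (𝓡.vec p - 𝓡.vec q +
      𝓡.sm r ((𝓡.vec x - 𝓡.vec p) - (𝓡.vec y - 𝓡.vec q))) := by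
  have h0 : 0 < 𝓡.real g := (𝓡.e_pos _).trans hl
  have hi : 𝓡.real (invR g l) = (𝓡.real g)⁻¹ := 𝓡.real_invR (by rwa [abs_of_pos h0])
  -- The two memberships keep their own scalars `invR g l` and `invR g' l`; it is enough that these
  -- represent the same real.
  have hi' : 𝓡.real (invR g' l) = (𝓡.real g)⁻¹ := by
    rw [𝓡.real_invR (by rwa [← hg, abs_of_pos h0]), hg]
  have key {k : Tm Ty.one} (hk : 𝓡.real k = (𝓡.real g)⁻¹) (v : 𝓡.Vec) :
      𝓡.sm (absR (timesR r g)) (𝓡.sm k v) = 𝓡.sm r v := by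
    rw [← sm_timesR]
    refine 𝓡.sm_congr ?_ v
    simp only [real_timesR, real_absR, hk]
    rw [abs_of_pos (mul_pos hr h0), mul_assoc, mul_inv_cancel₀ h0.ne', mul_one]
  -- The scalar `r γ` is positive, so the absolute value in the accretivity axiom is harmless, and
  -- it cancels the factor `γ⁻¹` up to `r`.
  have h := 𝓡.nm_accretive (timesR r g) hp hq
  simp only [nrm_vec, vec_vplus, vec_vneg, ← sub_eq_add_neg, vec_vsmul, map_sub, key hi,
    key hi'] at h
  simpa only [map_sub] using h

theorem exists_tpow_lt {g : Tm Ty.one} (h : 0 < 𝓡.real g) :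
    ∃ l, 𝓡.e (𝔐.val l) < 𝓡.real g := by
  obtain ⟨n, hn⟩ := 𝓡.exists_e_lt h
  obtain ⟨l, rfl⟩ := 𝔐.exists_val n
  exact ⟨l, hn⟩

end Completion
end FinType
namespace FinType

/-- `V^ω` proves what holds in every model of the axioms on the normed space and the operator. -/
theorem VProves.of_model {φ : Fm}
    (h : ∀ 𝔐 : Model SpaceAxiom, Completion 𝔐 → φ.subst Tm.var ∈ 𝔐.th) : VProves φ := by
  -- Derivability without the choice axioms is already enough.
  refine (complete SpaceAxiom.subst fun 𝔐 => ?_).mono fun _ h => Or.inr h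
  obtain ⟨𝓡⟩ := Completion.exists_completion 𝔐
  simpa only [Fm.subst_id] using h 𝔐 𝓡

end FinType

/-! ### The properties of the resolvent -/

theorem mainTheorem7 :
    -- (1) uniqueness: `∀ γ p x l (γ > 2 ^ (-l) ∧ γ⁻¹ (x - p) ∈ A p → p = J_γ x)`
    VProves (allR (allX (allX (allN
      (Fm.ltR (tpowR (nv 0)) (rv 0) ⊓ᶠ
          Fm.inA (vsmul (invR (rv 0) (nv 0)) (vminus (xv 0) (xv 1))) (xv 1) ⇒ᶠ
        Fm.eqX (xv 1) (J (rv 0) (xv 0))))))) ∧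
    -- (2) firm nonexpansivity: `∀ γ r x y (γ > 0 ∧ r > 0 →`
    -- `‖J_γ x - J_γ y‖ ≤ ‖r (x - y) + (1 - r) (J_γ x - J_γ y)‖)`
    VProves (allR (allR (allX (allX
      (Fm.ltR zeroR (rv 1) ⊓ᶠ Fm.ltR zeroR (rv 0) ⇒ᶠ
        Fm.leR (vnorm (vminus (J (rv 1) (xv 1)) (J (rv 1) (xv 0))))
          (vnorm (vplus (vsmul (rv 0) (vminus (xv 1) (xv 0)))
            (vsmul (minusR oneR (rv 0))
              (vminus (J (rv 1) (xv 1)) (J (rv 1) (xv 0))))))))))) ∧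
    -- (3) nonexpansivity: `∀ γ x y (γ > 0 → ‖J_γ x - J_γ y‖ ≤ ‖x - y‖)`
    VProves (allR (allX (allX
      (Fm.ltR zeroR (rv 0) ⇒ᶠ
        Fm.leR (vnorm (vminus (J (rv 0) (xv 1)) (J (rv 0) (xv 0))))
          (vnorm (vminus (xv 1) (xv 0))))))) ∧
    -- (4) extensionality:
    -- `∀ γ γ' x x' (γ > 0 ∧ γ' > 0 ∧ x = x' ∧ γ = γ' → J_γ x = J_γ' x')`
    VProves (allR (allR (allX (allX
      (Fm.ltR zeroR (rv 1) ⊓ᶠ Fm.ltR zeroR (rv 0) ⊓ᶠ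
          Fm.eqX (xv 1) (xv 0) ⊓ᶠ Fm.eqR (rv 1) (rv 0) ⇒ᶠ
        Fm.eqX (J (rv 1) (xv 1)) (J (rv 0) (xv 0))))))) := by
  refine ⟨.of_model fun 𝔐 𝓡 => ?_, .of_model fun 𝔐 𝓡 => ?_, .of_model fun 𝔐 𝓡 => ?_,
    .of_model fun 𝔐 𝓡 => ?_⟩ <;> simp only [Model.all_subst_mem_iff]
  · intro g p x l
    simp [Sub.cons_of_ne, Model.imp_subst_mem_iff, Model.and_subst_mem_iff,
      𝓡.ltR_mem_iff, 𝓡.eqX_mem_iff_vec]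
    intro hl hp
    refine 𝓡.vec_eq_of_nrm_sub_nonpos ?_
    -- With `r = 1`, `y = x` and `q = J_γ x`, the right-hand side is the norm of `p - q + ((x - p) -
    -- (x - q)) = 0`.
    refine (𝓡.nrm_sub_le (r := oneR) rfl hl (by simp) hp (𝓡.inA_resolvent x hl)).trans_eq ?_
    rw [𝓡.sm_oneR, sub_sub_sub_cancel_left, add_comm, sub_add_sub_cancel, sub_self, 𝓡.nrm_zero]
  · intro g r x y
    simp [Sub.cons_of_ne, Model.imp_subst_mem_iff, Model.and_subst_mem_iff,
      𝓡.ltR_mem_iff, 𝓡.leR_mem_iff, 𝓡.nrm_vec]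
    intro hg hr
    -- The resolvent axiom speaks of the reciprocal only relative to a lower bound `2 ^ (-l)`, which
    -- positivity of `γ` supplies.
    obtain ⟨l, hl⟩ := 𝓡.exists_tpow_lt hg
    have h := 𝓡.nrm_sub_le rfl hl hr (𝓡.inA_resolvent x hl) (𝓡.inA_resolvent y hl)
    -- The vectors agree: `p - q + r ((x - p) - (y - q)) = r (x - y) + (1 - r) (p - q)`.
    refine h.trans_eq (congrArg 𝓡.nrm ?_)
    simp only [𝓡.sm_plusR, 𝓡.sm_negR, 𝓡.sm_oneR, map_sub]
    abel
  · intro g x y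
    simp [Sub.cons_of_ne, Model.imp_subst_mem_iff, 𝓡.ltR_mem_iff, 𝓡.leR_mem_iff, 𝓡.nrm_vec]
    intro hg
    obtain ⟨l, hl⟩ := 𝓡.exists_tpow_lt hg
    have h := 𝓡.nrm_sub_le (r := oneR) rfl hl (by simp) (𝓡.inA_resolvent x hl)
      (𝓡.inA_resolvent y hl)
    refine h.trans_eq (congrArg 𝓡.nrm ?_)
    rw [𝓡.sm_oneR]
    abel
  · intro g g' x y
    simp [Sub.cons_of_ne, Model.imp_subst_mem_iff, Model.and_subst_mem_iff,
      𝓡.ltR_mem_iff, 𝓡.eqR_mem_iff, 𝓡.eqX_mem_iff_vec]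
    intro hg hg' hxy hgg
    obtain ⟨l, hl⟩ := 𝓡.exists_tpow_lt hg
    -- The same `l` is admissible for both representatives, as they denote the same real. With `r =
    -- 1` and `x = x'` the bound is again the norm of `0`.
    have h := 𝓡.nrm_sub_le (r := oneR) hgg hl (by simp) (𝓡.inA_resolvent x hl)
      (𝓡.inA_resolvent y (hl.trans_eq hgg))
    refine 𝓡.vec_eq_of_nrm_sub_nonpos (h.trans_eq ?_)
    rw [𝓡.sm_oneR, hxy, sub_sub_sub_cancel_left, add_comm, sub_add_sub_cancel, sub_self, 𝓡.nrm_zero]
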